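/- An instance of Red-Blue Set Cover consists of $n$ red elements, $k$ blue elements and $m$ sets $S_1,\dots,S_m$ of red and blue elements; a feasible solution is a sub-collection whose union contains all blue elements, and its cost is the number of red elements in that union. For an integer $r$, reals $0<\beta<\alpha<r-1$ and a function $k:\mathbb N\to\mathbb N$, the Hypergraph Dense-vs-Random problem is: given an $r$-uniform hypergraph $G$ on $n$ vertices and the number $k=k(n)$, distinguish with probability $1-o(1)$ as $n\to\infty$ between (Random) $G$ is random, each $r$-subset of the vertices being an edge independently with probability $n^{\alpha-(r-1)}$, and (Dense) $G$ is an arbitrary $r$-uniform hypergraph in which some $k$ vertices induce a subhypergraph of average degree at least $k^{\beta}$. The Hypergraph Dense-vs-Random Conjecture states: for every constant $r$ and every $0<\alpha<r-1$, for all sufficiently small $\varepsilon'>0$ and every $k:\mathbb N\to\mathbb N$ that grows polynomially ($k(n)\ge n^{c}$ for some $c>0$ and all large $n$) and satisfies $k(n)^{1+\alpha-\varepsilon'}\le n^{(1+\alpha)/2}$ for all $n$, no randomized polynomial-time algorithm solves this problem with $\beta=\alpha-\varepsilon'$. Theorem. Assume the Hypergraph Dense-vs-Random Conjecture. Then for every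 $\varepsilon>0$ and every constant $C>0$ there is no randomized polynomial-time algorithm which, on every Red-Blue Set Cover instance that has a feasible solution and satisfies $2\le k\le m$, finds with probability at least $2/3$ a feasible solution of cost at most $$\max\left\{1,\ \frac{C\,m^{1/4-\varepsilon}}{\log_2^2 k}\right\}$$ times the optimal cost. (In particular there is no such algorithm, randomized or deterministic, for all instances of Red-Blue Set Cover.) -/

import Mathlib

open Filter

namespace RedBlue

/-! ### Randomized polynomial-time algorithms

The machine model is a structured multi-stack machine over the binary alphabet.  A program mentions
only finitely many stacks and every elementary operation does a constant amount of work, so running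
times agree, up to a polynomial, with those of multi-tape Turing machines. -/

/-- Contents of the stacks; the top of a stack is the head of the list. -/
abbrev Store := ℕ → List Bool

/-- Programs of the multi-stack machine. -/
inductive Prog : Type
  /-- do nothing -/
  | skip : Prog
  /-- push the bit `b` on stack `x` -/
  | push (x : ℕ) (b : Bool) : Prog
  /-- remove the top of stack `x` (no effect if `x` is empty) -/
  | pop (x : ℕ) : Prog
  /-- first `p`, then `q` -/
  | seq (p q : Prog) : Prog
  /-- branch: stack `x` is empty, has top `false`, has top `true` -/
  | branch (x : ℕ) (pEmpty pFalse pTrue : Prog) : Prog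
  /-- as long as stack `x` is not empty, execute `p` -/
  | loop (x : ℕ) (p : Prog) : Prog

/-- `Runs p s t s'`: started in store `s`, the program `p` halts after exactly `t` steps,
in store `s'`.  Every elementary operation and every test counts as one step. -/
inductive Runs : Prog → Store → ℕ → Store → Prop
  | skip (s : Store) : Runs .skip s 1 s
  | push (s : Store) (x : ℕ) (b : Bool) :
      Runs (.push x b) s 1 (Function.update s x (b :: s x))
  | pop (s : Store) (x : ℕ) : Runs (.pop x) s 1 (Function.update s x (s x).tail)
  | seq {p q : Prog} {s s' s'' : Store} {t t' : ℕ} :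
      Runs p s t s' → Runs q s' t' s'' → Runs (.seq p q) s (t + t') s''
  | branchEmpty {x : ℕ} {pe pf pt : Prog} {s s' : Store} {t : ℕ} :
      s x = [] → Runs pe s t s' → Runs (.branch x pe pf pt) s (t + 1) s'
  | branchFalse {x : ℕ} {pe pf pt : Prog} {s s' : Store} {t : ℕ} {l : List Bool} :
      s x = false :: l → Runs pf s t s' → Runs (.branch x pe pf pt) s (t + 1) s'
  | branchTrue {x : ℕ} {pe pf pt : Prog} {s s' : Store} {t : ℕ} {l : List Bool} :
      s x = true :: l → Runs pt s t s' → Runs (.branch x pe pf pt) s (t + 1) s'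
  | loopEnd {x : ℕ} {p : Prog} {s : Store} : s x = [] → Runs (.loop x p) s 1 s
  | loopStep {x : ℕ} {p : Prog} {s s' s'' : Store} {t t' : ℕ} :
      s x ≠ [] → Runs p s t s' → Runs (.loop x p) s' t' s'' → Runs (.loop x p) s (t + t' + 1) s''

/-- Initial store: the input on stack `0`, the random bits on stack `1`, all other stacks empty. -/
def initStore (input coins : List Bool) : Store
  | 0 => input
  | 1 => coins
  | _ => []

/-- A randomized polynomial-time algorithm for inputs of type `Inst`, presented to the machine
through `encode`.  On an input of length `L` the machine gets a string of `L ^ d + d` uniformly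
random bits and halts within `L ^ d + d` steps, whatever these bits are.
(A deterministic algorithm is one that does not look at stack `1`.) -/
structure RandPolyTimeAlg {Inst : Type} (encode : Inst → List Bool) where
  /-- the program -/
  prog : Prog
  /-- the exponent in the polynomial bounds -/
  d : ℕ
  /-- the running time is polynomially bounded -/
  halts : ∀ (I : Inst) (coins : Fin ((encode I).length ^ d + d) → Bool), ∃ (t : ℕ) (s : Store),
    Runs prog (initStore (encode I) (List.ofFn coins)) t s ∧ t ≤ (encode I).length ^ d + d

/-- The probability, over the random bits of the algorithm, that its output on input `I` (the
contents of stack `2` when it halts) has the property `E`. -/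
noncomputable def RandPolyTimeAlg.prob {Inst : Type} {encode : Inst → List Bool}
    (A : RandPolyTimeAlg encode) (I : Inst) (E : List Bool → Prop) : ℝ :=
  ({coins : Fin ((encode I).length ^ A.d + A.d) → Bool | ∃ (t : ℕ) (s : Store),
      Runs A.prog (initStore (encode I) (List.ofFn coins)) t s ∧ E (s 2)}.ncard : ℝ)
    / 2 ^ ((encode I).length ^ A.d + A.d)

/-- A natural number in self-delimiting unary. -/
def unary (a : ℕ) : List Bool := List.replicate a true ++ [false]

/-! ### Red-Blue Set Cover -/

/-- An instance of Red-Blue Set Cover: `n` red elements, `k` blue elements, and `m` sets, the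
`i`-th of which consists of the red elements `red i` and the blue elements `blue i`. -/
structure Instance where
  /-- number of sets -/
  m : ℕ
  /-- number of red elements -/
  n : ℕ
  /-- number of blue elements -/
  k : ℕ
  /-- red part of each set -/
  red : Fin m → Finset (Fin n)
  /-- blue part of each set -/
  blue : Fin m → Finset (Fin k)

namespace Instance

variable (I : Instance)

/-- The sub-collection `F` covers all blue elements. -/
def Covers (F : Finset (Fin I.m)) : Prop := F.biUnion I.blue = Finset.univ

/-- The number of red elements covered by the sub-collection `F`. -/
def cost (F : Finset (Fin I.m)) : ℕ := (F.biUnion I.red).card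

/-- The instance as a bit string: `m`, `n`, `k` in unary, then the incidence vectors of the sets. -/
def encode : List Bool :=
  unary I.m ++ unary I.n ++ unary I.k ++
    (List.finRange I.m).flatMap fun i =>
      (List.finRange I.n).map (fun v => decide (v ∈ I.red i)) ++
        (List.finRange I.k).map (fun b => decide (b ∈ I.blue i))

/-- The sub-collection described by an output string: bit `i` says whether set `i` is chosen. -/
def decodeSol (out : List Bool) : Finset (Fin I.m) :=
  Finset.univ.filter fun i => out[(i : ℕ)]? = some true

end Instance

/-- On every instance in `P` that has a feasible solution, `A` finds with probability at least
`2/3` a feasible solution whose cost is at most `ρ m k` times that of every feasible solution. -/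
def ApproximatesOn (A : RandPolyTimeAlg Instance.encode) (P : Set Instance) (ρ : ℕ → ℕ → ℝ) :
    Prop :=
  ∀ I ∈ P, (∃ F, I.Covers F) →
    2 / 3 ≤ A.prob I fun out =>
      I.Covers (I.decodeSol out) ∧
        ∀ F, I.Covers F → (I.cost (I.decodeSol out) : ℝ) ≤ ρ I.m I.k * I.cost F

/-! ### The Hypergraph Dense-vs-Random Conjecture -/

/-- `r`-uniform hypergraphs on `n` vertices, given by their sets of edges. -/
abbrev Hypergraph (r n : ℕ) := Finset {e : Finset (Fin n) // e.card = r}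

/-- An input of the Dense-vs-Random problem: a hypergraph together with the parameter `k`. -/
structure DvRInput (r : ℕ) where
  /-- number of vertices -/
  n : ℕ
  /-- size of the vertex sets that are looked for -/
  k : ℕ
  /-- the hypergraph -/
  G : Hypergraph r n

/-- The edges of a hypergraph, each one as the list of its vertices, in a canonical order. -/
def edgeList {r n : ℕ} (G : Hypergraph r n) : List (List (Fin n)) :=
  ((List.finRange n).sublistsLen r).filter fun l => decide (l.toFinset ∈ G.image Subtype.val)

/-- The input as a bit string: the number of edges, `n`, `k` in unary, then the incidence vectors
of the edges. -/
def DvRInput.encode {r : ℕ} (J : DvRInput r) : List Bool :=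
  unary (edgeList J.G).length ++ unary J.n ++ unary J.k ++
    (edgeList J.G).flatMap fun l => (List.finRange J.n).map fun v => decide (v ∈ l)

/-- The probability of `G` in the random model in which each of the `r`-element subsets of the
`n` vertices is an edge independently with probability `p`. -/
noncomputable def randomWeight {r n : ℕ} (p : ℝ) (G : Hypergraph r n) : ℝ :=
  p ^ G.card * (1 - p) ^ Gᶜ.card

/-- The average degree of the subhypergraph of `G` induced by the vertex set `S`. -/
noncomputable def avgDegree {r n : ℕ} (G : Hypergraph r n) (S : Finset (Fin n)) : ℝ :=
  (r * (G.filter fun e => e.val ⊆ S).card : ℝ) / S.card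

/-- Some `k` vertices of `G` induce a subhypergraph of average degree at least `k ^ β`. -/
def HasDense {r n : ℕ} (G : Hypergraph r n) (k : ℕ) (β : ℝ) : Prop :=
  ∃ S : Finset (Fin n), S.card = k ∧ (k : ℝ) ^ β ≤ avgDegree G S

/-- The output of a decision algorithm is "dense". -/
def saysDense (out : List Bool) : Prop := out.head? = some true

/-- With probability tending to `1` as the number `n` of vertices grows, `A` does not answer
"dense" on a random hypergraph with edge probability `n ^ (α - (r - 1))` (average degree about
`n ^ α`), and answers "dense" on every hypergraph with `n` vertices in which some `k n` vertices
induce average degree at least `(k n) ^ β`. -/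
def SolvesDvR {r : ℕ} (A : RandPolyTimeAlg (DvRInput.encode (r := r))) (α β : ℝ) (k : ℕ → ℕ) :
    Prop :=
  ∀ δ : ℝ, 0 < δ → ∀ᶠ n : ℕ in atTop,
    (∑ G : Hypergraph r n, randomWeight ((n : ℝ) ^ (α - ((r : ℝ) - 1))) G *
        A.prob ⟨n, k n, G⟩ saysDense ≤ δ) ∧
      ∀ G : Hypergraph r n, HasDense G (k n) β → 1 - δ ≤ A.prob ⟨n, k n, G⟩ saysDense

/-- The Hypergraph Dense-vs-Random Conjecture: for all constants `r` and `0 < α < r - 1`, all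
sufficiently small `ε > 0`, and every `k : ℕ → ℕ` that grows polynomially and satisfies
`k ^ (1 + α - ε) ≤ n ^ ((1 + α) / 2)`, no randomized polynomial-time algorithm distinguishes, with
high probability, random `r`-uniform hypergraphs of log-density `α` from those containing a
subhypergraph on `k` vertices of log-density at least `α - ε`. -/
def HypergraphDenseVsRandomConjecture : Prop :=
  ∀ (r : ℕ) (α : ℝ), 0 < α → α < (r : ℝ) - 1 →
    ∃ ε₀ : ℝ, 0 < ε₀ ∧ ∀ ε : ℝ, 0 < ε → ε < ε₀ → ∀ k : ℕ → ℕ,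
      (∃ c : ℝ, 0 < c ∧ ∀ᶠ n : ℕ in atTop, (n : ℝ) ^ c ≤ k n) →
      (∀ n : ℕ, (k n : ℝ) ^ (1 + α - ε) ≤ (n : ℝ) ^ ((1 + α) / 2)) →
      ¬ ∃ A : RandPolyTimeAlg (DvRInput.encode (r := r)), SolvesDvR A α (α - ε) k

end RedBlue

/-!
The proof turns an approximation algorithm `A` for Red-Blue Set Cover into an algorithm for the
Hypergraph Dense-vs-Random problem.  Given an `r`-uniform hypergraph with `n` vertices and `m`
edges, let `b` be the power `2 ^ (2 * k.size)`, so that `k ^ 2 < b ≤ 4 * k ^ 2`, and give every edge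
one of `b` colours at random.  This is a Red-Blue Set Cover instance (`drawn`): the red elements are the
vertices, the blue elements are the colours, and each edge is a set that contains its own vertices
and its colour.  Run `A` on it, and accept if the answer consists of at least `b` edges with fewer
than `b` vertices in their union.  The reduction answers "dense" if `m > n ^ 3 / b` or if one of
`2 * k.size` independent rounds accepts.

The parameters are `α = 1 + ε / 2`, `k = ⌊n ^ (1 / 2 - ε / 2)⌋` and a uniformity `r` with
`ε * r ≥ 5`; it may be assumed that `ε ≤ 1 / 16`.  Everything is meant for large `n`.

* In a random hypergraph the expected number of edges is at most `n ^ (2 + ε / 2)`, which is much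
  less than `n ^ 3 / b`, and with high probability no `b` edges lie in a set of `b` vertices, by a
  union bound (`sum_randomWeight_small_union_le`): as `b` is at most `4 * n ^ (1 - ε)`, the expected
  number of such configurations is at most `(n * b ^ r * p) ^ b`, where
  `n * b ^ r * p ≤ 4 ^ r * n ^ (3 + ε / 2 - ε * r)` tends to `0` because `r` is large.  On a
  hypergraph without them no output of `A` whatsoever makes a round accept
  (`IsReduction.random_le`).
* Let `S` be a set of `k` vertices that induces average degree at least `k ^ (α - ε')`, where
  `ε' ≤ ε / 4`.  Then `S` contains at least `k ^ (2 + ε / 4) / r` edges, which is so much more than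
  `b` that with probability at least `3 / 4` all colours occur among them
  (`eventually_dense_le`, `avg_not_covers_le`).  These edges are then a solution of cost at most
  `k`.  If `m ≤ n ^ 3 / b`, then `m ≤ 4 * n ^ (2 + ε)`, and the approximation ratio is at most `k`
  (`eventually_ratio_lt`).  Hence a successful run of `A` yields a solution of cost at most
  `k ^ 2 < b`, and it has at least `b` sets because each set has only one colour.  So each round
  accepts with probability at least `1 / 2`, and some round does with probability at least
  `1 - 2 ^ (-2 * k.size)` (`IsReduction.le_dense`).

The algorithm has to be an actual program of the multi-stack machine.  Its stacks are named by the
fields of the structure `Regs`, and the stacks of `A` are placed behind them (`Prog.shift`).  The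
lemmas `runsIn_*` describe the effect and the running time of its parts, and `runsIn_reduction`
those of the whole program.  The reduction gives `A` more random bits than it is entitled to, namely
a fixed power of the length of the input; since `A` stops in time, it cannot see the surplus
(`Runs.append_bottom`).
-/

namespace RedBlue

/-! ### Runs of programs -/

theorem Runs.deterministic {p : Prog} {s s₁ : Store} {t₁ : ℕ} (h : Runs p s t₁ s₁) :
    ∀ {t₂ : ℕ} {s₂ : Store}, Runs p s t₂ s₂ → t₁ = t₂ ∧ s₁ = s₂ := by
  induction h with
  | skip s => intro _ _ h; cases h; simp
  | push s x b => intro _ _ h; cases h; simp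
  | pop s x => intro _ _ h; cases h; simp
  | seq _ _ ih₁ ih₂ =>
    intro _ _ h
    cases h with
    | seq h₁ h₂ =>
      obtain ⟨rfl, rfl⟩ := ih₁ h₁
      obtain ⟨rfl, rfl⟩ := ih₂ h₂
      simp
  | branchEmpty hx _ ih =>
    intro _ _ h
    cases h with
    | branchEmpty _ h => obtain ⟨rfl, rfl⟩ := ih h; simp
    | branchFalse hx' _ => simp [hx] at hx'
    | branchTrue hx' _ => simp [hx] at hx'
  | branchFalse hx _ ih =>
    intro _ _ h
    cases h with
    | branchFalse _ h => obtain ⟨rfl, rfl⟩ := ih h; simp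
    | branchEmpty hx' _ => simp [hx] at hx'
    | branchTrue hx' _ => simp [hx] at hx'
  | branchTrue hx _ ih =>
    intro _ _ h
    cases h with
    | branchTrue _ h => obtain ⟨rfl, rfl⟩ := ih h; simp
    | branchFalse hx' _ => simp [hx] at hx'
    | branchEmpty hx' _ => simp [hx] at hx'
  | loopEnd hx =>
    intro _ _ h
    cases h with
    | loopEnd _ => simp
    | loopStep hx' _ _ => exact absurd hx hx'
  | loopStep hx _ _ ih₁ ih₂ =>
    intro _ _ h
    cases h with
    | loopEnd hx' => exact absurd hx' hx
    | loopStep _ h₁ h₂ =>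
      obtain ⟨rfl, rfl⟩ := ih₁ h₁
      obtain ⟨rfl, rfl⟩ := ih₂ h₂
      simp

/-- A stack grows by at most one bit per step. -/
theorem Runs.length_le {p : Prog} {s s' : Store} {t : ℕ} (h : Runs p s t s') (x : ℕ) :
    (s' x).length ≤ (s x).length + t := by
  induction h with
  | skip s => omega
  | push s y b =>
    by_cases hx : x = y
    · subst hx; simp
    · simp [hx]
  | pop s y =>
    by_cases hx : x = y
    · subst hx; simp; omega
    · simp [hx]
  | seq _ _ ih₁ ih₂ => omega
  | branchEmpty _ _ ih => omega
  | branchFalse _ _ ih => omega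
  | branchTrue _ _ ih => omega
  | loopEnd _ => omega
  | loopStep _ _ _ ih₁ ih₂ => omega

/-- A strict upper bound for the stacks that a program mentions. -/
def Prog.bound : Prog → ℕ
  | .skip => 0
  | .push x _ => x + 1
  | .pop x => x + 1
  | .seq p q => max p.bound q.bound
  | .branch x p q r => max (x + 1) (max p.bound (max q.bound r.bound))
  | .loop x p => max (x + 1) p.bound

theorem Runs.eq_of_bound_le {p : Prog} {s s' : Store} {t : ℕ} (h : Runs p s t s') {x : ℕ}
    (hx : p.bound ≤ x) : s' x = s x := by
  induction h with
  | skip s => rfl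
  | push s y b => simp only [Prog.bound] at hx; exact Function.update_of_ne (by omega) _ _
  | pop s y => simp only [Prog.bound] at hx; exact Function.update_of_ne (by omega) _ _
  | seq _ _ ih₁ ih₂ =>
    simp only [Prog.bound, max_le_iff] at hx
    rw [ih₂ hx.2, ih₁ hx.1]
  | branchEmpty _ _ ih => simp only [Prog.bound, max_le_iff] at hx; exact ih hx.2.1
  | branchFalse _ _ ih => simp only [Prog.bound, max_le_iff] at hx; exact ih hx.2.2.1
  | branchTrue _ _ ih => simp only [Prog.bound, max_le_iff] at hx; exact ih hx.2.2.2
  | loopEnd _ => rfl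
  | loopStep _ _ _ ih₁ ih₂ =>
    rw [ih₂ hx, ih₁ (by simp only [Prog.bound, max_le_iff] at hx; exact hx.2)]

/-- Within `t` steps a program cannot see what lies below the topmost `t` bits of a stack: a run
of length `t ≤ |s x|` is not affected by bits added at the bottom of stack `x`. -/
theorem Runs.append_bottom {p : Prog} {s s' : Store} {t : ℕ} (h : Runs p s t s') (x : ℕ)
    (l : List Bool) (hx : t ≤ (s x).length) :
    Runs p (Function.update s x (s x ++ l)) t (Function.update s' x (s' x ++ l)) ∧
      (s x).length ≤ (s' x).length + t := by
  induction h with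
  | skip s => exact ⟨.skip _, by omega⟩
  | push s y b =>
    by_cases hy : y = x
    · subst hy
      refine ⟨?_, by simp; omega⟩
      convert Runs.push (Function.update s y (s y ++ l)) y b using 1
      simp
    · refine ⟨?_, by simp [Ne.symm hy]⟩
      convert Runs.push (Function.update s x (s x ++ l)) y b using 1
      rw [Function.update_of_ne hy, Function.update_of_ne (Ne.symm hy), Function.update_comm hy]
  | pop s y =>
    by_cases hy : y = x
    · subst hy
      refine ⟨?_, by simp; omega⟩
      convert Runs.pop (Function.update s y (s y ++ l)) y using 1
      have : s y ≠ [] := by intro h; simp [h] at hx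
      simp [List.tail_append_of_ne_nil this]
    · refine ⟨?_, by simp [Ne.symm hy]⟩
      convert Runs.pop (Function.update s x (s x ++ l)) y using 1
      rw [Function.update_of_ne hy, Function.update_of_ne (Ne.symm hy), Function.update_comm hy]
  | seq _ _ ih₁ ih₂ =>
    obtain ⟨h₁, e₁⟩ := ih₁ (by omega)
    obtain ⟨h₂, e₂⟩ := ih₂ (by omega)
    exact ⟨.seq h₁ h₂, by omega⟩
  | @branchEmpty y _ _ _ s _ _ hy _ ih =>
    obtain ⟨h₁, e₁⟩ := ih (by omega)
    refine ⟨.branchEmpty ?_ h₁, by omega⟩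
    have : y ≠ x := by rintro rfl; simp [hy] at hx
    rw [Function.update_of_ne this, hy]
  | @branchFalse y _ _ _ s _ _ l' hy _ ih =>
    obtain ⟨h₁, e₁⟩ := ih (by omega)
    by_cases hyx : y = x
    · subst hyx
      exact ⟨.branchFalse (l := l' ++ l) (by simp [hy]) h₁, by omega⟩
    · exact ⟨.branchFalse (l := l') (by simp [hy, hyx]) h₁, by omega⟩
  | @branchTrue y _ _ _ s _ _ l' hy _ ih =>
    obtain ⟨h₁, e₁⟩ := ih (by omega)
    by_cases hyx : y = x
    · subst hyx
      exact ⟨.branchTrue (l := l' ++ l) (by simp [hy]) h₁, by omega⟩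
    · exact ⟨.branchTrue (l := l') (by simp [hy, hyx]) h₁, by omega⟩
  | @loopEnd y _ s hy =>
    refine ⟨.loopEnd ?_, by omega⟩
    have : y ≠ x := by rintro rfl; simp [hy] at hx
    rw [Function.update_of_ne this, hy]
  | @loopStep y _ s _ _ _ _ hy _ _ ih₁ ih₂ =>
    obtain ⟨h₁, e₁⟩ := ih₁ (by omega)
    obtain ⟨h₂, e₂⟩ := ih₂ (by omega)
    refine ⟨.loopStep ?_ h₁ h₂, by omega⟩
    by_cases hyx : y = x
    · subst hyx; simp [hy]
    · simp [hyx, hy]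

/-- The program `p`, moved to the stacks `a, a + 1, …`. -/
def Prog.shift (a : ℕ) : Prog → Prog
  | .skip => .skip
  | .push x b => .push (a + x) b
  | .pop x => .pop (a + x)
  | .seq p q => .seq (p.shift a) (q.shift a)
  | .branch x p q r => .branch (a + x) (p.shift a) (q.shift a) (r.shift a)
  | .loop x p => .loop (a + x) (p.shift a)

/-- The store that consists of the first `a` stacks of `u`, followed by the stacks of `s`. -/
def glue (a : ℕ) (u s : Store) : Store := fun x => if x < a then u x else s (x - a)

theorem glue_add (a : ℕ) (u s : Store) (x : ℕ) : glue a u s (a + x) = s x := by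
  simp [glue]

theorem update_glue_add (a : ℕ) (u s : Store) (x : ℕ) (l : List Bool) :
    Function.update (glue a u s) (a + x) l = glue a u (Function.update s x l) := by
  funext y
  by_cases hy : y = a + x
  · subst hy; simp [glue]
  · rw [Function.update_of_ne hy]
    by_cases h : y < a
    · simp [glue, h]
    · have : y - a ≠ x := by omega
      simp [glue, h, this]

theorem update_glue_lt {a x : ℕ} (hx : x < a) (u s : Store) (l : List Bool) :
    Function.update (glue a u s) x l = glue a (Function.update u x l) s := by
  funext y
  by_cases hy : y = x
  · subst hy; simp [glue, hx]
  · simp [glue, hy]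

theorem Runs.shift {p : Prog} {s s' : Store} {t : ℕ} (h : Runs p s t s') (a : ℕ) (u : Store) :
    Runs (p.shift a) (glue a u s) t (glue a u s') := by
  induction h with
  | skip s => exact .skip _
  | push s x b =>
    have := Runs.push (glue a u s) (a + x) b
    rwa [update_glue_add, glue_add] at this
  | pop s x =>
    have := Runs.pop (glue a u s) (a + x)
    rwa [update_glue_add, glue_add] at this
  | seq _ _ ih₁ ih₂ => exact .seq ih₁ ih₂
  | branchEmpty hx _ ih => exact .branchEmpty (by rwa [glue_add]) ih
  | branchFalse hx _ ih => exact .branchFalse (by rw [glue_add]; exact hx) ih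
  | branchTrue hx _ ih => exact .branchTrue (by rw [glue_add]; exact hx) ih
  | loopEnd hx => exact .loopEnd (by rwa [glue_add])
  | loopStep hx _ _ ih₁ ih₂ => exact .loopStep (by rwa [glue_add]) ih₁ ih₂

/-! ### Running times -/

/-- Started in store `s`, the program `p` halts in store `s'` after at most `T` steps. -/
def RunsIn (p : Prog) (s : Store) (T : ℕ) (s' : Store) : Prop := ∃ t ≤ T, Runs p s t s'

namespace RunsIn

variable {p q r : Prog} {s s' s'' : Store} {T T' x y c : ℕ}

theorem mono (h : RunsIn p s T s') (hT : T ≤ T') : RunsIn p s T' s' :=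
  let ⟨t, ht, h⟩ := h
  ⟨t, ht.trans hT, h⟩

theorem skip (s : Store) : RunsIn .skip s 1 s := ⟨1, le_rfl, .skip s⟩

theorem push (s : Store) (x : ℕ) (b : Bool) :
    RunsIn (.push x b) s 1 (Function.update s x (b :: s x)) := ⟨1, le_rfl, .push s x b⟩

theorem pop (s : Store) (x : ℕ) :
    RunsIn (.pop x) s 1 (Function.update s x (s x).tail) := ⟨1, le_rfl, .pop s x⟩

theorem seq (h : RunsIn p s T s') (h' : RunsIn q s' T' s'') :
    RunsIn (.seq p q) s (T + T') s'' :=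
  let ⟨t, ht, h⟩ := h
  let ⟨t', ht', h'⟩ := h'
  ⟨t + t', by omega, .seq h h'⟩

theorem branchEmpty (hx : s x = []) (h : RunsIn p s T s') :
    RunsIn (.branch x p q r) s (T + 1) s' :=
  let ⟨t, ht, h⟩ := h
  ⟨t + 1, by omega, .branchEmpty hx h⟩

theorem branchFalse {l : List Bool} (hx : s x = false :: l) (h : RunsIn q s T s') :
    RunsIn (.branch x p q r) s (T + 1) s' :=
  let ⟨t, ht, h⟩ := h
  ⟨t + 1, by omega, .branchFalse hx h⟩

theorem branchTrue {l : List Bool} (hx : s x = true :: l) (h : RunsIn r s T s') :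
    RunsIn (.branch x p q r) s (T + 1) s' :=
  let ⟨t, ht, h⟩ := h
  ⟨t + 1, by omega, .branchTrue hx h⟩

/-- A loop that runs `n` times, with an invariant `I i` before the `i`-th execution of its body. -/
theorem loop_of_invariant (I : ℕ → Store → Prop) {n : ℕ}
    (hstep : ∀ i < n, ∀ s, I i s → s x ≠ [] ∧ ∃ s', RunsIn p s T s' ∧ I (i + 1) s')
    (hend : ∀ s, I n s → s x = []) (s : Store) (h0 : I 0 s) :
    ∃ s', RunsIn (.loop x p) s (n * (T + 1) + 1) s' ∧ I n s' := by
  induction n generalizing I s with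
  | zero => exact ⟨s, ⟨1, by omega, .loopEnd (hend s h0)⟩, h0⟩
  | succ n ih =>
    obtain ⟨hx, s₁, ⟨t, ht, h⟩, h1⟩ := hstep 0 (by omega) s h0
    obtain ⟨s₂, ⟨t', ht', h'⟩, h2⟩ := ih (fun i => I (i + 1))
      (fun i hi => hstep (i + 1) (by omega)) hend s₁ h1
    refine ⟨s₂, ⟨t + t' + 1, ?_, .loopStep hx h h'⟩, h2⟩
    calc t + t' + 1 ≤ T + (n * (T + 1) + 1) + 1 := by omega
      _ = (n + 1) * (T + 1) + 1 := by ring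

/-- A loop that runs `n` times, where `f i` is the store before the `i`-th execution. -/
theorem loop (f : ℕ → Store) (n : ℕ) (hne : ∀ i < n, f i x ≠ [])
    (hstep : ∀ i < n, RunsIn p (f i) T (f (i + 1))) (hend : f n x = []) :
    RunsIn (.loop x p) (f 0) (n * (T + 1) + 1) (f n) := by
  obtain ⟨s', h, rfl⟩ := loop_of_invariant (fun i s => s = f i) (n := n) (x := x) (p := p) (T := T)
    (by rintro i hi _ rfl; exact ⟨hne i hi, _, hstep i hi, rfl⟩) (by rintro _ rfl; exact hend)
    (f 0) rfl
  exact h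

end RunsIn

theorem RunsIn.congr {p : Prog} {s s' s₂ : Store} {T T₂ : ℕ} (h : RunsIn p s T s') (hT : T ≤ T₂)
    (hs : s' = s₂) : RunsIn p s T₂ s₂ := hs ▸ h.mono hT

theorem RunsIn.congr_left {p : Prog} {s s' s₂ : Store} {T : ℕ} (h : RunsIn p s T s')
    (hs : s = s₂) : RunsIn p s₂ T s' := hs ▸ h

theorem RunsIn.loopEnd {p : Prog} {x : ℕ} {s : Store} (h : s x = []) : RunsIn (.loop x p) s 1 s :=
  ⟨1, le_rfl, .loopEnd h⟩

theorem RunsIn.loopStep {p : Prog} {x T T' : ℕ} {s s' s'' : Store} (hx : s x ≠ [])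
    (h : RunsIn p s T s') (h' : RunsIn (.loop x p) s' T' s'') :
    RunsIn (.loop x p) s (T + T' + 1) s'' :=
  let ⟨t, ht, h⟩ := h
  let ⟨t', ht', h'⟩ := h'
  ⟨t + t' + 1, by omega, .loopStep hx h h'⟩

/-! ### Basic programs -/

/-- Move the top of stack `x` to stack `y`. -/
def move1 (x y : ℕ) : Prog :=
  .branch x .skip (.seq (.pop x) (.push y false)) (.seq (.pop x) (.push y true))

theorem runsIn_move1 {x y : ℕ} (hxy : x ≠ y) {s : Store} {b : Bool} {l : List Bool}
    (hx : s x = b :: l) :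
    RunsIn (move1 x y) s 3 (Function.update (Function.update s x l) y (b :: s y)) := by
  cases b
  · refine .branchFalse hx ?_
    simpa [hx, Function.update_of_ne hxy.symm] using (RunsIn.pop s x).seq (.push _ y false)
  · refine .branchTrue hx ?_
    simpa [hx, Function.update_of_ne hxy.symm] using (RunsIn.pop s x).seq (.push _ y true)

/-- Move the contents of stack `x` to stack `y`, in reverse order. -/
def moveRev (x y : ℕ) : Prog := .loop x (move1 x y)

theorem runsIn_moveRev {x y : ℕ} (hxy : x ≠ y) (s : Store) :
    RunsIn (moveRev x y) s ((s x).length * 4 + 1)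
      (Function.update (Function.update s x []) y ((s x).reverse ++ s y)) := by
  have := RunsIn.loop (x := x) (p := move1 x y) (T := 3)
    (fun i => Function.update (Function.update s x ((s x).drop i)) y
      (((s x).take i).reverse ++ s y)) (s x).length
    (by intro i hi; simpa [Function.update_of_ne hxy] using hi)
    (by
      intro i hi
      have h := runsIn_move1 hxy (s := Function.update (Function.update s x ((s x).drop i)) y
        (((s x).take i).reverse ++ s y)) (b := (s x)[i]) (l := (s x).drop (i + 1))
        (by rw [Function.update_of_ne hxy]; simp)
      convert h using 1
      have e : (List.take (i + 1) (s x)).reverse = (s x)[i] :: (List.take i (s x)).reverse := by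
        rw [List.take_succ_eq_append_getElem hi, List.reverse_append]
        rfl
      rw [Function.update_comm hxy.symm, Function.update_idem, Function.update_idem, e]
      simp)
    (by simp [Function.update_of_ne hxy])
  simpa [moveRev] using this

/-- Empty stack `x`. -/
def clear (x : ℕ) : Prog := .loop x (.pop x)

theorem runsIn_clear (x : ℕ) (s : Store) :
    RunsIn (clear x) s ((s x).length * 2 + 1) (Function.update s x []) := by
  have := RunsIn.loop (x := x) (p := .pop x) (T := 1)
    (fun i => Function.update s x ((s x).drop i)) (s x).length
    (by intro i hi; simpa using hi)
    (by
      intro i hi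
      have h := RunsIn.pop (Function.update s x ((s x).drop i)) x
      simpa using h)
    (by simp)
  simpa [clear] using this

/-- Put a copy of the contents of stack `x` on top of stack `y`, by means of the empty auxiliary
stack `t`. -/
def copy (x t y : ℕ) : Prog :=
  .seq (moveRev x t) (.loop t (.branch t .skip
    (.seq (.pop t) (.seq (.push x false) (.push y false)))
    (.seq (.pop t) (.seq (.push x true) (.push y true)))))

theorem runsIn_copy {x t y : ℕ} (hxt : x ≠ t) (hxy : x ≠ y) (hty : t ≠ y) (s : Store)
    (ht : s t = []) :
    RunsIn (copy x t y) s ((s x).length * 9 + 2) (Function.update s y (s x ++ s y)) := by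
  have h1 := runsIn_moveRev hxt s
  rw [ht, List.append_nil] at h1
  set l := s x with hl
  have h2 := RunsIn.loop (x := t) (p := (.branch t .skip
    (.seq (.pop t) (.seq (.push x false) (.push y false)))
    (.seq (.pop t) (.seq (.push x true) (.push y true))))) (T := 4)
    (fun i => Function.update (Function.update (Function.update s t (l.reverse.drop i))
      x ((l.reverse.take i).reverse)) y ((l.reverse.take i).reverse ++ s y)) l.length
    (by intro i hi; simpa [Function.update_of_ne hty, Function.update_of_ne hxt.symm] using hi)
    (by
      intro i hi
      have hi' : i < l.reverse.length := by simpa using hi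
      simp only [List.take_succ_eq_append_getElem hi', List.drop_eq_getElem_cons hi']
      generalize l.reverse[i] = b
      generalize l.reverse.drop (i + 1) = l₁
      generalize l.reverse.take i = l₂
      have key : ∀ b, RunsIn (.seq (.pop t) (.seq (.push x b) (.push y b)))
          (Function.update (Function.update (Function.update s t (b :: l₁)) x l₂.reverse) y
            (l₂.reverse ++ s y)) 3
          (Function.update (Function.update (Function.update s t l₁) x
            (l₂ ++ [b]).reverse) y ((l₂ ++ [b]).reverse ++ s y)) := by
        intro b
        have h := (RunsIn.pop (Function.update (Function.update (Function.update s t (b :: l₁))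
          x l₂.reverse) y (l₂.reverse ++ s y)) t).seq ((RunsIn.push _ x b).seq (.push _ y b))
        convert h using 1
        funext i
        simp only [Function.update_apply]
        split_ifs <;> simp_all
      cases b
      · exact .branchFalse
          (by simp [Function.update_of_ne hty, Function.update_of_ne hxt.symm]; rfl) (key false)
      · exact .branchTrue
          (by simp [Function.update_of_ne hty, Function.update_of_ne hxt.symm]; rfl) (key true))
    (by simp [Function.update_of_ne hty, Function.update_of_ne hxt.symm])
  have e0 : Function.update (Function.update (Function.update s t (l.reverse.drop 0))
      x ((l.reverse.take 0).reverse)) y ((l.reverse.take 0).reverse ++ s y) =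
      Function.update (Function.update s x []) t l.reverse := by
    funext i
    simp only [Function.update_apply]
    split_ifs <;> simp_all
  have e1 : Function.update (Function.update (Function.update s t (l.reverse.drop l.length))
      x ((l.reverse.take l.length).reverse)) y ((l.reverse.take l.length).reverse ++ s y) =
      Function.update s y (l ++ s y) := by
    have : (l.reverse.take l.length).reverse = l := by
      rw [← List.length_reverse, List.take_length, List.reverse_reverse]
    rw [this]
    funext i
    simp only [Function.update_apply]
    split_ifs <;> simp_all
  simp only [e0, e1] at h2
  exact (h1.seq h2).mono (by omega)

/-- Execute `p` once for each bit on stack `x`, by means of the empty auxiliary stacks `t`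
and `c`. -/
def repeatBy (x t c : ℕ) (p : Prog) : Prog :=
  .seq (copy x t c) (.loop c (.seq (.pop c) p))

/-- The counter `c` is not part of the stores that the invariant `I` is about: during the
execution of `p` it may hold any list `l`, which `p` must not change. -/
theorem runsIn_repeatBy_of_invariant {x t c T n : ℕ} {p : Prog} (hxt : x ≠ t) (hxc : x ≠ c)
    (htc : t ≠ c) (I : ℕ → Store → Prop) (s : Store) (hn : (s x).length = n) (ht : s t = [])
    (hc : s c = [])
    (hstep : ∀ i < n, ∀ s, I i s → ∀ l, ∃ s', RunsIn p (Function.update s c l) T s' ∧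
      ∃ s'', s' = Function.update s'' c l ∧ I (i + 1) s'')
    (hI : ∀ s, I n s → s c = []) (h0 : I 0 s) :
    ∃ s', RunsIn (repeatBy x t c p) s (n * (T + 11) + 3) s' ∧ I n s' := by
  have h1 := runsIn_copy hxt hxc htc s ht
  rw [hc, List.append_nil] at h1
  obtain ⟨s', h2, s'', rfl, h3⟩ := RunsIn.loop_of_invariant (x := c) (p := .seq (.pop c) p)
    (T := 1 + T) (n := n)
    (fun i s' => ∃ s'', s' = Function.update s'' c ((s x).drop i) ∧ I i s'')
    (by
      rintro i hi _ ⟨s₁, rfl, h⟩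
      refine ⟨by simpa using by omega, ?_⟩
      obtain ⟨s₂, h2, s₃, rfl, h3⟩ := hstep i hi s₁ h ((s x).drop (i + 1))
      refine ⟨_, (RunsIn.pop _ c).seq ?_, s₃, rfl, h3⟩
      simpa using h2)
    (by
      rintro _ ⟨s'', rfl, _⟩
      simp [← hn])
    (Function.update s c (s x)) ⟨s, by simp, h0⟩
  refine ⟨_, (h1.seq h2).mono ?_, ?_⟩
  · rw [hn]
    apply le_of_eq
    ring
  · have := hI _ h3
    rw [← hn, List.drop_length, ← this, Function.update_eq_self, hn]
    exact h3

theorem runsIn_repeatBy {x t c T : ℕ} {p : Prog} (hxt : x ≠ t) (hxc : x ≠ c) (htc : t ≠ c)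
    (f : ℕ → Store) (n : ℕ) (hn : (f 0 x).length = n) (ht : f 0 t = []) (hc : f 0 c = [])
    (hcn : f n c = [])
    (hstep : ∀ i < n, ∀ l, RunsIn p (Function.update (f i) c l) T
      (Function.update (f (i + 1)) c l)) :
    RunsIn (repeatBy x t c p) (f 0) (n * (T + 11) + 3) (f n) := by
  obtain ⟨s', h, rfl⟩ := runsIn_repeatBy_of_invariant hxt hxc htc (fun i s => s = f i) (f 0) hn ht
    hc (T := T) (p := p)
    (by rintro i hi _ rfl l; exact ⟨_, hstep i hi l, _, rfl, rfl⟩) (by rintro _ rfl; exact hcn) rfl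
  exact h

/-! ### The registers of the reduction -/

/-- The stacks used by the reduction: `rows` holds the incidence vectors of the hypergraph (at first
the whole input), `coins` the random bits, `flag` the answer, `m`, `n`, `k` the parameters of the
input in unary, `u` the number `m + n + k + 2` in unary, `z` the number of colours in unary, `j` its
logarithm, `w` the number of random bits for one call of the approximation algorithm, `enc` the
(reversed) encoding of a Red-Blue Set Cover instance, `acc` the incidence vector of the red elements
covered by a solution, `cnt` the number of its sets, and `p` the truncated difference
`m * z - n ^ 3`.  The other named stacks are auxiliary.  `low` contains the stacks of the
approximation algorithm. -/
structure Regs where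
  (rows coins flag m n k u j z w t c1 c2 c3 c4 lz rz zc enc rows2 acc acc2 cnt p : List Bool)
  (low : Store)

/-- The named stacks, in order. -/
def Regs.toList (st : Regs) : List (List Bool) :=
  [st.rows, st.coins, st.flag, st.m, st.n, st.k, st.u, st.j, st.z, st.w, st.t, st.c1, st.c2, st.c3,
    st.c4, st.lz, st.rz, st.zc, st.enc, st.rows2, st.acc, st.acc2, st.cnt, st.p]

/-- The store with the named stacks in front of the stacks of the approximation algorithm. -/
def Regs.toStore (st : Regs) : Store := glue 24 (fun i => st.toList.getD i []) st.low

theorem update_getD (l : List (List Bool)) {x : ℕ} (hx : x < l.length) (v : List Bool) :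
    Function.update (fun i => l.getD i []) x v = fun i => (l.set x v).getD i [] := by
  funext i
  by_cases h : i = x
  · subst h; simp [hx]
  · simp [h, List.getElem?_set_ne (Ne.symm h)]

theorem Regs.update_toStore (st : Regs) {x : ℕ} (hx : x < 24) (v : List Bool) :
    Function.update st.toStore x v =
      glue 24 (fun i => (st.toList.set x v).getD i []) st.low := by
  rw [Regs.toStore, update_glue_lt hx, update_getD _ (by simpa [Regs.toList] using hx)]

/-! The positions of the named stacks in a store, and of the stacks `0`, `1`, `2` of the
approximation algorithm. -/

namespace Reg

abbrev rows : ℕ := 0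
abbrev coins : ℕ := 1
abbrev flag : ℕ := 2
abbrev m : ℕ := 3
abbrev n : ℕ := 4
abbrev k : ℕ := 5
abbrev u : ℕ := 6
abbrev j : ℕ := 7
abbrev z : ℕ := 8
abbrev w : ℕ := 9
abbrev t : ℕ := 10
abbrev c1 : ℕ := 11
abbrev c2 : ℕ := 12
abbrev c3 : ℕ := 13
abbrev c4 : ℕ := 14
abbrev lz : ℕ := 15
abbrev rz : ℕ := 16
abbrev zc : ℕ := 17
abbrev enc : ℕ := 18
abbrev rows2 : ℕ := 19
abbrev acc : ℕ := 20
abbrev acc2 : ℕ := 21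
abbrev cnt : ℕ := 22
abbrev p : ℕ := 23
abbrev aIn : ℕ := 24
abbrev aCoins : ℕ := 25
abbrev aOut : ℕ := 26

end Reg

namespace Regs

variable (st : Regs) (l : List Bool)

@[simp] theorem toStore_rows : st.toStore Reg.rows = st.rows := rfl
@[simp] theorem toStore_coins : st.toStore Reg.coins = st.coins := rfl
@[simp] theorem toStore_flag : st.toStore Reg.flag = st.flag := rfl
@[simp] theorem toStore_m : st.toStore Reg.m = st.m := rfl
@[simp] theorem toStore_n : st.toStore Reg.n = st.n := rfl
@[simp] theorem toStore_k : st.toStore Reg.k = st.k := rfl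
@[simp] theorem toStore_u : st.toStore Reg.u = st.u := rfl
@[simp] theorem toStore_j : st.toStore Reg.j = st.j := rfl
@[simp] theorem toStore_z : st.toStore Reg.z = st.z := rfl
@[simp] theorem toStore_w : st.toStore Reg.w = st.w := rfl
@[simp] theorem toStore_t : st.toStore Reg.t = st.t := rfl
@[simp] theorem toStore_c1 : st.toStore Reg.c1 = st.c1 := rfl
@[simp] theorem toStore_c2 : st.toStore Reg.c2 = st.c2 := rfl
@[simp] theorem toStore_c3 : st.toStore Reg.c3 = st.c3 := rfl
@[simp] theorem toStore_c4 : st.toStore Reg.c4 = st.c4 := rfl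
@[simp] theorem toStore_lz : st.toStore Reg.lz = st.lz := rfl
@[simp] theorem toStore_rz : st.toStore Reg.rz = st.rz := rfl
@[simp] theorem toStore_zc : st.toStore Reg.zc = st.zc := rfl
@[simp] theorem toStore_enc : st.toStore Reg.enc = st.enc := rfl
@[simp] theorem toStore_rows2 : st.toStore Reg.rows2 = st.rows2 := rfl
@[simp] theorem toStore_acc : st.toStore Reg.acc = st.acc := rfl
@[simp] theorem toStore_acc2 : st.toStore Reg.acc2 = st.acc2 := rfl
@[simp] theorem toStore_cnt : st.toStore Reg.cnt = st.cnt := rfl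
@[simp] theorem toStore_p : st.toStore Reg.p = st.p := rfl
@[simp] theorem toStore_aIn : st.toStore Reg.aIn = st.low 0 := rfl
@[simp] theorem toStore_aCoins : st.toStore Reg.aCoins = st.low 1 := rfl
@[simp] theorem toStore_aOut : st.toStore Reg.aOut = st.low 2 := rfl

@[simp] theorem update_rows :
    Function.update st.toStore Reg.rows l = { st with rows := l }.toStore :=
  st.update_toStore (by decide) l
@[simp] theorem update_coins :
    Function.update st.toStore Reg.coins l = { st with coins := l }.toStore :=
  st.update_toStore (by decide) l
@[simp] theorem update_flag :
    Function.update st.toStore Reg.flag l = { st with flag := l }.toStore :=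
  st.update_toStore (by decide) l
@[simp] theorem update_m :
    Function.update st.toStore Reg.m l = { st with m := l }.toStore :=
  st.update_toStore (by decide) l
@[simp] theorem update_n :
    Function.update st.toStore Reg.n l = { st with n := l }.toStore :=
  st.update_toStore (by decide) l
@[simp] theorem update_k :
    Function.update st.toStore Reg.k l = { st with k := l }.toStore :=
  st.update_toStore (by decide) l
@[simp] theorem update_u :
    Function.update st.toStore Reg.u l = { st with u := l }.toStore :=
  st.update_toStore (by decide) l
@[simp] theorem update_j :
    Function.update st.toStore Reg.j l = { st with j := l }.toStore :=
  st.update_toStore (by decide) l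
@[simp] theorem update_z :
    Function.update st.toStore Reg.z l = { st with z := l }.toStore :=
  st.update_toStore (by decide) l
@[simp] theorem update_w :
    Function.update st.toStore Reg.w l = { st with w := l }.toStore :=
  st.update_toStore (by decide) l
@[simp] theorem update_c1 :
    Function.update st.toStore Reg.c1 l = { st with c1 := l }.toStore :=
  st.update_toStore (by decide) l
@[simp] theorem update_c2 :
    Function.update st.toStore Reg.c2 l = { st with c2 := l }.toStore :=
  st.update_toStore (by decide) l
@[simp] theorem update_c3 :
    Function.update st.toStore Reg.c3 l = { st with c3 := l }.toStore :=
  st.update_toStore (by decide) l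
@[simp] theorem update_lz :
    Function.update st.toStore Reg.lz l = { st with lz := l }.toStore :=
  st.update_toStore (by decide) l
@[simp] theorem update_rz :
    Function.update st.toStore Reg.rz l = { st with rz := l }.toStore :=
  st.update_toStore (by decide) l
@[simp] theorem update_zc :
    Function.update st.toStore Reg.zc l = { st with zc := l }.toStore :=
  st.update_toStore (by decide) l
@[simp] theorem update_enc :
    Function.update st.toStore Reg.enc l = { st with enc := l }.toStore :=
  st.update_toStore (by decide) l
@[simp] theorem update_rows2 :
    Function.update st.toStore Reg.rows2 l = { st with rows2 := l }.toStore :=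
  st.update_toStore (by decide) l
@[simp] theorem update_acc :
    Function.update st.toStore Reg.acc l = { st with acc := l }.toStore :=
  st.update_toStore (by decide) l
@[simp] theorem update_acc2 :
    Function.update st.toStore Reg.acc2 l = { st with acc2 := l }.toStore :=
  st.update_toStore (by decide) l
@[simp] theorem update_cnt :
    Function.update st.toStore Reg.cnt l = { st with cnt := l }.toStore :=
  st.update_toStore (by decide) l
@[simp] theorem update_p :
    Function.update st.toStore Reg.p l = { st with p := l }.toStore :=
  st.update_toStore (by decide) l
@[simp] theorem update_aIn : Function.update st.toStore Reg.aIn l =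
    { st with low := Function.update st.low 0 l }.toStore :=
  update_glue_add 24 _ _ 0 l
@[simp] theorem update_aCoins : Function.update st.toStore Reg.aCoins l =
    { st with low := Function.update st.low 1 l }.toStore :=
  update_glue_add 24 _ _ 1 l
@[simp] theorem update_aOut : Function.update st.toStore Reg.aOut l =
    { st with low := Function.update st.low 2 l }.toStore :=
  update_glue_add 24 _ _ 2 l

end Regs

/-! ### Reading the input -/

/-- Move a self-delimiting unary number from stack `x` to stack `y`, by means of the empty auxiliary
stack `f`. -/
def readUnary (x f y : ℕ) : Prog :=
  .seq (.push f true) (.loop f (.branch x (.pop f) (.seq (.pop x) (.pop f))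
    (.seq (.pop x) (.push y true))))

theorem runsIn_readUnary {x f y : ℕ} (hxf : x ≠ f) (hxy : x ≠ y) (hfy : f ≠ y) (a : ℕ)
    (l : List Bool) (s : Store) (hx : s x = unary a ++ l) (hf : s f = []) :
    RunsIn (readUnary x f y) s (a * 4 + 6)
      (Function.update (Function.update s x l) y (List.replicate a true ++ s y)) := by
  have key : ∀ (a : ℕ) (s : Store), s x = unary a ++ l → s f = [true] →
      RunsIn (.loop f (.branch x (.pop f) (.seq (.pop x) (.pop f))
        (.seq (.pop x) (.push y true)))) s (a * 4 + 5)
        (Function.update (Function.update (Function.update s x l) f []) y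
          (List.replicate a true ++ s y)) := by
    intro a
    induction a with
    | zero =>
      intro s hx hf
      have h1 := (RunsIn.pop s x).seq (.pop _ f)
      refine (RunsIn.loopStep (x := f) (by simp [hf])
        (RunsIn.branchFalse (x := x) (p := .pop f) (r := .seq (.pop x) (.push y true)) (l := l)
          (by simp [hx, unary]) h1)
        (.loopEnd (by simp [hf, hxf.symm]))).congr (by omega) ?_
      funext i
      simp only [Function.update_apply]
      split_ifs <;> simp_all [unary]
    | succ a ih =>
      intro s hx hf
      have h1 := (RunsIn.pop s x).seq (.push _ y true)
      have h2 := RunsIn.loopStep (p := (.branch x (.pop f) (.seq (.pop x) (.pop f))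
        (.seq (.pop x) (.push y true)))) (x := f) (by simp [hf])
        (.branchTrue (l := unary a ++ l) (by simp [hx, unary, List.replicate_succ]) h1)
        (ih _ (by simp [hxy, hx, unary, List.replicate_succ]) (by simp [hfy, hxf.symm, hf]))
      refine h2.congr (by omega) ?_
      funext i
      simp only [Function.update_apply]
      split_ifs <;> simp_all [List.replicate_succ']
  have h := (RunsIn.push s f true).seq (key a _ (by simp [hx, hxf]) (by simp [hf]))
  refine h.congr (by omega) ?_
  funext i
  simp only [Function.update_apply]
  split_ifs <;> simp_all

/-- Replace the unary number on stack `k` by its half, rounded down. -/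
def halveK : Prog :=
  .seq (.loop Reg.k (.seq (.pop Reg.k) (.branch Reg.k .skip
    (.seq (.pop Reg.k) (.push Reg.c1 true)) (.seq (.pop Reg.k) (.push Reg.c1 true)))))
    (moveRev Reg.c1 Reg.k)

theorem runsIn_halveK (st : Regs) (a : ℕ) (hk : st.k = List.replicate a true) (hc : st.c1 = []) :
    RunsIn halveK st.toStore (a * 10 + 10)
      { st with k := List.replicate (a / 2) true }.toStore := by
  have h1 := RunsIn.loop (x := Reg.k) (p := (.seq (.pop Reg.k) (.branch Reg.k .skip
    (.seq (.pop Reg.k) (.push Reg.c1 true)) (.seq (.pop Reg.k) (.push Reg.c1 true))))) (T := 4)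
    (fun i => { st with k := List.replicate (a - 2 * i) true,
                        c1 := List.replicate (min i (a / 2)) true }.toStore) ((a + 1) / 2)
    (by intro i hi; simp; omega)
    (by
      intro i hi
      obtain ⟨c, hc⟩ : ∃ c, a - 2 * i = c + 1 := ⟨a - 2 * i - 1, by omega⟩
      rcases c with _ | c
      · have h1 := (RunsIn.pop { st with
            k := List.replicate (a - 2 * i) true
            c1 := List.replicate (min i (a / 2)) true }.toStore Reg.k).seq
          (RunsIn.branchEmpty (x := Reg.k) (q := (.seq (.pop Reg.k) (.push Reg.c1 true)))
            (r := (.seq (.pop Reg.k) (.push Reg.c1 true))) (by simp [hc]) (.skip _))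
        have e : a - 2 * (i + 1) = 0 := by omega
        have e' : min (i + 1) (a / 2) = min i (a / 2) := by omega
        simpa [hc, e, e'] using h1.mono (by omega : _ ≤ 4)
      · have h1 := (RunsIn.pop { st with
            k := List.replicate (a - 2 * i) true
            c1 := List.replicate (min i (a / 2)) true }.toStore Reg.k).seq
          (RunsIn.branchTrue (x := Reg.k) (p := .skip)
            (q := (.seq (.pop Reg.k) (.push Reg.c1 true)))
            (r := (.seq (.pop Reg.k) (.push Reg.c1 true))) (l := List.replicate c true)
            (by simp [hc, List.replicate_succ]) ((RunsIn.pop _ _).seq (.push _ _ _)))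
        have e : a - 2 * (i + 1) = c := by omega
        have e' : min (i + 1) (a / 2) = min i (a / 2) + 1 := by omega
        simpa [hc, e, e', List.replicate_succ] using h1)
    (by simp; omega)
  have e : min ((a + 1) / 2) (a / 2) = a / 2 := by omega
  have e' : a - 2 * ((a + 1) / 2) = 0 := by omega
  have h2 := h1.seq (runsIn_moveRev (by decide : Reg.c1 ≠ Reg.k) _)
  simp only [Nat.mul_zero, Nat.sub_zero, Nat.zero_min, List.replicate_zero, e, e', ← hk, ← hc] at h2
  refine h2.congr ?_ ?_
  · simp; omega
  · simp [hc]

/-- Put twice the number of binary digits of the unary number on stack `k` on stack `j`, in unary,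
and empty stack `k`. -/
def computeJ : Prog :=
  .loop Reg.k (.seq halveK (.seq (.push Reg.j true) (.push Reg.j true)))

theorem runsIn_computeJ (st : Regs) (a : ℕ) (hk : st.k = List.replicate a true) (hc : st.c1 = [])
    (hj : st.j = []) :
    RunsIn computeJ st.toStore (a.size * (a * 10 + 13) + 1)
      { st with k := [], j := List.replicate (2 * a.size) true }.toStore := by
  have h1 := RunsIn.loop (x := Reg.k)
    (p := .seq halveK (.seq (.push Reg.j true) (.push Reg.j true)))
    (T := a * 10 + 12)
    (fun i => { st with k := List.replicate (a / 2 ^ i) true,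
                        j := List.replicate (2 * i) true }.toStore) a.size
    (by
      intro i hi
      have := Nat.div_pos (Nat.lt_size.1 hi) (by positivity)
      simp only [Regs.toStore_k, ne_eq, List.replicate_eq_nil_iff]
      omega)
    (by
      intro i hi
      have h1 := (runsIn_halveK { st with k := List.replicate (a / 2 ^ i) true,
                                          j := List.replicate (2 * i) true } (a / 2 ^ i) rfl hc).seq
          ((RunsIn.push _ Reg.j true).seq (.push _ Reg.j true))
      have e : a / 2 ^ i / 2 = a / 2 ^ (i + 1) := by rw [Nat.div_div_eq_div_mul, pow_succ]
      have e2 : a / 2 ^ i ≤ a := Nat.div_le_self _ _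
      refine h1.congr (by omega) ?_
      simp [e, Nat.mul_add, List.replicate_succ])
    (by simpa using Nat.lt_size_self a)
  have e : a / 2 ^ a.size = 0 := Nat.div_eq_of_lt (Nat.lt_size_self a)
  exact (h1.congr_left (by cases st; simp_all)).congr le_rfl (by simp [e])

/-! ### Preparations -/

/-- Double the unary number on stack `z`. -/
def doubleZ : Prog :=
  .seq (moveRev Reg.z Reg.c2)
    (.loop Reg.c2 (.seq (.pop Reg.c2) (.seq (.push Reg.z true) (.push Reg.z true))))

theorem runsIn_doubleZ (st : Regs) (a : ℕ) (hz : st.z = List.replicate a true) (hc : st.c2 = []) :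
    RunsIn doubleZ st.toStore (a * 8 + 2) { st with z := List.replicate (2 * a) true }.toStore := by
  have h1 := runsIn_moveRev (by decide : Reg.z ≠ Reg.c2) st.toStore
  have h2 := RunsIn.loop (x := Reg.c2)
    (p := (.seq (.pop Reg.c2) (.seq (.push Reg.z true) (.push Reg.z true)))) (T := 3)
    (fun i => { st with c2 := List.replicate (a - i) true,
                        z := List.replicate (2 * i) true }.toStore) a
    (by intro i hi; simp; omega)
    (by
      intro i hi
      have h1 := (RunsIn.pop { st with c2 := List.replicate (a - i) true,
                                       z := List.replicate (2 * i) true }.toStore Reg.c2).seq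
        ((RunsIn.push _ Reg.z true).seq (.push _ Reg.z true))
      simpa [Nat.mul_add, List.replicate_succ, Nat.sub_sub] using h1)
    (by simp)
  refine (h1.seq (h2.congr_left (by simp [hz, hc]))).congr ?_ (by simp [hc])
  simp [hz]
  omega

/-- Put `2 ^ j` in unary on stack `z`, where `j` is the unary number on stack `j`. -/
def computeZ : Prog := .seq (.push Reg.z true) (repeatBy Reg.j Reg.t Reg.c1 doubleZ)

theorem runsIn_computeZ (st : Regs) (j : ℕ) (hj : st.j = List.replicate j true) (ht : st.t = [])
    (hz : st.z = []) (hc1 : st.c1 = []) (hc2 : st.c2 = []) :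
    RunsIn computeZ st.toStore (j * (2 ^ j * 8 + 13) + 4)
      { st with z := List.replicate (2 ^ j) true }.toStore := by
  have h1 := RunsIn.push st.toStore Reg.z true
  have h2 := runsIn_repeatBy (x := Reg.j) (t := Reg.t) (c := Reg.c1) (p := doubleZ)
    (T := 2 ^ j * 8 + 2) (by decide) (by decide) (by decide)
    (fun i => { st with z := List.replicate (2 ^ i) true }.toStore) j
    (by simp [hj]) (by simp [ht]) (by simp [hc1]) (by simp [hc1])
    (by
      intro i hi l
      have h := runsIn_doubleZ { st with z := List.replicate (2 ^ i) true, c1 := l } (2 ^ i) rfl hc2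
      have : 2 ^ i ≤ 2 ^ j := Nat.pow_le_pow_right (by norm_num) hi.le
      simpa [pow_succ'] using h.mono (by omega : _ ≤ 2 ^ j * 8 + 2))
  exact (h1.seq (h2.congr_left (by simp [hz]))).congr (le_of_eq (by ring)) rfl

/-- Multiply the unary number on stack `w` by the one on stack `u`. -/
def mulW : Prog :=
  .seq (moveRev Reg.w Reg.c2) (.loop Reg.c2 (.seq (.pop Reg.c2) (copy Reg.u Reg.t Reg.w)))

theorem runsIn_mulW (st : Regs) (a b : ℕ) (hw : st.w = List.replicate a true)
    (hu : st.u = List.replicate b true) (ht : st.t = []) (hc : st.c2 = []) :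
    RunsIn mulW st.toStore (a * (b * 9 + 8) + 2)
      { st with w := List.replicate (a * b) true }.toStore := by
  have h1 := runsIn_moveRev (by decide : Reg.w ≠ Reg.c2) st.toStore
  have h2 := RunsIn.loop (x := Reg.c2)
    (p := (.seq (.pop Reg.c2) (copy Reg.u Reg.t Reg.w))) (T := b * 9 + 3)
    (fun i => { st with c2 := List.replicate (a - i) true,
                        w := List.replicate (i * b) true }.toStore) a
    (by intro i hi; simp; omega)
    (by
      intro i hi
      have h1 := (RunsIn.pop { st with c2 := List.replicate (a - i) true,
                                       w := List.replicate (i * b) true }.toStore Reg.c2).seq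
        (runsIn_copy (by decide : Reg.u ≠ Reg.t) (by decide : Reg.u ≠ Reg.w) (by decide) _
          (by simp [ht]))
      refine h1.congr ?_ ?_
      · simp [hu]; omega
      · simp [hu, Nat.add_mul, Nat.add_comm, Nat.sub_sub])
    (by simp)
  refine (h1.seq (h2.congr_left (by simp [hw, hc]))).congr ?_ (by simp [hc])
  simp [hw]
  nlinarith

/-- Put the `e`-th power of the unary number on stack `u` on stack `w`. -/
def computeW : ℕ → Prog
  | 0 => .push Reg.w true
  | e + 1 => .seq (computeW e) mulW

theorem runsIn_computeW (st : Regs) (b e : ℕ) (hw : st.w = [])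
    (hu : st.u = List.replicate b true) (hb : 0 < b) (ht : st.t = []) (hc : st.c2 = []) :
    RunsIn (computeW e) st.toStore (e * (b ^ e * 17 + 2) + 1)
      { st with w := List.replicate (b ^ e) true }.toStore := by
  induction e with
  | zero => simpa [hw, computeW] using RunsIn.push st.toStore Reg.w true
  | succ e ih =>
    have h := runsIn_mulW { st with w := List.replicate (b ^ e) true } (b ^ e) b rfl hu ht hc
    refine (ih.seq h).mono ?_
    have h1 : b ^ e ≤ b ^ (e + 1) := Nat.pow_le_pow_right hb (by omega)
    have h2 : b ^ e * (b * 9 + 8) = b ^ (e + 1) * 9 + b ^ e * 8 := by ring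
    have h3 : e * (b ^ e * 17 + 2) ≤ e * (b ^ (e + 1) * 17 + 2) := by gcongr
    rw [h2]
    nlinarith

/-- Put `m * z - n ^ 3` in unary on stack `p`. -/
def computeP : Prog :=
  .seq (repeatBy Reg.m Reg.t Reg.c1 (copy Reg.z Reg.t Reg.p))
    (repeatBy Reg.n Reg.t Reg.c1 (repeatBy Reg.n Reg.t Reg.c2
      (repeatBy Reg.n Reg.t Reg.c3 (.pop Reg.p))))

theorem runsIn_computeP (st : Regs) (m n b : ℕ) (hm : st.m = List.replicate m true)
    (hn : st.n = List.replicate n true) (hz : st.z = List.replicate b true) (ht : st.t = [])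
    (hc1 : st.c1 = []) (hc2 : st.c2 = []) (hc3 : st.c3 = []) (hp : st.p = []) :
    RunsIn computeP st.toStore (m * (b * 9 + 13) + 3 + (n * (n * (n * 12 + 14) + 14) + 3))
      { st with p := List.replicate (m * b - n * (n * n)) true }.toStore := by
  have h1 := runsIn_repeatBy (x := Reg.m) (t := Reg.t) (c := Reg.c1) (p := copy Reg.z Reg.t Reg.p)
    (T := b * 9 + 2) (by decide) (by decide) (by decide)
    (fun i => { st with p := List.replicate (i * b) true }.toStore) m
    (by simp [hm]) (by simp [ht]) (by simp [hc1]) (by simp [hc1])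
    (by
      intro i hi l
      have h := runsIn_copy (by decide : Reg.z ≠ Reg.t) (by decide : Reg.z ≠ Reg.p) (by decide)
        { st with p := List.replicate (i * b) true, c1 := l }.toStore (by simp [ht])
      simpa [hz, Nat.add_mul, Nat.add_comm] using h)
  have k3 : ∀ st : Regs, st.n = List.replicate n true → st.t = [] → st.c3 = [] →
      RunsIn (repeatBy Reg.n Reg.t Reg.c3 (.pop Reg.p)) st.toStore (n * 12 + 3)
        { st with p := st.p.drop n }.toStore := by
    intro st hn ht hc
    have h := runsIn_repeatBy (x := Reg.n) (t := Reg.t) (c := Reg.c3) (p := .pop Reg.p)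
      (T := 1) (by decide) (by decide) (by decide)
      (fun i => { st with p := st.p.drop i }.toStore) n
      (by simp [hn]) (by simp [ht]) (by simp [hc]) (by simp [hc])
      (by
        intro i hi l
        have h := RunsIn.pop { st with p := st.p.drop i, c3 := l }.toStore Reg.p
        simpa using h)
    simpa using h
  have k2 : ∀ st : Regs, st.n = List.replicate n true → st.t = [] → st.c2 = [] → st.c3 = [] →
      RunsIn (repeatBy Reg.n Reg.t Reg.c2 (repeatBy Reg.n Reg.t Reg.c3 (.pop Reg.p))) st.toStore
        (n * (n * 12 + 14) + 3) { st with p := st.p.drop (n * n) }.toStore := by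
    intro st hn ht hc2 hc3
    have h := runsIn_repeatBy (x := Reg.n) (t := Reg.t) (c := Reg.c2)
      (p := repeatBy Reg.n Reg.t Reg.c3 (.pop Reg.p))
      (T := n * 12 + 3) (by decide) (by decide) (by decide)
      (fun i => { st with p := st.p.drop (i * n) }.toStore) n
      (by simp [hn]) (by simp [ht]) (by simp [hc2]) (by simp [hc2])
      (by
        intro i hi l
        simpa [Nat.add_mul] using k3 { st with p := st.p.drop (i * n), c2 := l } hn ht hc3)
    simpa using h
  have h3 := runsIn_repeatBy (x := Reg.n) (t := Reg.t) (c := Reg.c1)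
    (p := repeatBy Reg.n Reg.t Reg.c2 (repeatBy Reg.n Reg.t Reg.c3 (.pop Reg.p)))
    (T := n * (n * 12 + 14) + 3) (by decide) (by decide) (by decide)
    (fun i => { st with p := (List.replicate (m * b) true).drop (i * (n * n)) }.toStore) n
    (by simp [hn]) (by simp [ht]) (by simp [hc1]) (by simp [hc1])
    (by
      intro i hi l
      simpa [Nat.add_mul, Nat.sub_sub] using k2 { st with
        p := (List.replicate (m * b) true).drop (i * (n * n)), c1 := l } hn ht hc2 hc3)
  refine ((h1.congr_left (by cases st; simp_all)).seq (h3.congr_left (by simp))).congr le_rfl ?_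
  simp

/-! ### Writing down a random Red-Blue Set Cover instance -/

/-- The natural number with binary digits `l`, least significant digit first. -/
def colour : List Bool → ℕ
  | [] => 0
  | b :: l => b.toNat + 2 * colour l

theorem colour_lt (l : List Bool) : colour l < 2 ^ l.length := by
  induction l with
  | nil => simp [colour]
  | cons b l ih => cases b <;> simp [colour, pow_succ'] <;> omega

theorem colour_concat (l : List Bool) (b : Bool) :
    colour (l ++ [b]) = colour l + 2 ^ l.length * b.toNat := by
  induction l with
  | nil => simp [colour]
  | cons c l ih => simp only [List.cons_append, colour, ih, List.length_cons, pow_succ']; ring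

/-- The incidence vector of the set `{colour l}` in `{0, …, 2 ^ l.length - 1}`. -/
def oneHot (l : List Bool) : List Bool :=
  List.replicate (colour l) false ++
    true :: List.replicate (2 ^ l.length - 1 - colour l) false

/-- The `i`-th block of length `N` of the list `l`. -/
def block (N : ℕ) (l : List Bool) (i : ℕ) : List Bool := (l.drop (i * N)).take N

/-- The encoding of the Red-Blue Set Cover instance with `2 ^ j` blue elements whose `i`-th set has
the red elements given by the `i`-th row of `R` and the blue element given by the `i`-th block
of coins. -/
def encodeList (m N j : ℕ) (R coins : List Bool) : List Bool :=
  unary m ++ unary N ++ unary (2 ^ j) ++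
    (List.range m).flatMap fun i => block N R i ++ oneHot (block j coins i)

/-- Push as many zeros on stack `y` as there are ones on stack `zc`, and double the latter. -/
def addDouble (y : ℕ) : Prog :=
  .seq (.loop Reg.zc (.seq (.pop Reg.zc) (.seq (.push Reg.c4 true) (.seq (.push Reg.c4 true)
    (.push y false))))) (moveRev Reg.c4 Reg.zc)

theorem runsIn_addDouble {y : ℕ} (hy : y ≠ Reg.zc) (hy' : y ≠ Reg.c4) (s : Store) (a : ℕ)
    (hz : s Reg.zc = List.replicate a true) (hc : s Reg.c4 = []) :
    RunsIn (addDouble y) s (a * 13 + 2) (Function.update (Function.update s y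
      (List.replicate a false ++ s y)) Reg.zc (List.replicate (2 * a) true)) := by
  have h1 := RunsIn.loop (x := Reg.zc) (p := (.seq (.pop Reg.zc) (.seq (.push Reg.c4 true)
    (.seq (.push Reg.c4 true) (.push y false))))) (T := 4)
    (fun i => Function.update (Function.update (Function.update s y
      (List.replicate i false ++ s y)) Reg.zc (List.replicate (a - i) true)) Reg.c4
      (List.replicate (2 * i) true)) a
    (by intro i hi; simp; omega)
    (by
      intro i hi
      have h := (RunsIn.pop (Function.update (Function.update (Function.update s y
        (List.replicate i false ++ s y)) Reg.zc (List.replicate (a - i) true)) Reg.c4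
        (List.replicate (2 * i) true)) Reg.zc).seq ((RunsIn.push _ Reg.c4 true).seq
        ((RunsIn.push _ Reg.c4 true).seq (.push _ y false)))
      refine h.congr le_rfl ?_
      clear h
      have e : List.replicate (2 * (i + 1)) true =
          true :: true :: List.replicate (2 * i) true := rfl
      have e' : List.replicate (i + 1) false = false :: List.replicate i false := rfl
      have e'' : (List.replicate (a - i) true).tail = List.replicate (a - (i + 1)) true := by
        simp [Nat.sub_sub]
      rw [e, e', ← e'']
      generalize List.replicate (a - i) true = l₁
      generalize List.replicate (2 * i) true = l₂
      funext x
      by_cases h1 : x = y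
      · subst h1
        simp [hy, hy']
      · by_cases h2 : x = Reg.zc
        · subst h2
          simp [hy.symm]
        · by_cases h3 : x = Reg.c4
          · subst h3
            simp [hy'.symm]
          · simp [h1, h2, h3])
    (by simp)
  have h2 := h1.seq (runsIn_moveRev (by decide : Reg.c4 ≠ Reg.zc) _)
  refine (h2.congr_left ?_).congr ?_ ?_
  · funext x
    simp only [Function.update_apply]
    split_ifs <;> simp_all
  · simp; omega
  · funext x
    simp only [Function.update_apply]
    split_ifs <;> simp_all

/-- Read one more binary digit of a random colour: stack `lz` counts the zeros in front of the one
of its incidence vector, stack `rz` those after it. -/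
def drawBit : Prog :=
  .branch Reg.coins .skip (.seq (.pop Reg.coins) (addDouble Reg.rz))
    (.seq (.pop Reg.coins) (addDouble Reg.lz))

theorem runsIn_drawBit (st : Regs) (b : Bool) (l : List Bool) (a : ℕ) (hl : st.coins = b :: l)
    (hz : st.zc = List.replicate a true) (hc : st.c4 = []) :
    RunsIn drawBit st.toStore (a * 13 + 4) { st with
      coins := l
      zc := List.replicate (2 * a) true
      lz := List.replicate (a * b.toNat) false ++ st.lz
      rz := List.replicate (a * (!b).toNat) false ++ st.rz }.toStore := by
  cases b
  · refine (RunsIn.branchFalse (by simpa using hl) ((RunsIn.pop _ _).seq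
      (runsIn_addDouble (by decide) (by decide) _ a (by simpa using hz) (by simpa using hc)))).congr
      (by omega) (by simp [hl])
  · refine (RunsIn.branchTrue (by simpa using hl) ((RunsIn.pop _ _).seq
      (runsIn_addDouble (by decide) (by decide) _ a (by simpa using hz) (by simpa using hc)))).congr
      (by omega) (by simp [hl])

/-- Append the incidence vector of a random colour to the encoding. -/
def drawColour : Prog :=
  .seq (.push Reg.zc true) (.seq (repeatBy Reg.j Reg.t Reg.c3 drawBit)
    (.seq (moveRev Reg.lz Reg.enc) (.seq (.push Reg.enc true)
      (.seq (moveRev Reg.rz Reg.enc) (clear Reg.zc)))))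

theorem runsIn_drawColour (st : Regs) (j : ℕ) (hj : st.j = List.replicate j true)
    (hl : j ≤ st.coins.length) (hz : st.zc = []) (hlz : st.lz = []) (hrz : st.rz = [])
    (ht : st.t = []) (hc3 : st.c3 = []) (hc4 : st.c4 = []) :
    RunsIn drawColour st.toStore (j * (2 ^ j * 13 + 15) + 2 ^ j * 10 + 8) { st with
      coins := st.coins.drop j
      enc := (oneHot (st.coins.take j)).reverse ++ st.enc }.toStore := by
  have h1 := RunsIn.push st.toStore Reg.zc true
  have h2 := runsIn_repeatBy (x := Reg.j) (t := Reg.t) (c := Reg.c3) (p := drawBit)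
    (T := 2 ^ j * 13 + 4) (by decide) (by decide) (by decide)
    (fun i => { st with
      coins := st.coins.drop i
      zc := List.replicate (2 ^ i) true
      lz := List.replicate (colour (st.coins.take i)) false
      rz := List.replicate (2 ^ i - 1 - colour (st.coins.take i)) false }.toStore) j
    (by simp [hj]) (by simp [ht]) (by simp [hc3]) (by simp [hc3])
    (by
      intro i hi l
      have hi' : i < st.coins.length := by omega
      have h := runsIn_drawBit { st with
        coins := st.coins.drop i
        zc := List.replicate (2 ^ i) true
        lz := List.replicate (colour (st.coins.take i)) false
        rz := List.replicate (2 ^ i - 1 - colour (st.coins.take i)) false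
        c3 := l } st.coins[i] (st.coins.drop (i + 1)) (2 ^ i) (by simp) rfl hc4
      have hp : 2 ^ i ≤ 2 ^ j := Nat.pow_le_pow_right (by norm_num) hi.le
      have hcl := colour_lt (st.coins.take i)
      rw [List.length_take, min_eq_left hi'.le] at hcl
      have e1 : colour (st.coins.take (i + 1)) =
          colour (st.coins.take i) + 2 ^ i * (st.coins[i]).toNat := by
        rw [List.take_succ_eq_append_getElem hi', colour_concat, List.length_take,
          min_eq_left hi'.le]
      refine (h.congr_left (by simp)).congr (by omega) ?_
      simp only [e1, List.replicate_append_replicate, Regs.update_c3, pow_succ']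
      congr 3
      · ring
      · cases st.coins[i] <;> simp <;> omega)
  have h3 := runsIn_moveRev (by decide : Reg.lz ≠ Reg.enc) ({ st with
      coins := st.coins.drop j
      zc := List.replicate (2 ^ j) true
      lz := List.replicate (colour (st.coins.take j)) false
      rz := List.replicate (2 ^ j - 1 - colour (st.coins.take j)) false }.toStore)
  have hcl := colour_lt (st.coins.take j)
  have hlen : (st.coins.take j).length = j := by simpa using hl
  rw [hlen] at hcl
  refine (h1.seq ((h2.congr_left ?_).seq (h3.seq ((RunsIn.push _ Reg.enc true).seq
    ((runsIn_moveRev (by decide : Reg.rz ≠ Reg.enc) _).seq (runsIn_clear Reg.zc _)))))).congr ?_ ?_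
  · clear h1 h2 h3
    cases st
    simp_all [colour]
  · simp; ring_nf; omega
  · clear h1 h2 h3
    cases st
    simp_all [oneHot]

/-- Copy the next row of the hypergraph to the encoding, and keep it on stack `rows2`. -/
def copyRow : Prog :=
  repeatBy Reg.n Reg.t Reg.c3 (.branch Reg.rows .skip
    (.seq (.pop Reg.rows) (.seq (.push Reg.rows2 false) (.push Reg.enc false)))
    (.seq (.pop Reg.rows) (.seq (.push Reg.rows2 true) (.push Reg.enc true))))

theorem runsIn_copyRow (st : Regs) (n : ℕ) (hn : st.n = List.replicate n true)
    (hl : n ≤ st.rows.length) (ht : st.t = []) (hc3 : st.c3 = []) :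
    RunsIn copyRow st.toStore (n * 15 + 3) { st with
      rows := st.rows.drop n
      rows2 := (st.rows.take n).reverse ++ st.rows2
      enc := (st.rows.take n).reverse ++ st.enc }.toStore := by
  have h := runsIn_repeatBy (x := Reg.n) (t := Reg.t) (c := Reg.c3) (p := .branch Reg.rows .skip
    (.seq (.pop Reg.rows) (.seq (.push Reg.rows2 false) (.push Reg.enc false)))
    (.seq (.pop Reg.rows) (.seq (.push Reg.rows2 true) (.push Reg.enc true))))
    (T := 4) (by decide) (by decide) (by decide)
    (fun i => { st with
      rows := st.rows.drop i
      rows2 := (st.rows.take i).reverse ++ st.rows2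
      enc := (st.rows.take i).reverse ++ st.enc }.toStore) n
    (by simp [hn]) (by simp [ht]) (by simp [hc3]) (by simp [hc3])
    (by
      intro i hi l
      have hi' : i < st.rows.length := by omega
      simp only [List.take_succ_eq_append_getElem hi', List.drop_eq_getElem_cons hi']
      generalize st.rows[i] = b
      generalize st.rows.drop (i + 1) = l₁
      generalize st.rows.take i = l₂
      cases b
      · refine (RunsIn.branchFalse (l := l₁) (by simp) ((RunsIn.pop _ _).seq
          ((RunsIn.push _ _ _).seq (RunsIn.push _ _ _)))).congr (by omega) (by simp)
      · refine (RunsIn.branchTrue (l := l₁) (by simp) ((RunsIn.pop _ _).seq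
          ((RunsIn.push _ _ _).seq (RunsIn.push _ _ _)))).congr (by omega) (by simp))
  simpa [copyRow] using h

theorem block_length {N i : ℕ} {l : List Bool} (h : (i + 1) * N ≤ l.length) :
    (block N l i).length = N := by
  simp only [block, List.length_take, List.length_drop]
  have : (i + 1) * N = i * N + N := by ring
  omega

theorem take_succ_mul (N i : ℕ) (l : List Bool) :
    l.take ((i + 1) * N) = l.take (i * N) ++ block N l i := by
  rw [Nat.add_mul, one_mul, List.take_add, block]

/-- Write the encoding of the random instance, in reverse order, on stack `enc`. -/
def encodeInstance : Prog :=
  .seq (.seq (copy Reg.m Reg.t Reg.enc) (.push Reg.enc false))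
    (.seq (.seq (copy Reg.n Reg.t Reg.enc) (.push Reg.enc false))
      (.seq (.seq (copy Reg.z Reg.t Reg.enc) (.push Reg.enc false))
        (.seq (repeatBy Reg.m Reg.t Reg.c2 (.seq copyRow drawColour))
          (moveRev Reg.rows2 Reg.rows))))

theorem runsIn_encodeInstance (st : Regs) (m n j : ℕ) (hm : st.m = List.replicate m true)
    (hn : st.n = List.replicate n true) (hj : st.j = List.replicate j true)
    (hz : st.z = List.replicate (2 ^ j) true) (hrows : st.rows.length = m * n)
    (hcoins : m * j ≤ st.coins.length) (henc : st.enc = []) (hr2 : st.rows2 = [])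
    (hzc : st.zc = []) (hlz : st.lz = []) (hrz : st.rz = []) (ht : st.t = []) (hc2 : st.c2 = [])
    (hc3 : st.c3 = []) (hc4 : st.c4 = []) :
    RunsIn encodeInstance st.toStore (m * 9 + n * 9 + 2 ^ j * 9 + 13 +
      m * (n * 19 + j * (2 ^ j * 13 + 15) + 2 ^ j * 10 + 22)) { st with
        coins := st.coins.drop (m * j)
        enc := (encodeList m n j st.rows st.coins).reverse }.toStore := by
  have h1 := (runsIn_copy (by decide : Reg.m ≠ Reg.t) (by decide : Reg.m ≠ Reg.enc) (by decide)
    st.toStore (by simp [ht])).seq (.push _ Reg.enc false)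
  have h2 := (runsIn_copy (by decide : Reg.n ≠ Reg.t) (by decide : Reg.n ≠ Reg.enc) (by decide)
    { st with enc := (unary m).reverse }.toStore (by simp [ht])).seq (.push _ Reg.enc false)
  have h3 := (runsIn_copy (by decide : Reg.z ≠ Reg.t) (by decide : Reg.z ≠ Reg.enc) (by decide)
    { st with enc := (unary m ++ unary n).reverse }.toStore (by simp [ht])).seq
      (.push _ Reg.enc false)
  have h4 := runsIn_repeatBy (x := Reg.m) (t := Reg.t) (c := Reg.c2) (p := .seq copyRow drawColour)
    (T := n * 15 + 3 + (j * (2 ^ j * 13 + 15) + 2 ^ j * 10 + 8)) (by decide) (by decide) (by decide)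
    (fun i => { st with
      rows := st.rows.drop (i * n)
      rows2 := (st.rows.take (i * n)).reverse
      coins := st.coins.drop (i * j)
      enc := ((List.range i).flatMap fun i => block n st.rows i ++
        oneHot (block j st.coins i)).reverse ++
          (unary m ++ unary n ++ unary (2 ^ j)).reverse }.toStore) m
    (by simp [hm]) (by simp [ht]) (by simp [hc2]) (by simp [hc2])
    (by
      intro i hi l
      have e1 : (i + 1) * n ≤ m * n := Nat.mul_le_mul_right _ hi
      have e2 : (i + 1) * j ≤ m * j := Nat.mul_le_mul_right _ hi
      rw [Nat.add_mul, one_mul] at e1 e2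
      set e := ((List.range i).flatMap fun i => block n st.rows i ++
        oneHot (block j st.coins i)).reverse ++
          (unary m ++ unary n ++ unary (2 ^ j)).reverse with he
      have h1 := runsIn_copyRow { st with
        rows := st.rows.drop (i * n)
        rows2 := (st.rows.take (i * n)).reverse
        coins := st.coins.drop (i * j)
        enc := e, c2 := l } n hn (by simp; omega) ht hc3
      have h2 := runsIn_drawColour { st with
        rows := st.rows.drop (i * n + n)
        rows2 := (st.rows.take ((i + 1) * n)).reverse
        coins := st.coins.drop (i * j)
        enc := (block n st.rows i).reverse ++ e, c2 := l } j hj (by simp; omega) hzc hlz hrz ht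
          hc3 hc4
      refine ((h1.congr_left (by simp)).seq (h2.congr_left ?_)).congr le_rfl ?_
      · simp [take_succ_mul, block]
      · simp [he, List.range_succ, Nat.add_mul, block])
  have h5 := runsIn_moveRev (by decide : Reg.rows2 ≠ Reg.rows) { st with
      rows := []
      rows2 := st.rows.reverse
      coins := st.coins.drop (m * j)
      enc := (encodeList m n j st.rows st.coins).reverse }.toStore
  refine (h1.seq ((h2.congr_left ?_).seq ((h3.congr_left ?_).seq ((h4.congr_left ?_).seq
    (h5.congr_left ?_))))).congr ?_ ?_
  · simp [unary, hm, henc]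
  · simp [unary, hn]
  · clear h1 h2 h3 h4 h5
    cases st
    simp_all [unary]
  · simp [encodeList, ← hrows]
  · simp [hm, hn, hz, hrows]; ring_nf; omega
  · clear h1 h2 h3 h4 h5
    cases st
    simp_all

/-! ### Calling the approximation algorithm -/

/-- Empty the first `B` stacks of the approximation algorithm. -/
def clearLow : ℕ → Prog
  | 0 => .skip
  | B + 1 => .seq (clearLow B) (clear (24 + B))

theorem runsIn_clearLow (B Q : ℕ) (st : Regs) (hQ : ∀ x, (st.low x).length ≤ Q) :
    RunsIn (clearLow B) st.toStore (B * (Q * 2 + 1) + 1)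
      { st with low := fun x => if x < B then [] else st.low x }.toStore := by
  induction B with
  | zero => simpa [clearLow] using RunsIn.skip st.toStore
  | succ B ih =>
    refine (ih.seq (runsIn_clear (24 + B) _)).congr ?_ ?_
    · have := hQ B
      simp only [Regs.toStore, glue_add, lt_irrefl, if_false]
      nlinarith
    · rw [Regs.toStore, update_glue_add]
      change glue 24 _ _ = glue 24 _ _
      congr 1
      funext x
      by_cases hx : x = B
      · subst hx; simp
      · have : x < B + 1 ↔ x < B := by omega
        simp [hx, this]

/-- Give the approximation algorithm as many coins as stack `w` says. -/
def moveCoins : Prog := repeatBy Reg.w Reg.t Reg.c2 (move1 Reg.coins Reg.aCoins)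

theorem runsIn_moveCoins (st : Regs) (D : ℕ) (hw : st.w = List.replicate D true)
    (hl : D ≤ st.coins.length) (ht : st.t = []) (hc2 : st.c2 = []) :
    RunsIn moveCoins st.toStore (D * 14 + 3) { st with
      coins := st.coins.drop D
      low := Function.update st.low 1 ((st.coins.take D).reverse ++ st.low 1) }.toStore := by
  have h := runsIn_repeatBy (x := Reg.w) (t := Reg.t) (c := Reg.c2)
    (p := move1 Reg.coins Reg.aCoins) (T := 3) (by decide) (by decide) (by decide)
    (fun i => { st with
      coins := st.coins.drop i
      low := Function.update st.low 1 ((st.coins.take i).reverse ++ st.low 1) }.toStore) D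
    (by simp [hw]) (by simp [ht]) (by simp [hc2]) (by simp [hc2])
    (by
      intro i hi l
      have hi' : i < st.coins.length := by omega
      simp only [List.take_succ_eq_append_getElem hi', List.drop_eq_getElem_cons hi']
      generalize st.coins[i] = b
      generalize st.coins.drop (i + 1) = l₁
      generalize st.coins.take i = l₂
      exact (runsIn_move1 (b := b) (l := l₁) (by decide) (by simp)).congr le_rfl (by simp))
  simpa [moveCoins] using h

theorem initStore_eq (l c : List Bool) :
    initStore l c = Function.update (Function.update (fun _ => []) 0 l) 1 c := by
  funext x
  match x with
  | 0 => rfl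
  | 1 => rfl
  | x + 2 => rfl

/-- Run the program `p` on the instance in `enc` with fresh coins, after emptying all stacks that an
earlier call may have left behind: those that `p` mentions, and those for its input, its coins and
its output. -/
def callAlg (p : Prog) : Prog :=
  .seq (clearLow (p.bound + 3)) (.seq (moveRev Reg.enc Reg.aIn) (.seq moveCoins (p.shift 24)))

theorem runsIn_callAlg (p : Prog) (st : Regs) (D Q T : ℕ) (s' : Store) (l : List Bool)
    (hw : st.w = List.replicate D true) (hl : D ≤ st.coins.length) (ht : st.t = [])
    (hc2 : st.c2 = []) (hlow : ∀ x, p.bound + 3 ≤ x → st.low x = [])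
    (hQ : ∀ x, (st.low x).length ≤ Q) (henc : st.enc = l.reverse)
    (hrun : RunsIn p (initStore l (st.coins.take D).reverse) T s') :
    RunsIn (callAlg p) st.toStore
      ((p.bound + 3) * (Q * 2 + 1) + 5 + l.length * 4 + D * 14 + T)
      { st with coins := st.coins.drop D, enc := [], low := s' }.toStore := by
  have h1 := runsIn_clearLow (p.bound + 3) Q st hQ
  have e : (fun x => if x < p.bound + 3 then [] else st.low x) = fun _ => [] := by
    funext x
    split_ifs with h
    · rfl
    · exact hlow x (by omega)
  rw [e] at h1
  have h2 := runsIn_moveRev (by decide : Reg.enc ≠ Reg.aIn)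
    { st with low := fun _ => [] }.toStore
  have h3 := runsIn_moveCoins { st with
    enc := [], low := Function.update (fun _ => []) 0 l } D hw hl ht hc2
  obtain ⟨t, ht, hr⟩ := hrun
  have h4 : RunsIn (p.shift 24) { st with
      coins := st.coins.drop D
      enc := []
      low := initStore l (st.coins.take D).reverse }.toStore T
      { st with coins := st.coins.drop D, enc := [], low := s' }.toStore :=
    ⟨t, ht, hr.shift 24 _⟩
  refine (h1.seq (h2.seq ((h3.congr_left ?_).seq (h4.congr_left ?_)))).congr ?_ rfl
  · simp [henc]
  · simp [initStore_eq]
  · simp [henc]; omega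

/-! ### Checking a solution -/

/-- The incidence vector of the union of the chosen ones among the first `i` rows of `R`, where
row `i` is chosen if `O[i]` is `true`. -/
def cover (N : ℕ) (R O : List Bool) : ℕ → List Bool
  | 0 => List.replicate N false
  | i + 1 => if O[i]? = some true then List.zipWith (· || ·) (cover N R O i) (block N R i)
      else cover N R O i

theorem cover_length {N : ℕ} {R O : List Bool} {i : ℕ} (h : i * N ≤ R.length) :
    (cover N R O i).length = N := by
  induction i with
  | zero => simp [cover]
  | succ i ih =>
    have h' := ih (by rw [Nat.add_mul] at h; omega)
    rw [cover]
    split_ifs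
    · simp [h', block_length h]
    · exact h'

/-- Skip the next row. -/
def skipRow : Prog := repeatBy Reg.n Reg.t Reg.c3 (move1 Reg.rows Reg.rows2)

theorem runsIn_skipRow (st : Regs) (n : ℕ) (hn : st.n = List.replicate n true)
    (hl : n ≤ st.rows.length) (ht : st.t = []) (hc3 : st.c3 = []) :
    RunsIn skipRow st.toStore (n * 14 + 3) { st with
      rows := st.rows.drop n
      rows2 := (st.rows.take n).reverse ++ st.rows2 }.toStore := by
  have h := runsIn_repeatBy (x := Reg.n) (t := Reg.t) (c := Reg.c3)
    (p := move1 Reg.rows Reg.rows2) (T := 3) (by decide) (by decide) (by decide)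
    (fun i => { st with
      rows := st.rows.drop i
      rows2 := (st.rows.take i).reverse ++ st.rows2 }.toStore) n
    (by simp [hn]) (by simp [ht]) (by simp [hc3]) (by simp [hc3])
    (by
      intro i hi l
      have hi' : i < st.rows.length := by omega
      simp only [List.take_succ_eq_append_getElem hi', List.drop_eq_getElem_cons hi']
      generalize st.rows[i] = b
      generalize st.rows.drop (i + 1) = l₁
      generalize st.rows.take i = l₂
      exact (runsIn_move1 (b := b) (l := l₁) (by decide) (by simp)).congr le_rfl (by simp))
  simpa [skipRow] using h

/-- Move the disjunction of the next bits of `rows` and `acc` to `acc2`. -/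
def orBit : Prog :=
  .branch Reg.rows .skip
    (.seq (.pop Reg.rows) (.seq (.push Reg.rows2 false) (move1 Reg.acc Reg.acc2)))
    (.seq (.pop Reg.rows) (.seq (.push Reg.rows2 true)
      (.seq (.pop Reg.acc) (.push Reg.acc2 true))))

/-- Add the next row to the union in `acc`. -/
def orRow : Prog := .seq (repeatBy Reg.n Reg.t Reg.c3 orBit) (moveRev Reg.acc2 Reg.acc)

theorem runsIn_orRow (st : Regs) (n : ℕ) (hn : st.n = List.replicate n true)
    (hl : n ≤ st.rows.length) (hacc : st.acc.length = n) (ht : st.t = []) (hc3 : st.c3 = [])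
    (hacc2 : st.acc2 = []) :
    RunsIn orRow st.toStore (n * 21 + 4) { st with
      rows := st.rows.drop n
      rows2 := (st.rows.take n).reverse ++ st.rows2
      acc := List.zipWith (· || ·) st.acc (st.rows.take n) }.toStore := by
  have hlen : (List.zipWith (· || ·) st.acc (st.rows.take n)).length = n := by
    simp [hacc, hl]
  have h1 := runsIn_repeatBy (x := Reg.n) (t := Reg.t) (c := Reg.c3)
    (p := orBit) (T := 6) (by decide) (by decide) (by decide)
    (fun i => { st with
      rows := st.rows.drop i
      rows2 := (st.rows.take i).reverse ++ st.rows2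
      acc := st.acc.drop i
      acc2 := ((List.zipWith (· || ·) st.acc (st.rows.take n)).take i).reverse }.toStore) n
    (by simp [hn]) (by simp [ht]) (by simp [hc3]) (by simp [hc3])
    (by
      intro i hi l
      have hi' : i < st.rows.length := by omega
      have hi2 : i < st.acc.length := by omega
      have hi3 : i < (List.zipWith (· || ·) st.acc (st.rows.take n)).length := by omega
      simp only [List.take_succ_eq_append_getElem hi', List.drop_eq_getElem_cons hi',
        List.take_succ_eq_append_getElem hi3, List.drop_eq_getElem_cons hi2, List.getElem_zipWith,
        List.getElem_take]
      generalize st.rows[i] = b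
      generalize st.rows.drop (i + 1) = l₁
      generalize st.rows.take i = l₂
      generalize st.acc[i] = b'
      generalize st.acc.drop (i + 1) = l₃
      generalize (List.zipWith (· || ·) st.acc (st.rows.take n)).take i = l₄
      cases b
      · exact (RunsIn.branchFalse (l := l₁) (by simp) ((RunsIn.pop _ _).seq
          ((RunsIn.push _ _ _).seq (runsIn_move1 (b := b') (l := l₃) (by decide)
            (by simp))))).congr (by omega) (by simp)
      · exact (RunsIn.branchTrue (l := l₁) (by simp) ((RunsIn.pop _ _).seq
          ((RunsIn.push _ _ _).seq ((RunsIn.pop _ _).seq (RunsIn.push _ _ _))))).congr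
            (by omega) (by simp))
  have h2 := runsIn_moveRev (by decide : Reg.acc2 ≠ Reg.acc) { st with
      rows := st.rows.drop n
      rows2 := (st.rows.take n).reverse ++ st.rows2
      acc := []
      acc2 := (List.zipWith (· || ·) st.acc (st.rows.take n)).reverse }.toStore
  refine ((h1.congr_left ?_).seq (h2.congr_left ?_)).congr ?_ ?_
  · clear h1 h2
    cases st
    simp_all
  · rw [List.take_of_length_le hlen.le, ← hacc, List.drop_length]
  · simp [hacc, hl]; omega
  · simp [hacc2]

/-- Take the next row into account if the solution contains it. -/
def checkRow : Prog :=
  .branch Reg.aOut skipRow (.seq (.pop Reg.aOut) skipRow)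
    (.seq (.pop Reg.aOut) (.seq (.push Reg.cnt true) orRow))

theorem runsIn_checkRow (st : Regs) (n : ℕ) (O : List Bool) (i : ℕ)
    (hn : st.n = List.replicate n true) (hO : st.low 2 = O.drop i)
    (hl : n ≤ st.rows.length) (hacc : st.acc.length = n) (ht : st.t = []) (hc3 : st.c3 = [])
    (hacc2 : st.acc2 = []) :
    RunsIn checkRow st.toStore (n * 21 + 7) { st with
      rows := st.rows.drop n
      rows2 := (st.rows.take n).reverse ++ st.rows2
      acc := if O[i]? = some true then List.zipWith (· || ·) st.acc (st.rows.take n) else st.acc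
      cnt := if O[i]? = some true then true :: st.cnt else st.cnt
      low := Function.update st.low 2 (O.drop (i + 1)) }.toStore := by
  by_cases hi : i < O.length
  · rw [List.drop_eq_getElem_cons hi] at hO
    rw [List.getElem?_eq_getElem hi]
    generalize O[i] = b at *
    have e : (st.low 2).tail = O.drop (i + 1) := by simp [hO]
    cases b
    · exact (RunsIn.branchFalse (by simpa using hO) ((RunsIn.pop _ _).seq
        ((runsIn_skipRow { st with low := Function.update st.low 2 (O.drop (i + 1)) } n hn hl ht
          hc3).congr_left (by simp [e])))).congr (by omega) (by simp)
    · exact (RunsIn.branchTrue (by simpa using hO) ((RunsIn.pop _ _).seq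
        ((RunsIn.push _ _ _).seq ((runsIn_orRow { st with
          cnt := true :: st.cnt
          low := Function.update st.low 2 (O.drop (i + 1)) } n hn hl hacc ht
          hc3 hacc2).congr_left (by simp [e]))))).congr (by omega) (by simp)
  · have e : O.drop (i + 1) = [] := List.drop_eq_nil_of_le (by omega)
    rw [List.drop_eq_nil_of_le (by omega)] at hO
    rw [List.getElem?_eq_none (by omega), e, ← hO]
    exact (RunsIn.branchEmpty (by simpa using hO) (runsIn_skipRow st n hn hl ht hc3)).congr
      (by omega) (by simp)

/-- Compute the union and the number of the rows in the solution. -/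
def evalSolution : Prog :=
  .seq (repeatBy Reg.n Reg.t Reg.c2 (.push Reg.acc false))
    (.seq (repeatBy Reg.m Reg.t Reg.c2 checkRow) (moveRev Reg.rows2 Reg.rows))

theorem runsIn_evalSolution (st : Regs) (m n : ℕ) (hm : st.m = List.replicate m true)
    (hn : st.n = List.replicate n true) (hrows : st.rows.length = m * n) (ht : st.t = [])
    (hc2 : st.c2 = []) (hc3 : st.c3 = []) (hacc : st.acc = []) (hacc2 : st.acc2 = [])
    (hr2 : st.rows2 = []) (hcnt : st.cnt = []) :
    RunsIn evalSolution st.toStore (n * 12 + 7 + m * (n * 25 + 18)) { st with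
      acc := cover n st.rows (st.low 2) m
      cnt := List.replicate (Nat.count (fun i => (st.low 2)[i]? = some true) m) true
      low := Function.update st.low 2 ((st.low 2).drop m) }.toStore := by
  have h1 := runsIn_repeatBy (x := Reg.n) (t := Reg.t) (c := Reg.c2)
    (p := .push Reg.acc false) (T := 1) (by decide) (by decide) (by decide)
    (fun i => { st with acc := List.replicate i false }.toStore) n
    (by simp [hn]) (by simp [ht]) (by simp [hc2]) (by simp [hc2])
    (by
      intro i hi l
      exact (RunsIn.push _ _ _).congr le_rfl (by simp [List.replicate_succ]))
  have h2 := runsIn_repeatBy (x := Reg.m) (t := Reg.t) (c := Reg.c2)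
    (p := checkRow) (T := n * 21 + 7) (by decide) (by decide) (by decide)
    (fun i => { st with
      rows := st.rows.drop (i * n)
      rows2 := (st.rows.take (i * n)).reverse
      acc := cover n st.rows (st.low 2) i
      cnt := List.replicate (Nat.count (fun i => (st.low 2)[i]? = some true) i) true
      low := Function.update st.low 2 ((st.low 2).drop i) }.toStore) m
    (by simp [hm]) (by simp [ht]) (by simp [hc2]) (by simp [hc2])
    (by
      intro i hi l
      have e1 : (i + 1) * n ≤ m * n := Nat.mul_le_mul_right _ hi
      rw [Nat.add_mul, one_mul] at e1
      have h := runsIn_checkRow { st with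
        rows := st.rows.drop (i * n)
        rows2 := (st.rows.take (i * n)).reverse
        acc := cover n st.rows (st.low 2) i
        cnt := List.replicate (Nat.count (fun i => (st.low 2)[i]? = some true) i) true
        low := Function.update st.low 2 ((st.low 2).drop i)
        c2 := l } n (st.low 2) i hn (by simp) (by simp; omega) (cover_length (by omega)) ht hc3
          hacc2
      refine (h.congr_left (by simp)).congr le_rfl ?_
      simp only [Nat.count_succ, take_succ_mul, cover, block, Regs.update_c2]
      congr 2
      · simp [Nat.add_mul]
      · simp
      · split_ifs <;> simp [List.replicate_succ]
      · simp)
  have h3 := runsIn_moveRev (by decide : Reg.rows2 ≠ Reg.rows) { st with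
      rows := []
      rows2 := st.rows.reverse
      acc := cover n st.rows (st.low 2) m
      cnt := List.replicate (Nat.count (fun i => (st.low 2)[i]? = some true) m) true
      low := Function.update st.low 2 ((st.low 2).drop m) }.toStore
  refine ((h1.congr_left ?_).seq ((h2.congr_left ?_).seq (h3.congr_left ?_))).congr ?_ ?_
  · clear h1 h2 h3
    cases st
    simp_all
  · clear h1 h2 h3
    cases st
    simp_all [cover]
  · simp [← hrows]
  · simp [hrows]; ring_nf; omega
  · clear h1 h2 h3
    cases st
    simp_all

/-- Raise the flag if the solution has at least as many sets as there are colours, but covers fewer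
red elements. -/
def verdict : Prog :=
  .seq (copy Reg.z Reg.t Reg.c2) (.seq
    (.loop Reg.acc (.branch Reg.acc .skip (.pop Reg.acc) (.seq (.pop Reg.acc) (.pop Reg.c2))))
    (.seq (copy Reg.z Reg.t Reg.c3) (.seq (.loop Reg.cnt (.seq (.pop Reg.cnt) (.pop Reg.c3)))
      (.seq (.branch Reg.c3 (.branch Reg.c2 .skip .skip (.push Reg.flag true)) .skip .skip)
        (.seq (clear Reg.c2) (clear Reg.c3))))))

theorem runsIn_verdict (st : Regs) (b c : ℕ) (hz : st.z = List.replicate b true)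
    (hcnt : st.cnt = List.replicate c true) (ht : st.t = []) (hc2 : st.c2 = [])
    (hc3 : st.c3 = []) :
    RunsIn verdict st.toStore (b * 22 + st.acc.length * 4 + c * 3 + 12) { st with
      acc := []
      cnt := []
      flag := if b ≤ c ∧ st.acc.count true < b then true :: st.flag else st.flag }.toStore := by
  have h1 := runsIn_copy (by decide : Reg.z ≠ Reg.t) (by decide : Reg.z ≠ Reg.c2) (by decide)
    st.toStore (by simp [ht])
  have h2 := RunsIn.loop (x := Reg.acc)
    (p := (.branch Reg.acc .skip (.pop Reg.acc) (.seq (.pop Reg.acc) (.pop Reg.c2)))) (T := 3)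
    (fun i => { st with
      acc := st.acc.drop i
      c2 := List.replicate (b - (st.acc.take i).count true) true }.toStore) st.acc.length
    (by intro i hi; simpa using hi)
    (by
      intro i hi
      simp only [List.take_succ_eq_append_getElem hi, List.drop_eq_getElem_cons hi]
      generalize st.acc[i] = b
      generalize st.acc.drop (i + 1) = l₁
      generalize st.acc.take i = l₂
      cases b
      · exact (RunsIn.branchFalse (l := l₁) (by simp) (RunsIn.pop _ _)).congr (by omega) (by simp)
      · exact (RunsIn.branchTrue (l := l₁) (by simp) ((RunsIn.pop _ _).seq (RunsIn.pop _ _))).congr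
          (by omega) (by simp [Nat.sub_sub]))
    (by simp)
  have h3 := runsIn_copy (by decide : Reg.z ≠ Reg.t) (by decide : Reg.z ≠ Reg.c3) (by decide)
    { st with acc := [], c2 := List.replicate (b - st.acc.count true) true }.toStore (by simp [ht])
  have h4 := RunsIn.loop (x := Reg.cnt)
    (p := (.seq (.pop Reg.cnt) (.pop Reg.c3))) (T := 2)
    (fun i => { st with
      acc := []
      c2 := List.replicate (b - st.acc.count true) true
      cnt := List.replicate (c - i) true
      c3 := List.replicate (b - i) true }.toStore) c
    (by intro i hi; simp; omega)
    (by
      intro i hi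
      exact ((RunsIn.pop _ _).seq (RunsIn.pop _ _)).congr (by omega) (by simp [Nat.sub_sub]))
    (by simp)
  have h5 : RunsIn (.branch Reg.c3 (.branch Reg.c2 .skip .skip (.push Reg.flag true)) .skip .skip)
      { st with
        acc := []
        c2 := List.replicate (b - st.acc.count true) true
        cnt := []
        c3 := List.replicate (b - c) true }.toStore 3
      { st with
        acc := []
        c2 := List.replicate (b - st.acc.count true) true
        cnt := []
        c3 := List.replicate (b - c) true
        flag := if b ≤ c ∧ st.acc.count true < b then true :: st.flag else st.flag }.toStore := by
    by_cases hbc : b ≤ c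
    · by_cases hb : st.acc.count true < b
      · obtain ⟨d, hd⟩ : ∃ d, b - st.acc.count true = d + 1 := ⟨b - st.acc.count true - 1, by omega⟩
        exact (RunsIn.branchEmpty (by simpa using by omega) (.branchTrue
          (l := List.replicate d true) (by simp [hd, List.replicate_succ])
          (.push _ _ _))).congr (by omega) (by simp [hbc, hb])
      · exact (RunsIn.branchEmpty (by simpa using by omega) (.branchEmpty
          (by simpa using by omega) (.skip _))).congr (by omega) (by simp [hb])
    · obtain ⟨d, hd⟩ : ∃ d, b - c = d + 1 := ⟨b - c - 1, by omega⟩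
      exact (RunsIn.branchTrue (l := List.replicate d true) (by simp [hd, List.replicate_succ])
          (.skip _)).congr (by omega) (by simp [hbc])
  refine (h1.seq ((h2.congr_left ?_).seq ((h3.congr_left ?_).seq ((h4.congr_left ?_).seq
    ((h5.congr_left ?_).seq ((runsIn_clear Reg.c2 _).seq (runsIn_clear Reg.c3 _))))))).congr ?_ ?_
  · simp [hz, hc2]
  · simp
  · simp [hz, hcnt, hc3]
  · simp
  · simp [hz]; omega
  · simp [hc2, hc3]

/-! ### The reduction -/

/-- One round: draw a random instance, call the approximation algorithm, check its answer. -/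
def round (p : Prog) : Prog :=
  .seq encodeInstance (.seq (callAlg p) (.seq evalSolution verdict))

/-- The output `O` of the approximation algorithm describes a collection of at least `b` rows of
`R` whose union has fewer than `b` elements. -/
def Beats (m n b : ℕ) (R O : List Bool) : Prop :=
  b ≤ Nat.count (fun i => O[i]? = some true) m ∧ (cover n R O m).count true < b

instance (m n b : ℕ) (R O : List Bool) : Decidable (Beats m n b R O) :=
  inferInstanceAs (Decidable (_ ∧ _))

theorem encodeList_length {m n j : ℕ} {R c : List Bool} (hR : R.length = m * n)
    (hc : m * j ≤ c.length) :
    (encodeList m n j R c).length = m + n + 2 ^ j + 3 + m * (n + 2 ^ j) := by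
  have h : ∀ i ∈ List.range m, (block n R i ++ oneHot (block j c i)).length = n + 2 ^ j := by
    intro i hi
    have hi : i + 1 ≤ m := by simpa using hi
    have e1 : (block n R i).length = n :=
      block_length (hR ▸ Nat.mul_le_mul_right _ hi)
    have e2 : (block j c i).length = j :=
      block_length ((Nat.mul_le_mul_right _ hi).trans hc)
    have := colour_lt (block j c i)
    rw [e2] at this
    simp only [oneHot, List.length_append, e1, e2, List.length_replicate, List.length_cons]
    omega
  have h2 : ((List.range m).flatMap fun i => block n R i ++ oneHot (block j c i)).length =
      m * (n + 2 ^ j) := by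
    rw [List.length_flatMap, List.map_congr_left h]
    simp
  simp only [encodeList, unary, List.length_append, List.length_replicate, h2,
    List.length_cons, List.length_nil]
  ring

/-- A bound for the running time of a round. -/
def roundTime (B m n j D T : ℕ) : ℕ :=
  (m * 9 + n * 9 + 2 ^ j * 9 + 13 + m * (n * 19 + j * (2 ^ j * 13 + 15) + 2 ^ j * 10 + 22)) +
  ((B + 3) * ((m + n + 2 ^ j + 3 + m * (n + 2 ^ j) + D + T) * 2 + 1) + 5 +
    (m + n + 2 ^ j + 3 + m * (n + 2 ^ j)) * 4 + D * 14 + T) +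
  (n * 12 + 7 + m * (n * 25 + 18)) + (2 ^ j * 22 + n * 4 + m * 3 + 12)

theorem runsIn_round (p : Prog) (st : Regs) (m n j D T : ℕ) (s' : Store)
    (hm : st.m = List.replicate m true)
    (hn : st.n = List.replicate n true) (hj : st.j = List.replicate j true)
    (hz : st.z = List.replicate (2 ^ j) true) (hw : st.w = List.replicate D true)
    (hrows : st.rows.length = m * n)
    (hcoins : m * j + D ≤ st.coins.length) (henc : st.enc = []) (hr2 : st.rows2 = [])
    (hzc : st.zc = []) (hlz : st.lz = []) (hrz : st.rz = []) (ht : st.t = []) (hc2 : st.c2 = [])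
    (hc3 : st.c3 = []) (hc4 : st.c4 = []) (hacc : st.acc = []) (hacc2 : st.acc2 = [])
    (hcnt : st.cnt = []) (hlow : ∀ x, p.bound + 3 ≤ x → st.low x = [])
    (hQ : ∀ x, (st.low x).length ≤ m + n + 2 ^ j + 3 + m * (n + 2 ^ j) + D + T)
    (hrun : RunsIn p (initStore (encodeList m n j st.rows st.coins)
      ((st.coins.drop (m * j)).take D).reverse) T s') :
    RunsIn (round p) st.toStore (roundTime p.bound m n j D T) { st with
      coins := st.coins.drop (m * j + D)
      flag := if Beats m n (2 ^ j) st.rows (s' 2) then true :: st.flag else st.flag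
      low := Function.update s' 2 ((s' 2).drop m) }.toStore := by
  have hE := encodeList_length (j := j) (c := st.coins) hrows (by omega)
  have h1 := runsIn_encodeInstance st m n j hm hn hj hz hrows (by omega) henc hr2 hzc hlz hrz ht hc2
    hc3 hc4
  have h2 := runsIn_callAlg p { st with
    coins := st.coins.drop (m * j)
    enc := (encodeList m n j st.rows st.coins).reverse } D _ T s' _ hw
    (by simp; omega) ht hc2 hlow hQ rfl hrun
  have h3 := runsIn_evalSolution { st with
    coins := st.coins.drop (m * j + D), low := s' } m n hm hn hrows ht hc2 hc3 hacc hacc2 hr2 hcnt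
  have h4 := runsIn_verdict { st with
    coins := st.coins.drop (m * j + D)
    acc := cover n st.rows (s' 2) m
    cnt := List.replicate (Nat.count (fun i => (s' 2)[i]? = some true) m) true
    low := Function.update s' 2 ((s' 2).drop m) } _ _ hz rfl ht hc2 hc3
  refine (h1.seq (h2.seq ((h3.congr_left ?_).seq (h4.congr_left ?_)))).congr ?_ ?_
  · simp [← henc]
  · simp
  · have hc : Nat.count (fun i => (s' 2)[i]? = some true) m ≤ m := Nat.count_le _
    have hc' : (cover n st.rows (s' 2) m).length = n := cover_length hrows.ge
    simp only [hE, hc', roundTime]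
    generalize (2 : ℕ) ^ j = b
    have : Nat.count (fun i => (s' 2)[i]? = some true) m * 3 ≤ m * 3 := by omega
    linarith
  · clear h1 h2 h3 h4
    cases st
    simp only at hacc hcnt
    subst hacc hcnt
    rfl

/-- A round that uses the coins `c` raises the flag: with the first `m * j` coins for the colours
and the next `D` for the algorithm `p`, the output of `p` is a solution that `Beats`.  Moving coins
from one stack to another reverses them. -/
def Accepts (p : Prog) (m n j D : ℕ) (R c : List Bool) : Prop :=
  ∃ t s', Runs p (initStore (encodeList m n j R c) ((c.drop (m * j)).take D).reverse) t s' ∧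
    Beats m n (2 ^ j) R (s' 2)

/-- Read the input and compute the parameters of the rounds. -/
def setup (e : ℕ) : Prog :=
  .seq (readUnary Reg.rows Reg.c1 Reg.m) (.seq (readUnary Reg.rows Reg.c1 Reg.n)
    (.seq (readUnary Reg.rows Reg.c1 Reg.k) (.seq (copy Reg.m Reg.t Reg.u)
      (.seq (copy Reg.n Reg.t Reg.u) (.seq (copy Reg.k Reg.t Reg.u)
        (.seq (.push Reg.u true) (.seq (.push Reg.u true) (.seq computeJ (.seq computeZ
          (.seq (computeW e) (.seq computeP
            (.branch Reg.p .skip .skip (.push Reg.flag true)))))))))))))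

/-- All stacks empty. -/
def emptyRegs : Regs :=
  ⟨[], [], [], [], [], [], [], [], [], [], [], [], [], [], [], [], [], [], [], [], [], [], [], [],
    fun _ => []⟩

theorem initStore_eq_toStore (l c : List Bool) :
    initStore l c = { emptyRegs with rows := l, coins := c }.toStore := by
  have h : emptyRegs.toStore = fun _ => [] := by
    funext x
    simp only [Regs.toStore, glue]
    split_ifs with hx
    · interval_cases x <;> rfl
    · rfl
  rw [initStore_eq, ← h]
  rw [Regs.update_rows, Regs.update_coins]

/-- A bound for the running time of the preparations. -/
def setupTime (m n k j b l e : ℕ) : ℕ :=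
  13 * (m + n + k) + 26 + (j * (k * 10 + 13) + 1) + (j * (b * 8 + 13) + 4) +
  (e * (l ^ e * 17 + 2) + 1) + (m * (b * 9 + 13) + 3 + (n * (n * (n * 12 + 14) + 14) + 3)) + 2

/-- The store after the preparations. -/
def readyRegs (m n k j D : ℕ) (R c : List Bool) : Regs :=
  { emptyRegs with
    rows := R
    coins := c
    m := List.replicate m true
    n := List.replicate n true
    u := List.replicate (m + n + k + 2) true
    j := List.replicate j true
    z := List.replicate (2 ^ j) true
    w := List.replicate D true
    p := List.replicate (m * 2 ^ j - n * (n * n)) true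
    flag := if n * (n * n) < m * 2 ^ j then [true] else [] }

theorem runsIn_setup (m n k e : ℕ) (R c : List Bool) :
    RunsIn (setup e) (initStore (unary m ++ unary n ++ unary k ++ R) c)
      (setupTime m n k (2 * k.size) (2 ^ (2 * k.size)) (m + n + k + 2) e)
      (readyRegs m n k (2 * k.size) ((m + n + k + 2) ^ e) R c).toStore := by
  rw [initStore_eq_toStore]
  have h1 := runsIn_readUnary (x := Reg.rows) (f := Reg.c1) (y := Reg.m) (by decide) (by decide)
    (by decide) m (unary n ++ unary k ++ R) { emptyRegs with
      rows := unary m ++ unary n ++ unary k ++ R, coins := c }.toStore (by simp) rfl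
  have h2 := runsIn_readUnary (x := Reg.rows) (f := Reg.c1) (y := Reg.n) (by decide) (by decide)
    (by decide) n (unary k ++ R) { emptyRegs with
      rows := unary n ++ unary k ++ R, coins := c, m := List.replicate m true }.toStore
      (by simp) rfl
  have h3 := runsIn_readUnary (x := Reg.rows) (f := Reg.c1) (y := Reg.k) (by decide) (by decide)
    (by decide) k R { emptyRegs with
      rows := unary k ++ R, coins := c, m := List.replicate m true
      n := List.replicate n true }.toStore (by simp) rfl
  set st : Regs := { emptyRegs with
      rows := R, coins := c, m := List.replicate m true
      n := List.replicate n true, k := List.replicate k true } with hst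
  have h4 := runsIn_copy (by decide : Reg.m ≠ Reg.t) (by decide : Reg.m ≠ Reg.u) (by decide)
    st.toStore rfl
  have h5 := runsIn_copy (by decide : Reg.n ≠ Reg.t) (by decide : Reg.n ≠ Reg.u) (by decide)
    { st with u := List.replicate m true }.toStore rfl
  have h6 := runsIn_copy (by decide : Reg.k ≠ Reg.t) (by decide : Reg.k ≠ Reg.u) (by decide)
    { st with u := List.replicate (m + n) true }.toStore rfl
  have h7 := runsIn_computeJ { st with u := List.replicate (m + n + k + 2) true } k rfl rfl rfl
  have h8 := runsIn_computeZ { st with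
    u := List.replicate (m + n + k + 2) true, k := []
    j := List.replicate (2 * k.size) true } _ rfl rfl rfl rfl rfl
  have h9 := runsIn_computeW { st with
    u := List.replicate (m + n + k + 2) true, k := []
    j := List.replicate (2 * k.size) true
    z := List.replicate (2 ^ (2 * k.size)) true } _ e rfl rfl (by omega) rfl rfl
  have h10 := runsIn_computeP { st with
    u := List.replicate (m + n + k + 2) true, k := []
    j := List.replicate (2 * k.size) true
    z := List.replicate (2 ^ (2 * k.size)) true
    w := List.replicate ((m + n + k + 2) ^ e) true } m n (2 ^ (2 * k.size)) rfl rfl rfl rfl rfl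
      rfl rfl rfl
  have h11 : RunsIn (.branch Reg.p .skip .skip (.push Reg.flag true))
      { readyRegs m n k (2 * k.size) ((m + n + k + 2) ^ e) R c with flag := [] }.toStore 2
      (readyRegs m n k (2 * k.size) ((m + n + k + 2) ^ e) R c).toStore := by
    by_cases h : n * (n * n) < m * 2 ^ (2 * k.size)
    · obtain ⟨d, hd⟩ : ∃ d, m * 2 ^ (2 * k.size) - n * (n * n) = d + 1 :=
        ⟨m * 2 ^ (2 * k.size) - n * (n * n) - 1, by omega⟩
      exact (RunsIn.branchTrue (l := List.replicate d true)
        (by simp [readyRegs, hd, List.replicate_succ]) (RunsIn.push _ _ _)).congr le_rfl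
          (by simp [readyRegs, h])
    · exact (RunsIn.branchEmpty (by simpa [readyRegs] using by omega) (RunsIn.skip _)).congr le_rfl
          (by simp [readyRegs, h])
  refine (h1.seq ((h2.congr_left ?_).seq ((h3.congr_left ?_).seq ((h4.congr_left ?_).seq
    ((h5.congr_left ?_).seq ((h6.congr_left ?_).seq ((RunsIn.push _ _ _).seq
      ((RunsIn.push _ _ _).seq ((h7.congr_left ?_).seq (h8.seq (h9.seq (h10.seq
        (h11.congr_left ?_))))))))))))).congr ?_ rfl
  · simp [emptyRegs]
  · simp [emptyRegs]
  · simp [hst, emptyRegs]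
  · simp [hst, emptyRegs]
  · simp [hst, emptyRegs, Nat.add_comm]
  · simp [hst, emptyRegs, List.replicate_succ, Nat.add_comm, Nat.add_left_comm]
  · simp [hst, emptyRegs, readyRegs]
  · simp [hst, setupTime]
    have : k.size * (k * 10 + 13) ≤ 2 * k.size * (k * 10 + 13) :=
      Nat.mul_le_mul_right _ (by omega)
    linarith

/-- The algorithm for the Dense-vs-Random problem that is built from an approximation algorithm
for Red-Blue Set Cover. -/
def reduction (e : ℕ) (p : Prog) : Prog := .seq (setup e) (repeatBy Reg.j Reg.t Reg.c1 (round p))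

/-- Running time and answer of the reduction, provided that `p` stops within `T` steps on all
instances that are drawn. -/
theorem runsIn_reduction (p : Prog) (m n k e T : ℕ) (R c : List Bool) (hR : R.length = m * n)
    (hc : 2 * k.size * (m * (2 * k.size) + (m + n + k + 2) ^ e) ≤ c.length)
    (hp : ∀ c : List Bool, m * (2 * k.size) + (m + n + k + 2) ^ e ≤ c.length →
      ∃ s', RunsIn p (initStore (encodeList m n (2 * k.size) R c)
        ((c.drop (m * (2 * k.size))).take ((m + n + k + 2) ^ e)).reverse) T s') :
    ∃ s', RunsIn (reduction e p) (initStore (unary m ++ unary n ++ unary k ++ R) c)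
      (setupTime m n k (2 * k.size) (2 ^ (2 * k.size)) (m + n + k + 2) e +
        (2 * k.size * (roundTime p.bound m n (2 * k.size) ((m + n + k + 2) ^ e) T + 11) + 3)) s' ∧
      (saysDense (s' 2) ↔ n * (n * n) < m * 2 ^ (2 * k.size) ∨ ∃ i < 2 * k.size,
        Accepts p m n (2 * k.size) ((m + n + k + 2) ^ e) R
          (c.drop (i * (m * (2 * k.size) + (m + n + k + 2) ^ e)))) := by
  have h1 := runsIn_setup m n k e R c
  set j := 2 * k.size
  set D := (m + n + k + 2) ^ e
  set P : ℕ → Prop := fun i => n * (n * n) < m * 2 ^ j ∨ ∃ i' < i,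
        Accepts p m n j D R (c.drop (i' * (m * j + D))) with hP
  set base : Regs := readyRegs m n k j D R c with hbase
  have h2 := runsIn_repeatBy_of_invariant (x := Reg.j) (t := Reg.t) (c := Reg.c1) (p := round p)
    (T := roundTime p.bound m n j D T) (n := j) (by decide) (by decide) (by decide)
    -- Only `coins`, `flag` and the stacks of `p` change.  The contents of the latter are not known,
    -- but their lengths are bounded, so that emptying them takes polynomial time.
    (fun i s => ∃ low f, s = { base with
        coins := c.drop (i * (m * j + D))
        flag := List.replicate f true
        low := low }.toStore ∧ (f ≠ 0 ↔ P i) ∧ (∀ x, p.bound + 3 ≤ x → low x = []) ∧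
        ∀ x, (low x).length ≤ m + n + 2 ^ j + 3 + m * (n + 2 ^ j) + D + T)
    base.toStore (by simp [hbase, readyRegs]) rfl rfl
    (by
      rintro i hi _ ⟨low, f, rfl, hf, hlow, hQ⟩ l
      have hlen : m * j + D ≤ (c.drop (i * (m * j + D))).length := by
        have e1 : (i + 1) * (m * j + D) ≤ j * (m * j + D) := Nat.mul_le_mul_right _ hi
        rw [Nat.add_mul, one_mul] at e1
        rw [List.length_drop]
        omega
      obtain ⟨s', hs'⟩ := hp _ hlen
      have h := runsIn_round p { base with
        coins := c.drop (i * (m * j + D))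
        flag := List.replicate f true
        low := low, c1 := l } m n j D T s' rfl rfl rfl rfl rfl hR hlen rfl rfl rfl rfl rfl rfl rfl
          rfl rfl rfl rfl rfl hlow hQ hs'
      have h' : RunsIn (round p) (Function.update { base with
          coins := c.drop (i * (m * j + D))
          flag := List.replicate f true
          low := low }.toStore Reg.c1 l) (roundTime p.bound m n j D T) (Function.update { base with
          coins := c.drop ((i + 1) * (m * j + D))
          flag := List.replicate (if Beats m n (2 ^ j) R (s' 2) then f + 1 else f) true
          low := Function.update s' 2 ((s' 2).drop m) }.toStore Reg.c1 l) := by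
        refine (h.congr_left (by simp)).congr le_rfl ?_
        simp only [Regs.update_c1, List.drop_drop]
        congr 2
        · congr 1
          ring
        · change (if Beats m n (2 ^ j) R (s' 2) then _ else _) = _
          split_ifs <;> simp [List.replicate_succ]
      refine ⟨_, h', _, rfl, _, _, rfl, ?_, ?_, ?_⟩
      · obtain ⟨t, ht, hr⟩ := hs'
        have hacc : Accepts p m n j D R (c.drop (i * (m * j + D))) ↔
            Beats m n (2 ^ j) R (s' 2) := by
          refine ⟨?_, fun h => ⟨t, s', hr, h⟩⟩
          rintro ⟨t₂, s₂, hr₂, h⟩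
          obtain ⟨-, rfl⟩ := hr.deterministic hr₂
          exact h
        have hPs : P (i + 1) ↔ P i ∨ Beats m n (2 ^ j) R (s' 2) := by
          rw [← hacc]
          simp only [hP]
          constructor
          · rintro (hA | ⟨i', hi', hA⟩)
            · exact .inl (.inl hA)
            · rcases Nat.lt_succ_iff_lt_or_eq.1 hi' with h' | rfl
              · exact .inl (.inr ⟨i', h', hA⟩)
              · exact .inr hA
          · rintro ((h | ⟨i', hi', h⟩) | h)
            · exact .inl h
            · exact .inr ⟨i', by omega, h⟩
            · exact .inr ⟨i, by omega, h⟩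
        rw [hPs, ← hf]
        split_ifs with hb <;> simp [hb]
      · intro x hx
        obtain ⟨t, ht, hr⟩ := hs'
        rw [Function.update_of_ne (by omega), hr.eq_of_bound_le (by omega)]
        match x with
        | 0 => omega
        | 1 => omega
        | x + 2 => rfl
      · intro x
        obtain ⟨t, ht, hr⟩ := hs'
        have hE := encodeList_length (j := j) (c := c.drop (i * (m * j + D))) hR (by omega)
        have h0 : (s' x).length ≤ m + n + 2 ^ j + 3 + m * (n + 2 ^ j) + D + T := by
          refine (hr.length_le x).trans ?_
          match x with
          | 0 => simp only [initStore]; rw [hE]; omega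
          | 1 =>
            simp only [initStore, List.length_reverse]
            have := List.length_take_le D ((c.drop (i * (m * j + D))).drop (m * j))
            omega
          | x + 2 => simp only [initStore, List.length_nil]; omega
        by_cases hx : x = 2
        · subst hx
          simp only [Function.update_self, List.length_drop]
          omega
        · rwa [Function.update_of_ne hx])
    (by
      rintro _ ⟨low, f, rfl, -⟩
      rfl)
    ⟨fun _ => [], if n * (n * n) < m * 2 ^ j then 1 else 0, by
      rw [Nat.zero_mul, List.drop_zero]
      congr 1
      simp only [hbase, readyRegs, emptyRegs]
      congr 1
      split_ifs <;> rfl, by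
      simp [hP], fun _ _ => rfl, fun _ => Nat.zero_le _⟩
  obtain ⟨s', h3, low, f, rfl, hf, -⟩ := h2
  refine ⟨_, h1.seq h3, ?_⟩
  rw [← hP] at *
  change saysDense (List.replicate f true) ↔ P j
  rw [← hf]
  cases f <;> simp [saysDense, List.replicate_succ]

/-! ### The drawn instance -/

/-- The vertex set of the `i`-th edge. -/
def edge {r n : ℕ} (G : Hypergraph r n) (i : Fin (edgeList G).length) : Finset (Fin n) :=
  ((edgeList G)[i]).toFinset

/-- The incidence vectors of the edges. -/
def incidence {r n : ℕ} (G : Hypergraph r n) : List Bool :=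
  (edgeList G).flatMap fun l => (List.finRange n).map fun v => decide (v ∈ l)

/-- The Red-Blue Set Cover instance whose sets are the edges of the hypergraph, each with one of
`2 ^ j` blue elements, its colour, which is given by the next `j` of the coins `c`. -/
def drawn {r n : ℕ} (G : Hypergraph r n) (j : ℕ) (c : List Bool) : Instance where
  m := (edgeList G).length
  n := n
  k := 2 ^ j
  red := edge G
  blue i := {⟨colour (block j c i), (colour_lt _).trans_le
    (Nat.pow_le_pow_right (by norm_num) (List.length_take_le _ _))⟩}

theorem mem_edgeList {r n : ℕ} {G : Hypergraph r n} {l : List (Fin n)} :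
    l ∈ edgeList G ↔ (l.Sublist (List.finRange n) ∧ l.length = r) ∧
      l.toFinset ∈ G.image Subtype.val := by
  simp [edgeList, List.mem_sublistsLen]

theorem edgeList_nodup {r n : ℕ} (G : Hypergraph r n) : (edgeList G).Nodup :=
  (List.nodup_sublistsLen r (List.nodup_finRange n)).filter _

theorem edge_mem {r n : ℕ} (G : Hypergraph r n) (i : Fin (edgeList G).length) :
    edge G i ∈ G.image Subtype.val :=
  (mem_edgeList.1 (List.getElem_mem i.2)).2

theorem edge_injective {r n : ℕ} (G : Hypergraph r n) : Function.Injective (edge G) := by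
  intro i i' h
  have h1 := (mem_edgeList.1 (List.getElem_mem i.2)).1.1
  have h2 := (mem_edgeList.1 (List.getElem_mem i'.2)).1.1
  have hs := List.pairwise_lt_finRange n
  have hp : ((edgeList G)[i]).Perm (edgeList G)[i'] :=
    List.perm_of_nodup_nodup_toFinset_eq (h1.nodup (List.nodup_finRange n))
      (h2.nodup (List.nodup_finRange n)) h
  have he := hp.eq_of_pairwise' (r := (· < ·)) (hs.sublist h1) (hs.sublist h2)
  exact Fin.ext ((edgeList_nodup G).getElem_inj_iff.1 he)

theorem exists_edge_eq {r n : ℕ} {G : Hypergraph r n} {e : {e : Finset (Fin n) // e.card = r}}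
    (he : e ∈ G) : ∃ i, edge G i = e.val := by
  have hf : ((List.finRange n).filter fun v => decide (v ∈ e.val)).toFinset = e.val := by
    ext v; simp
  have hl : (List.finRange n).filter (fun v => decide (v ∈ e.val)) ∈ edgeList G := by
    refine mem_edgeList.2 ⟨⟨List.filter_sublist, ?_⟩, ?_⟩
    · refine Eq.trans ?_ e.2
      conv_rhs => rw [← hf]
      exact (List.toFinset_card_of_nodup ((List.nodup_finRange n).filter _)).symm
    · rw [hf]
      exact Finset.mem_image_of_mem _ he
  obtain ⟨i, hi, h⟩ := List.getElem_of_mem hl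
  refine ⟨⟨i, hi⟩, ?_⟩
  rw [edge]
  simp only [Fin.getElem_fin]
  rw [h, hf]

theorem block_flatMap {α : Type*} {N : ℕ} (f : α → List Bool) (L : List α)
    (hf : ∀ x ∈ L, (f x).length = N) (i : ℕ) (hi : i < L.length) :
    block N (L.flatMap f) i = f L[i] := by
  induction L generalizing i with
  | nil => simp at hi
  | cons x L ih =>
    have hx := hf x (by simp)
    cases i with
    | zero => simp [block, ← hx]
    | succ i =>
      have := ih (fun y hy => hf y (by simp [hy])) i (by simpa using hi)
      rw [block] at this
      rw [block, List.flatMap_cons, show (i + 1) * N = (f x).length + i * N by rw [hx]; ring,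
        List.drop_append, List.drop_of_length_le (by omega), Nat.add_sub_cancel_left,
        List.nil_append, this]
      rfl

theorem incidence_length {r n : ℕ} (G : Hypergraph r n) :
    (incidence G).length = (edgeList G).length * n := by
  simp [incidence, List.length_flatMap]

theorem block_incidence {r n : ℕ} (G : Hypergraph r n) (i : Fin (edgeList G).length) :
    block n (incidence G) i = (List.finRange n).map fun v => decide (v ∈ edge G i) := by
  rw [incidence, block_flatMap _ _ (by simp) i i.2]
  simp [edge]

theorem oneHot_eq (l : List Bool) (j : ℕ) (hl : l.length = j) (h : colour l < 2 ^ j) :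
    oneHot l = (List.finRange (2 ^ j)).map fun b =>
      decide (b ∈ ({⟨colour l, h⟩} : Finset (Fin (2 ^ j)))) := by
  subst hl
  apply List.ext_getElem
  · simp [oneHot]; omega
  · intro i h1 h2
    simp only [oneHot, List.getElem_map, Finset.mem_singleton, Fin.ext_iff]
    simp only [List.getElem_finRange, Fin.val_cast]
    rw [List.getElem_append]
    split_ifs with hi
    · simp at hi ⊢
      omega
    · simp at hi
      rw [List.getElem_cons]
      split_ifs with hi'
      · simp at hi' ⊢; omega
      · simp at hi' ⊢; omega

theorem encode_drawn {r n : ℕ} (G : Hypergraph r n) (j : ℕ) (c : List Bool)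
    (hc : (edgeList G).length * j ≤ c.length) :
    (drawn G j c).encode = encodeList (edgeList G).length n j (incidence G) c := by
  rw [Instance.encode, encodeList]
  congr 1
  rw [← List.map_coe_finRange_eq_range, List.flatMap_map]
  change (List.finRange (edgeList G).length).flatMap _ = _
  congr 1
  funext (i : Fin (edgeList G).length)
  rw [block_incidence G i, oneHot_eq _ j (block_length ((Nat.mul_le_mul_right _ i.2).trans hc))]
  rfl

/-- The number of sets in a solution, as the reduction counts it. -/
theorem card_decodeSol {r n : ℕ} (G : Hypergraph r n) (j : ℕ) (c O : List Bool) :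
    Nat.count (fun i => O[i]? = some true) (edgeList G).length =
      ((drawn G j c).decodeSol O).card := by
  rw [Nat.count_eq_card_filter_range, Instance.decodeSol]
  rw [← Finset.card_map Fin.valEmbedding]
  congr 1
  ext i
  simp only [Finset.mem_filter, Finset.mem_range, Finset.mem_map, Finset.mem_univ, true_and,
    Fin.valEmbedding_apply]
  constructor
  · rintro ⟨hi, h⟩
    exact ⟨⟨i, hi⟩, h, rfl⟩
  · rintro ⟨i, h, rfl⟩
    exact ⟨i.2, h⟩

theorem cover_eq {r n : ℕ} (G : Hypergraph r n) (O : List Bool) (i : ℕ)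
    (hi : i ≤ (edgeList G).length) :
    cover n (incidence G) O i = (List.finRange n).map fun v =>
      decide (∃ i' : Fin (edgeList G).length, (i' : ℕ) < i ∧ O[(i' : ℕ)]? = some true ∧
        v ∈ edge G i') := by
  induction i with
  | zero =>
    rw [cover]
    apply List.ext_getElem <;> simp
  | succ i ih =>
    have h := ih (by omega)
    have hb := block_incidence G ⟨i, hi⟩
    simp only at hb
    rw [cover, h, hb]
    split_ifs with hO
    · apply List.ext_getElem
      · simp
      · intro v _ _
        simp only [List.getElem_zipWith, List.getElem_map, ← Bool.decide_or]
        apply decide_eq_decide.2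
        constructor
        · rintro (⟨i', h1, h2, h3⟩ | h')
          · exact ⟨i', by omega, h2, h3⟩
          · exact ⟨⟨i, hi⟩, by simp, hO, h'⟩
        · rintro ⟨i', h1, h2, h3⟩
          rcases Nat.lt_succ_iff_lt_or_eq.1 h1 with h1 | h1
          · exact .inl ⟨i', h1, h2, h3⟩
          · right
            have e : (⟨i, hi⟩ : Fin (edgeList G).length) = i' := Fin.ext h1.symm
            exact e ▸ h3
    · congr 1
      funext v
      apply decide_eq_decide.2
      constructor
      · rintro ⟨i', h1, h2, h3⟩
        exact ⟨i', by omega, h2, h3⟩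
      · rintro ⟨i', h1, h2, h3⟩
        refine ⟨i', ?_, h2, h3⟩
        rcases Nat.lt_succ_iff_lt_or_eq.1 h1 with h1 | h1
        · exact h1
        · rw [h1] at h2
          exact absurd h2 hO

/-- The cost of a solution, as the reduction computes it. -/
theorem count_cover {r n : ℕ} (G : Hypergraph r n) (j : ℕ) (c O : List Bool) :
    (cover n (incidence G) O (edgeList G).length).count true =
      (drawn G j c).cost ((drawn G j c).decodeSol O) := by
  have h : (drawn G j c).cost ((drawn G j c).decodeSol O) = (Finset.univ.filter fun v : Fin n =>
      ∃ i' : Fin (edgeList G).length, (i' : ℕ) < (edgeList G).length ∧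
        O[(i' : ℕ)]? = some true ∧ v ∈ edge G i').card := by
    change ((Finset.univ.filter fun i : Fin (edgeList G).length =>
      O[(i : ℕ)]? = some true).biUnion (edge G)).card = _
    congr 1
    ext v
    simp
  rw [h, cover_eq G O _ le_rfl, List.count_eq_countP, List.countP_map, List.countP_eq_length_filter,
    ← List.toFinset_card_of_nodup ((List.nodup_finRange n).filter _)]
  congr 1
  ext v
  simp

theorem beats_iff {r n : ℕ} (G : Hypergraph r n) (j : ℕ) (c O : List Bool) :
    Beats (edgeList G).length n (2 ^ j) (incidence G) O ↔
      2 ^ j ≤ ((drawn G j c).decodeSol O).card ∧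
        (drawn G j c).cost ((drawn G j c).decodeSol O) < 2 ^ j := by
  rw [Beats, card_decodeSol G j c, count_cover G j c]

/-! ### The reduction runs in polynomial time -/

/-- A function of three natural numbers that is bounded by a power of their sum plus two. -/
def PolyBounded (f : ℕ → ℕ → ℕ → ℕ) : Prop := ∃ c, ∀ m n k, f m n k ≤ (m + n + k + 2) ^ c

namespace PolyBounded

variable {f g : ℕ → ℕ → ℕ → ℕ}

theorem const (a : ℕ) : PolyBounded fun _ _ _ => a := by
  refine ⟨a, fun m n k => ?_⟩
  calc a ≤ 2 ^ a := Nat.lt_two_pow_self.le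
    _ ≤ (m + n + k + 2) ^ a := Nat.pow_le_pow_left (by omega) _

theorem first : PolyBounded fun m _ _ => m :=
  ⟨1, fun m n k => by rw [pow_one]; dsimp only; omega⟩

theorem second : PolyBounded fun _ n _ => n :=
  ⟨1, fun m n k => by rw [pow_one]; dsimp only; omega⟩

theorem third : PolyBounded fun _ _ k => k :=
  ⟨1, fun m n k => by rw [pow_one]; dsimp only; omega⟩

theorem add (hf : PolyBounded f) (hg : PolyBounded g) :
    PolyBounded fun m n k => f m n k + g m n k := by
  obtain ⟨a, ha⟩ := hf
  obtain ⟨b, hb⟩ := hg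
  refine ⟨max a b + 1, fun m n k => ?_⟩
  have h1 : (m + n + k + 2) ^ a ≤ (m + n + k + 2) ^ max a b :=
    Nat.pow_le_pow_right (by omega) (le_max_left _ _)
  have h2 : (m + n + k + 2) ^ b ≤ (m + n + k + 2) ^ max a b :=
    Nat.pow_le_pow_right (by omega) (le_max_right _ _)
  have := ha m n k
  have := hb m n k
  calc f m n k + g m n k ≤ (m + n + k + 2) ^ max a b * 2 := by omega
    _ ≤ (m + n + k + 2) ^ max a b * (m + n + k + 2) := Nat.mul_le_mul_left _ (by omega)
    _ = (m + n + k + 2) ^ (max a b + 1) := (pow_succ _ _).symm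

theorem mul (hf : PolyBounded f) (hg : PolyBounded g) :
    PolyBounded fun m n k => f m n k * g m n k := by
  obtain ⟨a, ha⟩ := hf
  obtain ⟨b, hb⟩ := hg
  refine ⟨a + b, fun m n k => ?_⟩
  rw [pow_add]
  exact Nat.mul_le_mul (ha m n k) (hb m n k)

theorem pow (hf : PolyBounded f) (d : ℕ) : PolyBounded fun m n k => f m n k ^ d := by
  obtain ⟨a, ha⟩ := hf
  refine ⟨a * d, fun m n k => ?_⟩
  rw [pow_mul]
  exact Nat.pow_le_pow_left (ha m n k) _

theorem mono (hf : PolyBounded f) (h : ∀ m n k, g m n k ≤ f m n k) : PolyBounded g := by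
  obtain ⟨a, ha⟩ := hf
  exact ⟨a, fun m n k => (h m n k).trans (ha m n k)⟩

theorem size : PolyBounded fun _ _ k => 2 * k.size :=
  ((const 2).mul third).mono fun _ _ _ =>
    Nat.mul_le_mul_left _ (Nat.size_le.2 Nat.lt_two_pow_self)

end PolyBounded

theorem two_pow_size_le (k : ℕ) : 2 ^ k.size ≤ 2 * k + 1 := by
  rcases Nat.eq_zero_or_pos k with rfl | hk
  · simp
  · have h1 : 0 < k.size := Nat.size_pos.2 hk
    have h2 : 2 ^ (k.size - 1) ≤ k := Nat.lt_size.1 (by omega)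
    have h3 : 2 ^ k.size = 2 * 2 ^ (k.size - 1) := by
      rw [← pow_succ']
      congr 1
      omega
    omega

theorem PolyBounded.two_pow_size : PolyBounded fun _ _ k => 2 ^ (2 * k.size) :=
  ((((const 2).mul third).add (const 1)).pow 2).mono fun _ _ k => by
    rw [mul_comm, pow_mul]
    exact Nat.pow_le_pow_left (two_pow_size_le k) 2

theorem PolyBounded.setupTime (e : ℕ) {j b l : ℕ → ℕ → ℕ → ℕ} (hj : PolyBounded j)
    (hb : PolyBounded b) (hl : PolyBounded fun m n k => l m n k ^ e) :
    PolyBounded fun m n k => setupTime m n k (j m n k) (b m n k) (l m n k) e := by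
  unfold RedBlue.setupTime
  repeat with_reducible first
    | exact hj
    | exact hb
    | exact hl
    | exact PolyBounded.first
    | exact PolyBounded.second
    | exact PolyBounded.third
    | exact PolyBounded.const _
    | apply PolyBounded.add
    | apply PolyBounded.mul

theorem PolyBounded.roundTime (B : ℕ) {j D T : ℕ → ℕ → ℕ → ℕ} (hj : PolyBounded j)
    (hb : PolyBounded fun m n k => 2 ^ j m n k) (hD : PolyBounded D) (hT : PolyBounded T) :
    PolyBounded fun m n k => roundTime B m n (j m n k) (D m n k) (T m n k) := by
  unfold RedBlue.roundTime
  repeat with_reducible first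
    | exact hj
    | exact hb
    | exact hD
    | exact hT
    | exact PolyBounded.first
    | exact PolyBounded.second
    | exact PolyBounded.const _
    | apply PolyBounded.add
    | apply PolyBounded.mul

/-- The length of the encoding of the drawn instance. -/
def instLength (m n k : ℕ) : ℕ := m + n + 2 ^ (2 * k.size) + 3 + m * (n + 2 ^ (2 * k.size))

theorem exists_poly_bounds (d B : ℕ) : ∃ e d' : ℕ, ∀ m n k : ℕ,
    instLength m n k ^ d + d ≤ (m + n + k + 2) ^ e ∧
    2 * k.size * (m * (2 * k.size) + (m + n + k + 2) ^ e) ≤ (m + n + k + 2) ^ d' ∧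
    setupTime m n k (2 * k.size) (2 ^ (2 * k.size)) (m + n + k + 2) e +
        (2 * k.size * (roundTime B m n (2 * k.size) ((m + n + k + 2) ^ e)
          (instLength m n k ^ d + d) + 11) + 3) ≤ (m + n + k + 2) ^ d' := by
  have hl : PolyBounded fun m n k => m + n + k + 2 :=
    ((PolyBounded.first.add .second).add .third).add (.const 2)
  have hI : PolyBounded instLength :=
    (((PolyBounded.first.add .second).add .two_pow_size).add (.const 3)).add
      (PolyBounded.first.mul (PolyBounded.second.add .two_pow_size))
  have hT := (hI.pow d).add (.const d)
  obtain ⟨e, he⟩ := id hT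
  have h1 : PolyBounded fun m n k => 2 * k.size * (m * (2 * k.size) + (m + n + k + 2) ^ e) :=
    PolyBounded.size.mul ((PolyBounded.first.mul .size).add (hl.pow e))
  have h2 : PolyBounded fun m n k =>
      setupTime m n k (2 * k.size) (2 ^ (2 * k.size)) (m + n + k + 2) e :=
    PolyBounded.setupTime e .size .two_pow_size (hl.pow e)
  have h3 : PolyBounded fun m n k => 2 * k.size * (roundTime B m n (2 * k.size)
      ((m + n + k + 2) ^ e) (instLength m n k ^ d + d) + 11) + 3 :=
    (PolyBounded.size.mul ((PolyBounded.roundTime B .size .two_pow_size (hl.pow e) hT).add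
      (.const 11))).add (.const 3)
  obtain ⟨a, ha⟩ := h1
  obtain ⟨b, hb⟩ := h2.add h3
  refine ⟨e, max a b, fun m n k => ⟨he m n k, (ha m n k).trans ?_, (hb m n k).trans ?_⟩⟩
  · exact Nat.pow_le_pow_right (by omega) (le_max_left _ _)
  · exact Nat.pow_le_pow_right (by omega) (le_max_right _ _)

/-- An algorithm that stops within `T` steps does not notice that it got more than `T` coins. -/
theorem Runs.more_coins {p : Prog} {l v : List Bool} {t T : ℕ} {s : Store}
    (h : Runs p (initStore l (v.take T)) t s) (ht : t ≤ T) (hv : T ≤ v.length) :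
    Runs p (initStore l v) t (Function.update s 1 (s 1 ++ v.drop T)) := by
  have h' := (h.append_bottom 1 (v.drop T) (by simp [initStore]; omega)).1
  convert h' using 1
  simp [initStore_eq]

theorem DvRInput.encode_eq {r : ℕ} (J : DvRInput r) :
    J.encode = unary (edgeList J.G).length ++ unary J.n ++ unary J.k ++ incidence J.G := rfl

theorem encode_drawn_length {r n : ℕ} (G : Hypergraph r n) (k : ℕ) (c : List Bool)
    (hc : (edgeList G).length * (2 * k.size) ≤ c.length) :
    (drawn G (2 * k.size) c).encode.length = instLength (edgeList G).length n k := by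
  rw [encode_drawn G _ c hc, encodeList_length (incidence_length G) hc, instLength]

/-- A solution of the instance `I` that has at least as many sets as there are blue elements, but
covers fewer red elements. -/
def Instance.Cheap (I : Instance) (O : List Bool) : Prop :=
  I.k ≤ (I.decodeSol O).card ∧ I.cost (I.decodeSol O) < I.k

/-- The algorithm `A`, with the coins `v`, finds a cheap solution of `I`. -/
def FindsCheap (A : RandPolyTimeAlg Instance.encode) (I : Instance) (v : List Bool) : Prop :=
  ∃ t s, Runs A.prog (initStore I.encode v) t s ∧ I.Cheap (s 2)

theorem accepts_iff (A : RandPolyTimeAlg Instance.encode) {r n : ℕ} (G : Hypergraph r n)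
    (k D : ℕ) (c : List Bool) (hc : (edgeList G).length * (2 * k.size) ≤ c.length) :
    Accepts A.prog (edgeList G).length n (2 * k.size) D (incidence G) c ↔
      FindsCheap A (drawn G (2 * k.size) c)
        ((c.drop ((edgeList G).length * (2 * k.size))).take D).reverse := by
  simp only [Accepts, FindsCheap, ← encode_drawn G _ c hc, beats_iff G _ c]
  rfl

/-- Additional coins do not change the run of an algorithm. -/
theorem RandPolyTimeAlg.exists_run (A : RandPolyTimeAlg Instance.encode) (I : Instance)
    (v : List Bool) (hv : I.encode.length ^ A.d + A.d ≤ v.length) :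
    ∃ t s, t ≤ I.encode.length ^ A.d + A.d ∧
      Runs A.prog (initStore I.encode (v.take (I.encode.length ^ A.d + A.d))) t s ∧
      Runs A.prog (initStore I.encode v) t
        (Function.update s 1 (s 1 ++ v.drop (I.encode.length ^ A.d + A.d))) := by
  set T := I.encode.length ^ A.d + A.d with hT
  obtain ⟨t, s, hr, ht⟩ := A.halts I fun i => v[i]
  have e : List.ofFn (fun i : Fin T => v[i]) = v.take T := by
    apply List.ext_getElem
    · simp [hv]
    · intro i h1 h2
      simp
  rw [e] at hr
  exact ⟨t, s, ht, hr, hr.more_coins ht hv⟩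

theorem findsCheap_take_iff (A : RandPolyTimeAlg Instance.encode) (I : Instance)
    (v : List Bool) (hv : I.encode.length ^ A.d + A.d ≤ v.length) :
    FindsCheap A I (v.take (I.encode.length ^ A.d + A.d)) ↔ FindsCheap A I v := by
  obtain ⟨t, s, -, h1, h2⟩ := A.exists_run I v hv
  constructor
  · rintro ⟨t', s', h, hs⟩
    obtain ⟨rfl, rfl⟩ := h1.deterministic h
    exact ⟨_, _, h2, hs⟩
  · rintro ⟨t', s', h, hs⟩
    obtain ⟨rfl, rfl⟩ := h2.deterministic h
    exact ⟨_, _, h1, hs⟩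

/-- The algorithm `B` for the Dense-vs-Random problem answers "dense" exactly if the hypergraph has
more than `n ^ 3 / b` edges, where `b = 2 ^ (2 * k.size)`, or one of `2 * k.size` rounds with
disjoint segments of the random bits accepts.  In each round `A` gets
`(m + n + k + 2) ^ e` random bits, where `m` is the number of edges; these are enough, and `B` has
enough random bits for all rounds. -/
def IsReduction (A : RandPolyTimeAlg Instance.encode) {r : ℕ}
    (B : RandPolyTimeAlg (DvRInput.encode (r := r))) (e : ℕ) : Prop :=
  ∀ (n k : ℕ) (G : Hypergraph r n),
    instLength (edgeList G).length n k ^ A.d + A.d ≤ ((edgeList G).length + n + k + 2) ^ e ∧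
    2 * k.size * ((edgeList G).length * (2 * k.size) + ((edgeList G).length + n + k + 2) ^ e) ≤
      (DvRInput.encode ⟨n, k, G⟩).length ^ B.d + B.d ∧
    ∀ c : List Bool, c.length = (DvRInput.encode ⟨n, k, G⟩).length ^ B.d + B.d →
      ((∃ t s, Runs B.prog (initStore (DvRInput.encode ⟨n, k, G⟩) c) t s ∧ saysDense (s 2)) ↔
        n * (n * n) < (edgeList G).length * 2 ^ (2 * k.size) ∨ ∃ i < 2 * k.size,
          Accepts A.prog (edgeList G).length n (2 * k.size)
            (((edgeList G).length + n + k + 2) ^ e) (incidence G)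
            (c.drop (i * ((edgeList G).length * (2 * k.size) +
              ((edgeList G).length + n + k + 2) ^ e))))

/-- The reduction is a randomized polynomial-time algorithm. -/
theorem exists_isReduction (A : RandPolyTimeAlg Instance.encode) (r : ℕ) :
    ∃ (B : RandPolyTimeAlg (DvRInput.encode (r := r))) (e : ℕ), IsReduction A B e := by
  obtain ⟨e, d', h⟩ := exists_poly_bounds A.d A.prog.bound
  have hlen : ∀ (n k : ℕ) (G : Hypergraph r n),
      ((edgeList G).length + n + k + 2) ^ d' ≤ (DvRInput.encode ⟨n, k, G⟩).length ^ d' := by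
    intro n k G
    refine Nat.pow_le_pow_left ?_ _
    simp [DvRInput.encode_eq, unary]
    omega
  have key : ∀ (n k : ℕ) (G : Hypergraph r n) (c : List Bool),
      c.length = (DvRInput.encode ⟨n, k, G⟩).length ^ d' + d' →
      ∃ s', RunsIn (reduction e A.prog) (initStore (DvRInput.encode ⟨n, k, G⟩) c)
        ((DvRInput.encode ⟨n, k, G⟩).length ^ d' + d') s' ∧
        (saysDense (s' 2) ↔ n * (n * n) < (edgeList G).length * 2 ^ (2 * k.size) ∨
          ∃ i < 2 * k.size, Accepts A.prog (edgeList G).length n (2 * k.size)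
              (((edgeList G).length + n + k + 2) ^ e) (incidence G)
              (c.drop (i * ((edgeList G).length * (2 * k.size) +
                ((edgeList G).length + n + k + 2) ^ e)))) := by
    intro n k G c hc
    obtain ⟨h1, h2, h3⟩ := h (edgeList G).length n k
    have hl := hlen n k G
    obtain ⟨s', hs, hd⟩ := runsIn_reduction A.prog (edgeList G).length n k e
      (instLength (edgeList G).length n k ^ A.d + A.d) (incidence G) c (incidence_length G)
      (by omega) (by
        intro c hc
        have hI := encode_drawn_length G k c (by omega)
        rw [← encode_drawn G _ c (by omega), ← hI]
        obtain ⟨t, s, ht, -, hr⟩ := A.exists_run (drawn G (2 * k.size) c)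
          ((c.drop ((edgeList G).length * (2 * k.size))).take
            (((edgeList G).length + n + k + 2) ^ e)).reverse (by
              rw [hI, List.length_reverse, List.length_take, List.length_drop]
              omega)
        exact ⟨_, t, ht, hr⟩)
    exact ⟨s', hs.mono (by omega), hd⟩
  refine ⟨⟨reduction e A.prog, d', ?_⟩, e, ?_⟩
  · rintro ⟨n, k, G⟩ coins
    obtain ⟨s', ⟨t, ht, hr⟩, -⟩ := key n k G (List.ofFn coins) (by simp)
    exact ⟨t, s', hr, ht⟩
  · intro n k G
    obtain ⟨h1, h2, -⟩ := h (edgeList G).length n k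
    refine ⟨h1, (h2.trans (hlen n k G)).trans (Nat.le_add_right _ _), fun c hc => ?_⟩
    obtain ⟨s', ⟨t, -, hr⟩, hd⟩ := key n k G c hc
    rw [← hd]
    constructor
    · rintro ⟨t₂, s₂, hr₂, h⟩
      obtain ⟨-, rfl⟩ := hr.deterministic hr₂
      exact h
    · exact fun h => ⟨t, s', hr, h⟩

/-! ### Averages over random bits -/

/-- The average of `f` over all bit strings of length `n`. -/
noncomputable def avg : ℕ → (List Bool → ℝ) → ℝ
  | 0, f => f []
  | n + 1, f => (avg n (fun l => f (false :: l)) + avg n fun l => f (true :: l)) / 2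

open Classical in
/-- The truth value of `P` as a real number. -/
noncomputable def ind (P : Prop) : ℝ := if P then 1 else 0

theorem ind_nonneg (P : Prop) : 0 ≤ ind P := by
  unfold ind; split_ifs <;> norm_num

theorem ind_le_one (P : Prop) : ind P ≤ 1 := by
  unfold ind; split_ifs <;> norm_num

theorem ind_of {P : Prop} (h : P) : ind P = 1 := if_pos h

theorem ind_of_not {P : Prop} (h : ¬P) : ind P = 0 := if_neg h

theorem ind_mono {P Q : Prop} (h : P → Q) : ind P ≤ ind Q := by
  by_cases hP : P
  · rw [ind_of hP, ind_of (h hP)]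
  · rw [ind_of_not hP]
    exact ind_nonneg Q

theorem ind_not (P : Prop) : ind (¬P) = 1 - ind P := by
  by_cases h : P
  · rw [ind_of h, ind_of_not (not_not.2 h), sub_self]
  · rw [ind_of h, ind_of_not h, sub_zero]

theorem ind_and (P Q : Prop) : ind (P ∧ Q) = ind P * ind Q := by
  by_cases h : P <;> by_cases h' : Q <;> simp [ind, h, h']

theorem avg_mono {n : ℕ} {f g : List Bool → ℝ} (h : ∀ l, l.length = n → f l ≤ g l) :
    avg n f ≤ avg n g := by
  induction n generalizing f g with
  | zero => exact h [] rfl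
  | succ n ih =>
    have h0 := ih (f := fun l => f (false :: l)) (g := fun l => g (false :: l))
      fun l hl => h _ (by simp [hl])
    have h1 := ih (f := fun l => f (true :: l)) (g := fun l => g (true :: l))
      fun l hl => h _ (by simp [hl])
    simp only [avg]
    linarith

theorem avg_congr {n : ℕ} {f g : List Bool → ℝ} (h : ∀ l, l.length = n → f l = g l) :
    avg n f = avg n g :=
  le_antisymm (avg_mono fun l hl => (h l hl).le) (avg_mono fun l hl => (h l hl).ge)

theorem avg_const (n : ℕ) (a : ℝ) : avg n (fun _ => a) = a := by
  induction n with
  | zero => rfl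
  | succ n ih => simp [avg, ih]

theorem avg_const_mul (n : ℕ) (a : ℝ) (f : List Bool → ℝ) :
    avg n (fun l => a * f l) = a * avg n f := by
  induction n generalizing f with
  | zero => rfl
  | succ n ih => simp only [avg, ih]; ring

theorem avg_mul_const (n : ℕ) (a : ℝ) (f : List Bool → ℝ) :
    avg n (fun l => f l * a) = avg n f * a := by
  simp only [mul_comm _ a, avg_const_mul]

theorem avg_add (n : ℕ) (f g : List Bool → ℝ) :
    avg n (fun l => f l + g l) = avg n f + avg n g := by
  induction n generalizing f g with
  | zero => rfl
  | succ n ih => simp only [avg, ih]; ring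

theorem avg_sum {ι : Type*} (s : Finset ι) (n : ℕ) (f : ι → List Bool → ℝ) :
    avg n (fun l => ∑ i ∈ s, f i l) = ∑ i ∈ s, avg n (f i) := by
  classical
  induction s using Finset.induction_on with
  | empty => simp [avg_const]
  | insert a s ha ih => simp only [Finset.sum_insert ha, avg_add, ih]

theorem avg_ind_not (n : ℕ) (P : List Bool → Prop) :
    avg n (fun l => ind (¬P l)) = 1 - avg n fun l => ind (P l) := by
  have h := avg_add n (fun l => ind (¬P l)) fun l => ind (P l)
  have e : (fun l => ind (¬P l) + ind (P l)) = fun _ => 1 := by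
    funext l; rw [ind_not]; ring
  rw [e, avg_const] at h
  linarith

theorem avg_append (a b : ℕ) (f : List Bool → ℝ) :
    avg (a + b) f = avg a fun u => avg b fun v => f (u ++ v) := by
  induction a generalizing f with
  | zero => simp [avg]
  | succ a ih => rw [Nat.add_right_comm]; simp only [avg, ih]; rfl

theorem avg_reverse (n : ℕ) (f : List Bool → ℝ) : avg n (fun l => f l.reverse) = avg n f := by
  induction n generalizing f with
  | zero => rfl
  | succ n ih =>
    rw [avg_append n 1 f]
    have h1 := ih fun l => f (l ++ [false])
    have h2 := ih fun l => f (l ++ [true])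
    simp only [avg, List.reverse_cons]
    rw [h1, h2, ← avg_add]
    simp only [div_eq_mul_inv, ← avg_mul_const]

theorem sum_ofFn (n : ℕ) (f : List Bool → ℝ) :
    ∑ v : Fin n → Bool, f (List.ofFn v) = 2 ^ n * avg n f := by
  induction n generalizing f with
  | zero => simp [avg]
  | succ n ih =>
    rw [← (Fin.consEquiv fun _ => Bool).sum_comp, Fintype.sum_prod_type]
    have e : ∀ (b : Bool) (v : Fin n → Bool),
        List.ofFn ((Fin.consEquiv fun _ => Bool) (b, v)) = b :: List.ofFn v := by
      intro b v
      rw [List.ofFn_succ]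
      rfl
    simp only [e, Fintype.sum_bool]
    rw [ih fun l => f (true :: l), ih fun l => f (false :: l), avg]
    ring

theorem RandPolyTimeAlg.prob_eq {Inst : Type} {encode : Inst → List Bool}
    (A : RandPolyTimeAlg encode) (I : Inst) (E : List Bool → Prop) :
    A.prob I E = avg ((encode I).length ^ A.d + A.d)
      fun c => ind (∃ t s, Runs A.prog (initStore (encode I) c) t s ∧ E (s 2)) := by
  classical
  have h := sum_ofFn ((encode I).length ^ A.d + A.d)
    fun c => ind (∃ t s, Runs A.prog (initStore (encode I) c) t s ∧ E (s 2))
  rw [RandPolyTimeAlg.prob, div_eq_iff (by positivity), mul_comm, ← h, Set.ncard_eq_toFinset_card']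
  simp only [ind, Finset.sum_boole]
  congr 2
  ext
  simp

/-! ### Random colourings -/

theorem avg_colour {j c : ℕ} (hc : c < 2 ^ j) :
    avg j (fun l => ind (colour l = c)) = 1 / 2 ^ j := by
  induction j generalizing c with
  | zero =>
    have : c = 0 := by simpa using hc
    simp [avg, colour, this, ind]
  | succ j ih =>
    have h0 : ∀ l, colour (false :: l) = c ↔ (colour l = c / 2 ∧ c % 2 = 0) := by
      intro l; simp [colour]; omega
    have h1 : ∀ l, colour (true :: l) = c ↔ (colour l = c / 2 ∧ c % 2 = 1) := by
      intro l; simp [colour]; omega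
    simp only [avg, h0, h1, ind_and, avg_mul_const]
    rw [ih (by rw [pow_succ] at hc; omega)]
    rcases Nat.mod_two_eq_zero_or_one c with h | h
    · rw [ind_of h, ind_of_not (by omega : ¬c % 2 = 1)]
      rw [pow_succ]
      field_simp
      norm_num
    · rw [ind_of h, ind_of_not (by omega : ¬c % 2 = 0)]
      rw [pow_succ]
      field_simp
      norm_num

theorem block_append_succ {j : ℕ} {u v : List Bool} (hu : u.length = j) (i : ℕ) :
    block j (u ++ v) (i + 1) = block j v i := by
  rw [block, block, show (i + 1) * j = u.length + i * j by rw [hu]; ring,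
    List.drop_length_add_append]

theorem block_append_of_le {j i : ℕ} {u v : List Bool} (hu : (i + 1) * j ≤ u.length) :
    block j (u ++ v) i = block j u i := by
  have e : (i + 1) * j = i * j + j := by ring
  rw [block, block, List.drop_append_of_le_length (by omega), List.take_append_of_le_length
    (by rw [List.length_drop]; omega)]

/-- Disjoint blocks of random bits are independent. -/
theorem avg_prod_block (m j : ℕ) (g : ℕ → List Bool → ℝ) :
    avg (m * j) (fun l => ∏ i ∈ Finset.range m, g i (block j l i)) =
      ∏ i ∈ Finset.range m, avg j (g i) := by
  induction m generalizing g with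
  | zero => simp [avg]
  | succ m ih =>
    rw [show (m + 1) * j = j + m * j by ring, avg_append, Finset.prod_range_succ', ← ih,
      mul_comm (avg _ _), ← avg_mul_const]
    refine avg_congr fun u hu => ?_
    rw [← avg_const_mul]
    refine avg_congr fun v _ => ?_
    rw [Finset.prod_range_succ', mul_comm]
    congr 1
    · rw [block_append_of_le (by omega)]
      simp [block, ← hu]
    · exact Finset.prod_congr rfl fun i _ => by rw [block_append_succ hu]

/-- If at least one of the colours is missing on a set `F` of edges, this is due to one of the
`2 ^ j` colours, and each one is missing with probability `(1 - 2 ^ (-j)) ^ |F|`. -/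
theorem avg_not_covers_le {r n : ℕ} (G : Hypergraph r n) (j : ℕ)
    (F : Finset (Fin (edgeList G).length)) :
    avg ((edgeList G).length * j) (fun u => ind ¬(drawn G j u).Covers F) ≤
      2 ^ j * (1 - 1 / 2 ^ j) ^ F.card := by
  classical
  set g : ℕ → ℕ → List Bool → ℝ := fun c i l =>
    if ∃ h : i < (edgeList G).length, (⟨i, h⟩ : Fin (edgeList G).length) ∈ F then
      ind (¬colour l = c) else 1 with hg
  have hle : ∀ u : List Bool, ind (¬(drawn G j u).Covers F) ≤
      ∑ c ∈ Finset.range (2 ^ j), ∏ i ∈ Finset.range (edgeList G).length, g c i (block j u i) := by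
    intro u
    have hpos : ∀ c ∈ Finset.range (2 ^ j),
        0 ≤ ∏ i ∈ Finset.range (edgeList G).length, g c i (block j u i) := by
      intro c _
      refine Finset.prod_nonneg fun i _ => ?_
      simp only [hg]
      split_ifs
      exacts [ind_nonneg _, zero_le_one]
    by_cases hcov : (drawn G j u).Covers F
    · rw [ind_of_not (not_not.2 hcov)]
      exact Finset.sum_nonneg hpos
    · obtain ⟨c, hc⟩ : ∃ c : Fin (2 ^ j), c ∉ F.biUnion (drawn G j u).blue := by
        by_contra h
        push Not at h
        exact hcov (Finset.eq_univ_iff_forall.2 h)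
      refine le_trans ?_ (Finset.single_le_sum hpos (Finset.mem_range.2 c.2))
      rw [ind_of hcov, Finset.prod_eq_one]
      intro i _
      simp only [hg]
      split_ifs with hi
      · obtain ⟨h, hF⟩ := hi
        refine ind_of fun h' => hc (Finset.mem_biUnion.2 ⟨_, hF, ?_⟩)
        exact Finset.mem_singleton.2 (Fin.ext h'.symm)
      · rfl
  refine (avg_mono fun u _ => hle u).trans ?_
  rw [avg_sum]
  have hc : ∀ c ∈ Finset.range (2 ^ j),
      avg ((edgeList G).length * j) (fun u =>
          ∏ i ∈ Finset.range (edgeList G).length, g c i (block j u i)) =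
        (1 - 1 / 2 ^ j) ^ F.card := by
    intro c hc
    rw [avg_prod_block]
    have h1 : ∀ i, avg j (g c i) =
        if ∃ h : i < (edgeList G).length, (⟨i, h⟩ : Fin (edgeList G).length) ∈ F then
          (1 - 1 / 2 ^ j : ℝ) else 1 := by
      intro i
      simp only [hg]
      split_ifs
      · rw [avg_ind_not, avg_colour (Finset.mem_range.1 hc)]
      · exact avg_const _ _
    simp only [h1]
    rw [Finset.prod_ite, Finset.prod_const, Finset.prod_const_one, mul_one]
    congr 1
    rw [← Finset.card_map Fin.valEmbedding]
    congr 1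
    ext i
    simp only [Finset.mem_filter, Finset.mem_range, Finset.mem_map, Fin.valEmbedding_apply]
    constructor
    · rintro ⟨_, h, hF⟩
      exact ⟨_, hF, rfl⟩
    · rintro ⟨i, hF, rfl⟩
      exact ⟨i.2, i.2, hF⟩
  rw [Finset.sum_congr rfl hc, Finset.sum_const, Finset.card_range, nsmul_eq_mul]
  push_cast
  rfl

/-! ### The success probability of the reduction -/

/-- Independent repetition: if `R` disjoint blocks of `N` random bits each are bad with
probability at most `q`, then all of them are with probability at most `q ^ R`. -/
theorem avg_forall_not_le {N : ℕ} {q : ℝ} (good : List Bool → Prop)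
    (hgood : ∀ c, N ≤ c.length → (good c ↔ good (c.take N)))
    (hq : avg N (fun c => ind ¬good c) ≤ q) (R M : ℕ) (hM : R * N ≤ M) :
    avg M (fun c => ind (∀ i < R, ¬good (c.drop (i * N)))) ≤ q ^ R := by
  have hq0 : 0 ≤ q := le_trans (by
    rw [← avg_const N 0]; exact avg_mono fun _ _ => ind_nonneg _) hq
  induction R generalizing M with
  | zero =>
    simp only [pow_zero]
    calc _ ≤ avg M fun _ => 1 := avg_mono fun _ _ => ind_le_one _
      _ = 1 := avg_const _ _
  | succ R ih =>
    obtain ⟨M, rfl⟩ : ∃ M', M = N + M' := ⟨M - N, by rw [Nat.add_mul] at hM; omega⟩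
    have h := ih M (by rw [Nat.add_mul] at hM; omega)
    rw [avg_append]
    calc _ = avg N fun u => ind (¬good u) *
          avg M fun v => ind (∀ i < R, ¬good (v.drop (i * N))) := by
          refine avg_congr fun u hu => ?_
          rw [← avg_const_mul]
          refine avg_congr fun v hv => ?_
          rw [← ind_and]
          congr 1
          apply propext
          have h0 : good (u ++ v) ↔ good u := by
            rw [hgood _ (by simp [hu]), ← hu, List.take_left']
            rfl
          have hs : ∀ i, (u ++ v).drop ((i + 1) * N) = v.drop (i * N) := by
            intro i
            rw [show (i + 1) * N = u.length + i * N by rw [hu]; ring, List.drop_length_add_append]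
          constructor
          · intro hall
            refine ⟨?_, fun i hi => ?_⟩
            · have := hall 0 (by omega)
              simpa [h0] using this
            · have := hall (i + 1) (by omega)
              rwa [hs] at this
          · rintro ⟨hu, hv⟩ i hi
            cases i with
            | zero => simpa [h0] using hu
            | succ i => rw [hs]; exact hv i (by omega)
      _ = avg N (fun u => ind (¬good u)) *
          avg M fun v => ind (∀ i < R, ¬good (v.drop (i * N))) := avg_mul_const _ _ _
      _ ≤ q * q ^ R := by
          refine mul_le_mul hq h ?_ hq0
          rw [← avg_const M 0]
          exact avg_mono fun _ _ => ind_nonneg _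
      _ = q ^ (R + 1) := (pow_succ' _ _).symm

theorem drawn_append {r n : ℕ} (G : Hypergraph r n) (j : ℕ) {u : List Bool}
    (hu : (edgeList G).length * j ≤ u.length) (v : List Bool) :
    drawn G j (u ++ v) = drawn G j u := by
  simp only [drawn]
  congr 1
  funext i
  congr 2
  rw [block_append_of_le ((Nat.mul_le_mul_right _ i.2).trans hu)]

/-- The coins arrive in reverse order, and there may be too many of them; neither matters. -/
theorem avg_findsCheap (A : RandPolyTimeAlg Instance.encode) (I : Instance) (D : ℕ)
    (hD : I.encode.length ^ A.d + A.d ≤ D) :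
    avg D (fun v => ind (FindsCheap A I v.reverse)) = A.prob I I.Cheap := by
  rw [avg_reverse D fun v => ind (FindsCheap A I v), A.prob_eq]
  obtain ⟨D, rfl⟩ := Nat.exists_eq_add_of_le hD
  rw [avg_append]
  refine avg_congr fun u hu => ?_
  rw [← avg_const D (ind (∃ t s, _))]
  refine avg_congr fun v _ => ?_
  rw [← findsCheap_take_iff A I _ (by simp [hu]), ← hu, List.take_left']
  · rfl
  · rfl

/-- A round fails only if the colours do not cover `F`, with probability at most `1 / 4`, or if the
algorithm fails on a drawn instance in which `F` is a solution, with probability at most `1 / 3`. -/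
theorem avg_not_accepts_le (A : RandPolyTimeAlg Instance.encode) {r n : ℕ} (G : Hypergraph r n)
    (k D : ℕ) (hD : instLength (edgeList G).length n k ^ A.d + A.d ≤ D)
    (F : Finset (Fin (edgeList G).length))
    (hF : (2 : ℝ) ^ (2 * k.size) * (1 - 1 / 2 ^ (2 * k.size)) ^ F.card ≤ 1 / 4)
    (hA : ∀ u, (drawn G (2 * k.size) u).Covers F →
      2 / 3 ≤ A.prob (drawn G (2 * k.size) u) (drawn G (2 * k.size) u).Cheap) :
    avg ((edgeList G).length * (2 * k.size) + D) (fun c => ind ¬Accepts A.prog (edgeList G).length n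
      (2 * k.size) D (incidence G) c) ≤ 1 / 2 := by
  have h1 : ∀ u : List Bool, u.length = (edgeList G).length * (2 * k.size) →
      avg D (fun v => ind ¬Accepts A.prog (edgeList G).length n (2 * k.size) D (incidence G)
        (u ++ v)) ≤
        1 / 3 + 2 / 3 * ind ¬(drawn G (2 * k.size) u).Covers F := by
    intro u hu
    have e : avg D (fun v => ind ¬Accepts A.prog (edgeList G).length n (2 * k.size) D (incidence G)
        (u ++ v)) =
        1 - A.prob (drawn G (2 * k.size) u) (drawn G (2 * k.size) u).Cheap := by
      rw [avg_ind_not, ← avg_findsCheap A _ D (by rwa [encode_drawn_length G k u hu.ge])]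
      congr 1
      refine avg_congr fun v hv => ?_
      rw [accepts_iff A G k D _ (by simp [hu]), drawn_append G (2 * k.size) hu.ge, ← hu,
        List.drop_left', List.take_of_length_le hv.le]
      rfl
    rw [e]
    by_cases hcov : (drawn G (2 * k.size) u).Covers F
    · rw [ind_of_not (not_not.2 hcov)]
      linarith [hA u hcov]
    · rw [ind_of hcov]
      have : 0 ≤ A.prob (drawn G (2 * k.size) u) (drawn G (2 * k.size) u).Cheap := by
        rw [RandPolyTimeAlg.prob]; positivity
      linarith
  rw [avg_append]
  refine (avg_mono h1).trans ?_
  rw [avg_add, avg_const, avg_const_mul]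
  linarith [(avg_not_covers_le G _ F).trans hF]

/-- A round depends only on the coins that it consumes. -/
theorem accepts_take_iff (p : Prog) {r n : ℕ} (G : Hypergraph r n) (j D : ℕ) (c : List Bool)
    (hc : (edgeList G).length * j + D ≤ c.length) :
    Accepts p (edgeList G).length n j D (incidence G) c ↔
      Accepts p (edgeList G).length n j D (incidence G)
        (c.take ((edgeList G).length * j + D)) := by
  have h1 : encodeList (edgeList G).length n j (incidence G)
      (c.take ((edgeList G).length * j + D)) =
      encodeList (edgeList G).length n j (incidence G) c := by
    rw [← encode_drawn G j c (by omega),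
      ← encode_drawn G j (c.take _) (by rw [List.length_take]; omega)]
    conv_rhs => rw [← List.take_append_drop ((edgeList G).length * j + D) c]
    rw [drawn_append G j (by rw [List.length_take]; omega)]
  have h2 : ((c.take ((edgeList G).length * j + D)).drop ((edgeList G).length * j)).take D =
      (c.drop ((edgeList G).length * j)).take D := by
    rw [List.drop_take, Nat.add_sub_cancel_left, List.take_take, min_self]
  rw [Accepts, Accepts, h1, h2]

/-! ### The reduction on random hypergraphs -/

theorem randomWeight_nonneg {r n : ℕ} {p : ℝ} (h0 : 0 ≤ p) (h1 : p ≤ 1) (G : Hypergraph r n) :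
    0 ≤ randomWeight p G :=
  mul_nonneg (pow_nonneg h0 _) (pow_nonneg (by linarith) _)

/-- All edges of `F` are present with probability `p ^ F.card`. -/
theorem sum_randomWeight_subset {r n : ℕ} (p : ℝ) (F : Hypergraph r n) :
    ∑ G : Hypergraph r n, randomWeight p G * ind (F ⊆ G) = p ^ F.card := by
  classical
  have h := Finset.prod_add (fun _ : {e : Finset (Fin n) // e.card = r} => p)
    (fun e => if e ∈ F then 0 else 1 - p) Finset.univ
  rw [Finset.powerset_univ] at h
  have h1 : ∏ e : {e : Finset (Fin n) // e.card = r}, (p + if e ∈ F then 0 else 1 - p) =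
      p ^ F.card := by
    have : ∀ e : {e : Finset (Fin n) // e.card = r}, (p + if e ∈ F then 0 else 1 - p) =
        if e ∈ F then p else 1 := by
      intro e; split_ifs <;> ring
    simp only [this]
    rw [Finset.prod_ite, Finset.prod_const, Finset.prod_const_one, mul_one]
    congr 2
    ext e
    simp
  rw [← h1, h]
  refine Finset.sum_congr rfl fun G _ => ?_
  rw [Finset.prod_const, randomWeight, mul_assoc]
  congr 1
  rw [← Finset.compl_eq_univ_sdiff]
  by_cases hF : F ⊆ G
  · rw [ind_of hF, mul_one, Finset.prod_congr rfl fun e he => if_neg fun h =>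
      (Finset.mem_compl.1 he) (hF h), Finset.prod_const]
  · rw [ind_of_not hF, mul_zero]
    obtain ⟨e, he, heG⟩ := Finset.not_subset.1 hF
    exact (Finset.prod_eq_zero (f := fun e => if e ∈ F then 0 else 1 - p)
      (Finset.mem_compl.2 heG) (if_pos he)).symm

theorem card_edges_subset_le {r n : ℕ} (T : Finset (Fin n)) :
    (Finset.univ.filter fun e : {e : Finset (Fin n) // e.card = r} => e.val ⊆ T).card ≤
      T.card ^ r := by
  refine le_trans ?_ (Nat.choose_le_pow T.card r)
  rw [← Finset.card_powersetCard, ← Finset.card_map (Function.Embedding.subtype _)]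
  refine Finset.card_le_card fun e he => ?_
  simp only [Finset.mem_map, Finset.mem_filter, Finset.mem_univ, true_and,
    Function.Embedding.subtype_apply] at he
  obtain ⟨e, he, rfl⟩ := he
  exact Finset.mem_powersetCard.2 ⟨he, e.2⟩

/-- By Markov's inequality, a random hypergraph does not have many edges. -/
theorem sum_randomWeight_card_le {r n : ℕ} {p : ℝ} (h0 : 0 ≤ p) (h1 : p ≤ 1) {a : ℝ}
    (ha : 0 < a) :
    ∑ G : Hypergraph r n, randomWeight p G * ind (a < G.card) ≤ n ^ r * p / a := by
  classical
  have hle : ∀ G : Hypergraph r n, ind (a < G.card) ≤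
      (∑ e : {e : Finset (Fin n) // e.card = r}, ind ({e} ⊆ G)) / a := by
    intro G
    have e : ∑ e : {e : Finset (Fin n) // e.card = r}, ind ({e} ⊆ G) = G.card := by
      simp [ind]
    rw [e]
    by_cases h : a < G.card
    · rw [ind_of h, le_div_iff₀ ha]
      linarith
    · rw [ind_of_not h]
      positivity
  calc _ ≤ ∑ G : Hypergraph r n, randomWeight p G *
        ((∑ e : {e : Finset (Fin n) // e.card = r}, ind ({e} ⊆ G)) / a) :=
        Finset.sum_le_sum fun G _ =>
          mul_le_mul_of_nonneg_left (hle G) (randomWeight_nonneg h0 h1 G)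
    _ = (∑ e : {e : Finset (Fin n) // e.card = r}, ∑ G : Hypergraph r n,
        randomWeight p G * ind ({e} ⊆ G)) / a := by
        rw [Finset.sum_comm, Finset.sum_div]
        refine Finset.sum_congr rfl fun G _ => ?_
        rw [← Finset.mul_sum]
        ring
    _ = (Finset.univ.filter fun e : {e : Finset (Fin n) // e.card = r} =>
          e.val ⊆ Finset.univ).card * p / a := by
        simp only [sum_randomWeight_subset, Finset.card_singleton, pow_one, Finset.sum_const,
          nsmul_eq_mul, Finset.subset_univ, Finset.filter_true]
    _ ≤ n ^ r * p / a := by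
        gcongr
        have := card_edges_subset_le (r := r) (Finset.univ : Finset (Fin n))
        rw [Finset.card_univ, Fintype.card_fin] at this
        exact_mod_cast this

/-- In a sparse random hypergraph no `b` edges lie in a set of only `b` vertices. -/
theorem sum_randomWeight_small_union_le {r n b : ℕ} {p : ℝ} (h0 : 0 ≤ p) (h1 : p ≤ 1) :
    ∑ G : Hypergraph r n, randomWeight p G *
      ind (∃ F ⊆ G, F.card = b ∧ ∃ T : Finset (Fin n), T.card = b ∧ ∀ e ∈ F, e.val ⊆ T) ≤
        (n * b ^ r * p) ^ b := by
  classical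
  set X : Finset (Fin n) → Finset (Hypergraph r n) := fun T =>
    Finset.powersetCard b (Finset.univ.filter fun e => e.val ⊆ T) with hX
  set Y := Finset.powersetCard b (Finset.univ : Finset (Fin n)) with hY
  have hle : ∀ G : Hypergraph r n, ind (∃ F ⊆ G, F.card = b ∧ ∃ T : Finset (Fin n),
      T.card = b ∧ ∀ e ∈ F, e.val ⊆ T) ≤ ∑ T ∈ Y, ∑ F ∈ X T, ind (F ⊆ G) := by
    intro G
    have hpos : ∀ T ∈ Y, 0 ≤ ∑ F ∈ X T, ind (F ⊆ G) := fun T _ =>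
      Finset.sum_nonneg fun _ _ => ind_nonneg _
    by_cases h : ∃ F ⊆ G, F.card = b ∧ ∃ T : Finset (Fin n), T.card = b ∧ ∀ e ∈ F, e.val ⊆ T
    · rw [ind_of h]
      obtain ⟨F, hF, hFb, T, hT, hFT⟩ := h
      calc (1 : ℝ) = ind (F ⊆ G) := (ind_of hF).symm
        _ ≤ ∑ F ∈ X T, ind (F ⊆ G) :=
          Finset.single_le_sum (f := fun F => ind (F ⊆ G)) (fun _ _ => ind_nonneg _)
            (Finset.mem_powersetCard.2 ⟨fun e he => by simpa using hFT e he, hFb⟩)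
        _ ≤ _ := Finset.single_le_sum (f := fun T => ∑ F ∈ X T, ind (F ⊆ G)) hpos
          (Finset.mem_powersetCard.2 ⟨Finset.subset_univ _, hT⟩)
    · rw [ind_of_not h]
      exact Finset.sum_nonneg hpos
  calc _ ≤ ∑ G : Hypergraph r n, randomWeight p G * ∑ T ∈ Y, ∑ F ∈ X T, ind (F ⊆ G) :=
        Finset.sum_le_sum fun G _ =>
          mul_le_mul_of_nonneg_left (hle G) (randomWeight_nonneg h0 h1 G)
    _ = ∑ T ∈ Y, ∑ F ∈ X T, ∑ G : Hypergraph r n, randomWeight p G * ind (F ⊆ G) := by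
        simp only [Finset.mul_sum]
        rw [Finset.sum_comm]
        exact Finset.sum_congr rfl fun T _ => Finset.sum_comm
    _ = ∑ T ∈ Y, ∑ F ∈ X T, p ^ b := by
        refine Finset.sum_congr rfl fun T _ => Finset.sum_congr rfl fun F hF => ?_
        rw [sum_randomWeight_subset, (Finset.mem_powersetCard.1 hF).2]
    _ ≤ ∑ T ∈ Y, ((b : ℝ) ^ r) ^ b * p ^ b := by
        refine Finset.sum_le_sum fun T hT => ?_
        rw [Finset.sum_const, nsmul_eq_mul]
        gcongr
        have h : (X T).card ≤ (b ^ r) ^ b := by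
          rw [hX, Finset.card_powersetCard]
          refine (Nat.choose_le_pow _ _).trans (Nat.pow_le_pow_left ?_ _)
          rw [← (Finset.mem_powersetCard.1 hT).2]
          exact card_edges_subset_le T
        exact_mod_cast h
    _ ≤ (n : ℝ) ^ b * (((b : ℝ) ^ r) ^ b * p ^ b) := by
        rw [Finset.sum_const, nsmul_eq_mul]
        gcongr
        rw [hY, Finset.card_powersetCard, Finset.card_univ, Fintype.card_fin]
        exact_mod_cast Nat.choose_le_pow _ _
    _ = (n * b ^ r * p) ^ b := by rw [mul_pow, mul_pow]; ring

theorem image_edge {r n : ℕ} (G : Hypergraph r n) :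
    Finset.univ.image (edge G) = G.image Subtype.val := by
  ext e
  simp only [Finset.mem_image, Finset.mem_univ, true_and]
  constructor
  · rintro ⟨i, rfl⟩
    simpa using edge_mem G i
  · rintro ⟨e, he, rfl⟩
    exact exists_edge_eq he

theorem card_filter_edge {r n : ℕ} (G : Hypergraph r n) (P : Finset (Fin n) → Prop)
    [DecidablePred P] : (Finset.univ.filter fun i => P (edge G i)).card =
      (G.filter fun e => P e.val).card := by
  rw [← Finset.card_image_of_injective _ (edge_injective G),
    ← Finset.card_image_of_injective _ Subtype.val_injective]
  congr 1
  ext e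
  have h := Finset.ext_iff.1 (image_edge G) e
  simp only [Finset.mem_image, Finset.mem_univ, true_and, Finset.mem_filter] at h ⊢
  constructor
  · rintro ⟨i, hi, rfl⟩
    obtain ⟨e, he, h⟩ := h.1 ⟨i, rfl⟩
    exact ⟨e, ⟨he, h ▸ hi⟩, h⟩
  · rintro ⟨e', ⟨he, hP⟩, rfl⟩
    obtain ⟨i, hi⟩ := h.2 ⟨e', he, rfl⟩
    exact ⟨i, hi ▸ hP, hi⟩

theorem edgeList_length {r n : ℕ} (G : Hypergraph r n) : (edgeList G).length = G.card := by
  have h := card_filter_edge G fun _ => True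
  simpa using h

/-- A cheap solution consists of many edges with a small union. -/
theorem exists_small_union_of_accepts {A : RandPolyTimeAlg Instance.encode} {r n k D : ℕ}
    {G : Hypergraph r n} {c : List Bool} (hc : (edgeList G).length * (2 * k.size) ≤ c.length)
    (hb : 2 ^ (2 * k.size) ≤ n)
    (h : Accepts A.prog (edgeList G).length n (2 * k.size) D (incidence G) c) :
    ∃ F ⊆ G, F.card = 2 ^ (2 * k.size) ∧
      ∃ T : Finset (Fin n), T.card = 2 ^ (2 * k.size) ∧ ∀ e ∈ F, e.val ⊆ T := by
  classical
  rw [accepts_iff A G k D c hc] at h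
  obtain ⟨t, s, -, h1, h2⟩ := h
  set F₀ : Finset (Fin (edgeList G).length) := (drawn G (2 * k.size) c).decodeSol (s 2)
  have h2 : (F₀.biUnion (edge G)).card < 2 ^ (2 * k.size) := h2
  have h1 : 2 ^ (2 * k.size) ≤ F₀.card := h1
  obtain ⟨F, hF, hFb⟩ := Finset.exists_subset_card_eq h1
  obtain ⟨T, hT, hTb⟩ := Finset.exists_superset_card_eq h2.le
    (by simpa using hb : _ ≤ Fintype.card (Fin n))
  refine ⟨G.filter fun e => e.val ∈ F.image (edge G), Finset.filter_subset _ _, ?_, T, hTb, ?_⟩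
  · rw [← card_filter_edge G fun e => e ∈ F.image (edge G), ← hFb]
    congr 1
    ext i
    simp [(edge_injective G).eq_iff]
  · intro e he
    obtain ⟨i, hi, h⟩ := Finset.mem_image.1 (Finset.mem_filter.1 he).2
    rw [← h]
    exact (Finset.subset_biUnion_of_mem (edge G) (hF hi)).trans hT

/-- The reduction rarely answers "dense" on a random hypergraph: either there are many edges, or
some round has found `b` edges with at most `b` vertices in their union. -/
theorem IsReduction.random_le {A : RandPolyTimeAlg Instance.encode} {r e : ℕ}
    {B : RandPolyTimeAlg (DvRInput.encode (r := r))} (hB : IsReduction A B e) {n k : ℕ}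
    (hb : 2 ^ (2 * k.size) ≤ n) {p : ℝ} (h0 : 0 ≤ p) (h1 : p ≤ 1) :
    ∑ G : Hypergraph r n, randomWeight p G * B.prob ⟨n, k, G⟩ saysDense ≤
      n ^ r * p / (n ^ 3 / 2 ^ (2 * k.size)) +
        (n * (2 ^ (2 * k.size)) ^ r * p) ^ 2 ^ (2 * k.size) := by
  classical
  have hn : 0 < n := lt_of_lt_of_le (by positivity) hb
  have hprob : ∀ G : Hypergraph r n, B.prob ⟨n, k, G⟩ saysDense ≤
      ind ((n : ℝ) ^ 3 / 2 ^ (2 * k.size) < G.card) +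
      ind (∃ F ⊆ G, F.card = 2 ^ (2 * k.size) ∧
        ∃ T : Finset (Fin n), T.card = 2 ^ (2 * k.size) ∧ ∀ e ∈ F, e.val ⊆ T) := by
    intro G
    obtain ⟨-, h2, h3⟩ := hB n k G
    rw [B.prob_eq]
    set P := ∃ F ⊆ G, F.card = 2 ^ (2 * k.size) ∧
        ∃ T : Finset (Fin n), T.card = 2 ^ (2 * k.size) ∧ ∀ e ∈ F, e.val ⊆ T with hP
    calc _ ≤ avg _ fun _ => ind ((n : ℝ) ^ 3 / 2 ^ (2 * k.size) < G.card) + ind P := by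
          refine avg_mono fun c hc => ?_
          by_cases h : ∃ t s, Runs B.prog (initStore (DvRInput.encode ⟨n, k, G⟩) c) t s ∧
            saysDense (s 2)
          · rw [ind_of h]
            rcases (h3 c hc).1 h with h | ⟨i, hi, h⟩
            · rw [edgeList_length] at h
              have h' : (n : ℝ) ^ 3 / 2 ^ (2 * k.size) < G.card := by
                rw [div_lt_iff₀ (by positivity)]
                have : n ^ 3 = n * (n * n) := by ring
                rw [← this] at h
                exact_mod_cast h
              rw [ind_of h']
              linarith [ind_nonneg P]
            · have hPt : P := by
                refine exists_small_union_of_accepts ?_ hb h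
                rw [List.length_drop, hc]
                set N := (edgeList G).length * (2 * k.size) +
                  ((edgeList G).length + n + k + 2) ^ e with hN
                have e1 : (i + 1) * N ≤ 2 * k.size * N := Nat.mul_le_mul_right _ hi
                rw [Nat.add_mul, one_mul] at e1
                omega
              rw [ind_of hPt]
              linarith [ind_nonneg ((n : ℝ) ^ 3 / 2 ^ (2 * k.size) < G.card)]
          · rw [ind_of_not h]
            exact add_nonneg (ind_nonneg _) (ind_nonneg _)
      _ = _ := avg_const _ _
  calc _ ≤ ∑ G : Hypergraph r n, randomWeight p G *
      (ind ((n : ℝ) ^ 3 / 2 ^ (2 * k.size) < G.card) +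
      ind (∃ F ⊆ G, F.card = 2 ^ (2 * k.size) ∧
        ∃ T : Finset (Fin n), T.card = 2 ^ (2 * k.size) ∧ ∀ e ∈ F, e.val ⊆ T)) :=
        Finset.sum_le_sum fun G _ =>
          mul_le_mul_of_nonneg_left (hprob G) (randomWeight_nonneg h0 h1 G)
    _ ≤ _ := by
        simp only [mul_add, Finset.sum_add_distrib]
        refine add_le_add (sum_randomWeight_card_le h0 h1 (by positivity)) ?_
        refine (sum_randomWeight_small_union_le h0 h1).trans_eq ?_
        push_cast
        rfl

/-! ### The reduction on hypergraphs with a dense part -/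

/-- Every set has only one blue element. -/
theorem card_le_of_covers {r n : ℕ} {G : Hypergraph r n} {j : ℕ} {c : List Bool}
    {F : Finset (Fin (edgeList G).length)} (h : (drawn G j c).Covers F) : 2 ^ j ≤ F.card := by
  have h1 : (F.biUnion (drawn G j c).blue).card ≤ F.card * 1 :=
    Finset.card_biUnion_le_card_mul _ _ _ fun i _ => by simp [drawn]
  have h2 : (Finset.univ : Finset (Fin (2 ^ j))).card = (F.biUnion (drawn G j c).blue).card :=
    congrArg Finset.card h.symm
  rwa [← h2, Finset.card_univ, Fintype.card_fin, mul_one] at h1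

/-- The edges inside the dense part `S` cover at most `k` red elements.  If they have all the
colours, then a `ρ`-approximate solution is cheap. -/
theorem IsReduction.le_dense {A : RandPolyTimeAlg Instance.encode} {r e : ℕ}
    {B : RandPolyTimeAlg (DvRInput.encode (r := r))} (hB : IsReduction A B e)
    {ρ : ℕ → ℕ → ℝ} (hA : ApproximatesOn A {I | 2 ≤ I.k ∧ I.k ≤ I.m} ρ) {n k : ℕ}
    (hk : 0 < k) {G : Hypergraph r n} {S : Finset (Fin n)} (hS : S.card = k)
    (hρ0 : 0 ≤ ρ G.card (2 ^ (2 * k.size)))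
    (hρ : (G.card * 2 ^ (2 * k.size) ≤ n ^ 3) →
      ρ G.card (2 ^ (2 * k.size)) * k < 2 ^ (2 * k.size))
    (hF : (2 : ℝ) ^ (2 * k.size) *
      (1 - 1 / 2 ^ (2 * k.size)) ^ (G.filter fun e => e.val ⊆ S).card ≤ 1 / 4) :
    1 - (1 / 2) ^ (2 * k.size) ≤ B.prob ⟨n, k, G⟩ saysDense := by
  obtain ⟨h1, h2, h3⟩ := hB n k G
  set F : Finset (Fin (edgeList G).length) := Finset.univ.filter fun i => edge G i ⊆ S with hFdef
  set D := ((edgeList G).length + n + k + 2) ^ e with hD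
  have hFcard : F.card = (G.filter fun e => e.val ⊆ S).card := card_filter_edge G (· ⊆ S)
  rw [← hFcard] at hF
  have hmem : ∀ i ∈ F, edge G i ⊆ S := fun i hi => (Finset.mem_filter.1 hi).2
  rw [B.prob_eq]
  by_cases hbig : n * (n * n) < (edgeList G).length * 2 ^ (2 * k.size)
  · have : ∀ c : List Bool, c.length = (DvRInput.encode ⟨n, k, G⟩).length ^ B.d + B.d →
        (1 : ℝ) ≤ ind (∃ t s, Runs B.prog (initStore (DvRInput.encode ⟨n, k, G⟩) c) t s ∧
          saysDense (s 2)) := fun c hc => (ind_of ((h3 c hc).2 (.inl hbig))).ge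
    have h := avg_mono this
    rw [avg_const] at h
    have : (0 : ℝ) ≤ (1 / 2) ^ (2 * k.size) := by positivity
    linarith
  · have hround : avg ((edgeList G).length * (2 * k.size) + D) (fun c =>
        ind ¬Accepts A.prog (edgeList G).length n (2 * k.size) D (incidence G) c) ≤ 1 / 2 := by
      refine avg_not_accepts_le A G k D h1 F hF fun u hcov => ?_
      have hsize : 0 < k.size := Nat.size_pos.2 hk
      have hb2 : 2 ≤ 2 ^ (2 * k.size) := by
        calc 2 = 2 ^ 1 := rfl
          _ ≤ 2 ^ (2 * k.size) := Nat.pow_le_pow_right (by norm_num) (by omega)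
      have hbm : 2 ^ (2 * k.size) ≤ (edgeList G).length := by
        refine (card_le_of_covers hcov).trans ((Finset.card_le_univ F).trans ?_)
        rw [Fintype.card_fin]
      refine (hA (drawn G (2 * k.size) u) ⟨hb2, hbm⟩ ⟨F, hcov⟩).trans ?_
      rw [A.prob_eq, A.prob_eq]
      refine avg_mono fun c _ => ind_mono ?_
      rintro ⟨t, s, hr, hs, hcost⟩
      refine ⟨t, s, hr, card_le_of_covers hs, ?_⟩
      have hF1 : (drawn G (2 * k.size) u).cost F ≤ k := by
        rw [← hS]
        refine Finset.card_le_card (Finset.biUnion_subset.2 fun i hi => ?_)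
        exact hmem i hi
      have h4 := hcost F hcov
      have h5 := hρ (by
        rw [← edgeList_length, pow_succ, pow_two]
        nlinarith [not_lt.1 hbig])
      have hm : (drawn G (2 * k.size) u).m = G.card := edgeList_length G
      have hk : (drawn G (2 * k.size) u).k = 2 ^ (2 * k.size) := rfl
      rw [hm, hk] at h4
      rw [hk]
      have h6 : (((drawn G (2 * k.size) u).cost ((drawn G (2 * k.size) u).decodeSol (s 2)) : ℕ) : ℝ)
          < 2 ^ (2 * k.size) := by
        refine (h4.trans ?_).trans_lt h5
        exact mul_le_mul_of_nonneg_left (by exact_mod_cast hF1) hρ0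
      exact_mod_cast h6
    have h := avg_forall_not_le
      (fun c => Accepts A.prog (edgeList G).length n (2 * k.size) D (incidence G) c)
      (fun c hc => accepts_take_iff A.prog G _ D c hc) hround (2 * k.size) _ h2
    have h4 : 1 - (1 / 2) ^ (2 * k.size) ≤
        avg ((DvRInput.encode ⟨n, k, G⟩).length ^ B.d + B.d) fun c =>
          ind ¬(∀ i < 2 * k.size, ¬Accepts A.prog (edgeList G).length n (2 * k.size) D
            (incidence G) (c.drop (i * ((edgeList G).length * (2 * k.size) + D)))) := by
      rw [avg_ind_not]
      linarith
    refine h4.trans (avg_mono fun c hc => ind_mono fun h => (h3 c hc).2 (.inr ?_))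
    push Not at h
    exact h

/-! ### Choice of the parameters -/

theorem RandPolyTimeAlg.prob_mono {Inst : Type} {encode : Inst → List Bool}
    (A : RandPolyTimeAlg encode) (I : Inst) {E E' : List Bool → Prop}
    (h : ∀ out, E out → E' out) : A.prob I E ≤ A.prob I E' := by
  rw [A.prob_eq, A.prob_eq]
  refine avg_mono fun c _ => ind_mono ?_
  rintro ⟨t, s, hr, hs⟩
  exact ⟨t, s, hr, h _ hs⟩

theorem ApproximatesOn.mono {A : RandPolyTimeAlg Instance.encode} {P : Set Instance}
    {ρ ρ' : ℕ → ℕ → ℝ} (hA : ApproximatesOn A P ρ) (h : ∀ I ∈ P, ρ I.m I.k ≤ ρ' I.m I.k) :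
    ApproximatesOn A P ρ' := fun I hI hF =>
  (hA I hI hF).trans <| A.prob_mono I fun _ ho =>
    ⟨ho.1, fun F hF => (ho.2 F hF).trans (mul_le_mul_of_nonneg_right (h I hI) (by positivity))⟩

theorem eventually_le_rpow (M : ℝ) {c : ℝ} (hc : 0 < c) : ∀ᶠ n : ℕ in atTop, M ≤ (n : ℝ) ^ c :=
  ((tendsto_rpow_atTop hc).comp tendsto_natCast_atTop_atTop).eventually_ge_atTop M

theorem sq_lt_two_pow (k : ℕ) : k ^ 2 < 2 ^ (2 * k.size) := by
  rw [mul_comm, pow_mul]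
  exact Nat.pow_lt_pow_left (Nat.lt_size_self k) (by norm_num)

theorem two_pow_le_sq {k : ℕ} (hk : 0 < k) : 2 ^ (2 * k.size) ≤ 4 * k ^ 2 := by
  obtain ⟨s, hs⟩ := Nat.exists_eq_succ_of_ne_zero (Nat.size_pos.2 hk).ne'
  have h := two_pow_size_le k
  have h2 : 2 ^ k.size ≤ 2 * k := by
    rw [hs, pow_succ] at h ⊢
    omega
  calc 2 ^ (2 * k.size) = (2 ^ k.size) ^ 2 := by rw [mul_comm, pow_mul]
    _ ≤ (2 * k) ^ 2 := Nat.pow_le_pow_left h2 2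
    _ = 4 * k ^ 2 := by ring

/-- The size `⌊n ^ a⌋` of the dense part. -/
noncomputable def denseSize (a : ℝ) (n : ℕ) : ℕ := ⌊(n : ℝ) ^ a⌋₊

theorem denseSize_le (a : ℝ) (n : ℕ) : (denseSize a n : ℝ) ≤ (n : ℝ) ^ a :=
  Nat.floor_le (by positivity)

theorem denseSize_pos {a : ℝ} (ha : 0 ≤ a) {n : ℕ} (hn : 0 < n) : 0 < denseSize a n :=
  Nat.floor_pos.2 (Real.one_le_rpow (by exact_mod_cast hn) ha)

theorem rpow_le_denseSize {a : ℝ} (ha : 0 ≤ a) {n : ℕ} (hn : 0 < n) :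
    (n : ℝ) ^ a ≤ 2 * denseSize a n := by
  have h1 : (n : ℝ) ^ a < denseSize a n + 1 := Nat.lt_floor_add_one _
  have h2 : (1 : ℝ) ≤ denseSize a n := by exact_mod_cast denseSize_pos ha hn
  linarith

theorem eventually_le_denseSize (M : ℝ) {a : ℝ} (ha : 0 < a) :
    ∀ᶠ n : ℕ in atTop, M ≤ denseSize a n := by
  filter_upwards [eventually_le_rpow (2 * M) ha, eventually_gt_atTop 0] with n h hn
  linarith [rpow_le_denseSize ha.le hn]

theorem two_pow_le_rpow {a : ℝ} (ha : 0 ≤ a) {n : ℕ} (hn : 0 < n) :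
    (2 : ℝ) ^ (2 * (denseSize a n).size) ≤ 4 * (n : ℝ) ^ (2 * a) := by
  have h : (2 : ℝ) ^ (2 * (denseSize a n).size) ≤ 4 * (denseSize a n : ℝ) ^ 2 := by
    exact_mod_cast two_pow_le_sq (denseSize_pos ha hn)
  refine h.trans ?_
  rw [mul_comm 2 a, Real.rpow_mul (by positivity), Real.rpow_two]
  have := denseSize_le a n
  gcongr

theorem eventually_two_pow_le {a : ℝ} (ha : 0 ≤ a) (ha' : a < 1 / 2) :
    ∀ᶠ n : ℕ in atTop, 2 ^ (2 * (denseSize a n).size) ≤ n := by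
  filter_upwards [eventually_le_rpow 4 (show 0 < 1 - 2 * a by linarith),
    eventually_gt_atTop 0] with n h hn
  have h0 : (0 : ℝ) < n := by exact_mod_cast hn
  have : (2 : ℝ) ^ (2 * (denseSize a n).size) ≤ n := by
    calc _ ≤ 4 * (n : ℝ) ^ (2 * a) := two_pow_le_rpow ha hn
      _ ≤ (n : ℝ) ^ (1 - 2 * a) * (n : ℝ) ^ (2 * a) := by gcongr
      _ = n := by rw [← Real.rpow_add h0]; simp
  exact_mod_cast this

/-- The error on random hypergraphs tends to `0`. -/
theorem eventually_random_le {η : ℝ} (hη : 0 < η) (hη' : η < 1 / 2) {r : ℕ} (hr : 5 ≤ 2 * η * r)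
    {δ : ℝ} (hδ : 0 < δ) : ∀ᶠ n : ℕ in atTop,
      (n : ℝ) ^ r * (n : ℝ) ^ (1 + η - ((r : ℝ) - 1)) /
          (n ^ 3 / 2 ^ (2 * (denseSize (1 / 2 - η) n).size)) +
        (n * (2 ^ (2 * (denseSize (1 / 2 - η) n).size)) ^ r * (n : ℝ) ^ (1 + η - ((r : ℝ) - 1))) ^
          2 ^ (2 * (denseSize (1 / 2 - η) n).size) ≤ δ := by
  filter_upwards [eventually_le_rpow (8 / δ) hη,
    eventually_le_rpow (4 ^ r * (1 + 2 / δ)) one_pos, eventually_gt_atTop 0] with n h1 h2 hn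
  have h0 : (0 : ℝ) < n := by exact_mod_cast hn
  have hb := two_pow_le_rpow (show (0 : ℝ) ≤ 1 / 2 - η by linarith) hn
  set b := 2 ^ (2 * (denseSize (1 / 2 - η) n).size) with hbdef
  have hb' : (2 : ℝ) ^ (2 * (denseSize (1 / 2 - η) n).size) = (b : ℕ) := by simp [hbdef]
  rw [hb'] at hb ⊢
  have hb0 : b ≠ 0 := by positivity
  have first : (n : ℝ) ^ r * (n : ℝ) ^ (1 + η - ((r : ℝ) - 1)) / (n ^ 3 / b) ≤ δ / 2 := by
    have e : (n : ℝ) ^ r * (n : ℝ) ^ (1 + η - ((r : ℝ) - 1)) * (4 * (n : ℝ) ^ (2 * (1 / 2 - η))) =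
        4 * n ^ 3 * (n : ℝ) ^ (-η) := by
      rw [← Real.rpow_natCast, ← Real.rpow_natCast]
      have : ∀ x y z : ℝ, x * y * (4 * z) = 4 * (x * y * z) := fun x y z => by ring
      rw [this, mul_assoc 4, ← Real.rpow_add h0, ← Real.rpow_add h0, ← Real.rpow_add h0]
      congr 2
      push_cast
      ring
    rw [div_div_eq_mul_div, div_le_iff₀ (by positivity)]
    calc _ ≤ (n : ℝ) ^ r * (n : ℝ) ^ (1 + η - ((r : ℝ) - 1)) *
          (4 * (n : ℝ) ^ (2 * (1 / 2 - η))) := by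
          gcongr
      _ = 4 * n ^ 3 * (n : ℝ) ^ (-η) := e
      _ ≤ δ / 2 * n ^ 3 := by
          rw [Real.rpow_neg h0.le, ← div_eq_mul_inv, div_le_iff₀ (by positivity)]
          rw [div_le_iff₀ hδ] at h1
          have : (0 : ℝ) < n ^ 3 := by positivity
          nlinarith
  have second : n * (b : ℝ) ^ r * (n : ℝ) ^ (1 + η - ((r : ℝ) - 1)) ≤ 4 ^ r / n := by
    calc _ ≤ n * (4 * (n : ℝ) ^ (2 * (1 / 2 - η))) ^ r * (n : ℝ) ^ (1 + η - ((r : ℝ) - 1)) := by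
          gcongr
      _ = 4 ^ r * ((n : ℝ) ^ (1 : ℝ) * (n : ℝ) ^ (2 * (1 / 2 - η) * r) *
            (n : ℝ) ^ (1 + η - ((r : ℝ) - 1))) := by
          rw [mul_pow, Real.rpow_mul h0.le _ (r : ℝ), Real.rpow_natCast, Real.rpow_one]
          ring
      _ ≤ 4 ^ r * (n : ℝ) ^ (-1 : ℝ) := by
          rw [← Real.rpow_add h0, ← Real.rpow_add h0]
          gcongr
          · exact_mod_cast hn
          · nlinarith
      _ = 4 ^ r / n := by rw [Real.rpow_neg_one, div_eq_mul_inv]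
  rw [Real.rpow_one] at h2
  have hδ' : 0 < 2 / δ := by positivity
  have h4 : (0 : ℝ) < 4 ^ r := by positivity
  have third : (4 : ℝ) ^ r / n ≤ 1 := by
    rw [div_le_one h0]
    nlinarith
  have fourth : (4 : ℝ) ^ r / n ≤ δ / 2 := by
    rw [div_le_iff₀ h0]
    have e : δ * (2 / δ) = 2 := by field_simp
    calc (4 : ℝ) ^ r = δ / 2 * (4 ^ r * (2 / δ)) := by linear_combination -(4 ^ r / 2) * e
      _ ≤ δ / 2 * n := by
        gcongr
        nlinarith
  have := (pow_le_of_le_one (by positivity) (second.trans third) hb0).trans (second.trans fourth)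
  linarith

/-- The edges in the dense part are likely to meet all `2 ^ (2 * k.size)` colours. -/
theorem eventually_dense_le {a η : ℝ} (ha : 0 < a) (hη : 0 < η) {r : ℕ} (hr : 0 < r) :
    ∀ᶠ n : ℕ in atTop, ∀ M : ℕ,
      (denseSize a n : ℝ) ^ (1 + η / 2) ≤ r * M / denseSize a n →
      (2 : ℝ) ^ (2 * (denseSize a n).size) *
        (1 - 1 / 2 ^ (2 * (denseSize a n).size)) ^ M ≤ 1 / 4 := by
  have hr' : (0 : ℝ) < r := by exact_mod_cast hr
  have hK : Tendsto (fun n => (denseSize a n : ℝ) ^ (η / 2)) atTop atTop :=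
    (tendsto_rpow_atTop (by positivity)).comp
      (tendsto_atTop.2 fun M => eventually_le_denseSize M ha)
  have hexp := (isLittleO_rpow_exp_pos_mul_atTop (4 / η) (show 0 < 1 / (4 * (r : ℝ)) by
    positivity)).bound (show (0 : ℝ) < 1 / 16 by norm_num)
  filter_upwards [hK.eventually hexp, eventually_le_denseSize 1 ha] with n h1 h2 M hM
  set K : ℝ := ((denseSize a n : ℕ) : ℝ) with hKdef
  have hK0 : 0 < K := by linarith
  have hb : (2 : ℝ) ^ (2 * (denseSize a n).size) ≤ 4 * K ^ 2 := by
    have h2' : 0 < denseSize a n := by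
      rw [hKdef] at hK0
      exact_mod_cast hK0
    rw [hKdef]
    exact_mod_cast two_pow_le_sq h2'
  set b : ℝ := (2 : ℝ) ^ (2 * (denseSize a n).size) with hbdef
  have hb0 : 0 < b := by positivity
  have hb1 : 1 ≤ b := one_le_pow₀ (by norm_num)
  have hMb : K ^ (η / 2) / (4 * r) ≤ M / b := by
    rw [le_div_iff₀ hK0, add_comm, Real.rpow_add hK0, Real.rpow_one] at hM
    rw [div_le_div_iff₀ (by positivity) hb0]
    calc K ^ (η / 2) * b ≤ K ^ (η / 2) * (4 * K ^ 2) := by gcongr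
      _ ≤ M * (4 * r) := by linear_combination 4 * hM
  rw [← Real.rpow_mul hK0.le, show η / 2 * (4 / η) = (2 : ℕ) by field_simp; norm_num,
    Real.rpow_natCast, Real.norm_of_nonneg (by positivity),
    Real.norm_of_nonneg (by positivity)] at h1
  have h3 : (1 - 1 / b) ^ M ≤ Real.exp (-(K ^ (η / 2) / (4 * r))) := by
    calc (1 - 1 / b) ^ M ≤ Real.exp (-(1 / b)) ^ M := by
          have h5 : 1 / b ≤ 1 := by rw [div_le_one hb0]; exact hb1
          have := Real.add_one_le_exp (-(1 / b))
          exact pow_le_pow_left₀ (by linarith) (by linarith) _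
      _ = Real.exp (-(M / b)) := by rw [← Real.exp_nat_mul]; congr 1; ring
      _ ≤ _ := Real.exp_le_exp.2 (by linarith)
  calc b * (1 - 1 / b) ^ M ≤ 4 * K ^ 2 * Real.exp (-(K ^ (η / 2) / (4 * r))) := by
        have h5 : 1 / b ≤ 1 := by rw [div_le_one hb0]; exact hb1
        have : 0 ≤ (1 - 1 / b) ^ M := pow_nonneg (by linarith) _
        gcongr
    _ ≤ 1 / 4 := by
        rw [Real.exp_neg, ← div_eq_mul_inv, div_le_iff₀ (Real.exp_pos _)]
        rw [one_div_mul_eq_div (4 * (r : ℝ))] at h1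
        linarith

/-- When there are few edges, the approximation ratio is too small to bridge the gap between the
costs of the solutions in the two cases. -/
theorem eventually_ratio_lt {ε C : ℝ} (hε : 0 < ε) (hε' : ε ≤ 1 / 16) (hC : 0 < C) :
    ∀ᶠ n : ℕ in atTop, ∀ m : ℕ, m * 2 ^ (2 * (denseSize (1 / 2 - ε / 2) n).size) ≤ n ^ 3 →
      max 1 (C * (m : ℝ) ^ (1 / 4 - ε) /
        Real.logb 2 ((2 ^ (2 * (denseSize (1 / 2 - ε / 2) n).size) : ℕ) : ℝ) ^ 2) *
          denseSize (1 / 2 - ε / 2) n < 2 ^ (2 * (denseSize (1 / 2 - ε / 2) n).size) := by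
  have ha : 0 < 1 / 2 - ε / 2 := by linarith
  filter_upwards [eventually_le_rpow (8 * C) hε, eventually_gt_atTop 0] with n h1 hn m hm
  have h0 : (0 : ℝ) < n := by exact_mod_cast hn
  have hK := denseSize_pos ha.le hn
  have hnK := rpow_le_denseSize ha.le hn
  have hsq := sq_lt_two_pow (denseSize (1 / 2 - ε / 2) n)
  have hsize := Nat.size_pos.2 hK
  set k := denseSize (1 / 2 - ε / 2) n with hk
  have hsq' : (k : ℝ) ^ 2 < 2 ^ (2 * k.size) := by exact_mod_cast hsq
  have hK' : (1 : ℝ) ≤ k := by exact_mod_cast hK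
  have hlog : 1 ≤ Real.logb 2 ((2 ^ (2 * k.size) : ℕ) : ℝ) ^ 2 := by
    push_cast
    rw [← Real.rpow_natCast 2, Real.logb_rpow (by norm_num) (by norm_num)]
    exact one_le_pow₀ (by exact_mod_cast (by omega : 1 ≤ 2 * k.size))
  have hm' : (m : ℝ) ≤ 4 * (n : ℝ) ^ (2 + ε) := by
    have e1 : (m : ℝ) * k ^ 2 ≤ n ^ 3 := by
      exact_mod_cast (Nat.mul_le_mul_left m hsq.le).trans hm
    have e2 : (n : ℝ) ^ 3 = (n : ℝ) ^ (2 + ε) * ((n : ℝ) ^ (1 / 2 - ε / 2)) ^ 2 := by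
      rw [← Real.rpow_natCast, ← Real.rpow_natCast, ← Real.rpow_mul h0.le, ← Real.rpow_add h0]
      congr 1
      push_cast
      ring
    have e3 : ((n : ℝ) ^ (1 / 2 - ε / 2)) ^ 2 ≤ 4 * k ^ 2 := by
      calc _ ≤ (2 * (k : ℝ)) ^ 2 := by gcongr
        _ = _ := by ring
    have e4 : (m : ℝ) * k ^ 2 ≤ 4 * (n : ℝ) ^ (2 + ε) * k ^ 2 := by
      calc _ ≤ (n : ℝ) ^ 3 := e1
        _ ≤ (n : ℝ) ^ (2 + ε) * (4 * k ^ 2) := by rw [e2]; gcongr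
        _ = _ := by ring
    exact le_of_mul_le_mul_right e4 (by positivity)
  have hρ : C * (m : ℝ) ^ (1 / 4 - ε) ≤ k := by
    have e1 : (m : ℝ) ^ (1 / 4 - ε) ≤ 4 * (n : ℝ) ^ (1 / 2 - ε / 2 - ε) := by
      calc (m : ℝ) ^ (1 / 4 - ε) ≤ (4 * (n : ℝ) ^ (2 + ε)) ^ (1 / 4 - ε) :=
            Real.rpow_le_rpow (by positivity) hm' (by linarith)
        _ = 4 ^ (1 / 4 - ε) * (n : ℝ) ^ ((2 + ε) * (1 / 4 - ε)) := by
            rw [Real.mul_rpow (by norm_num) (by positivity), ← Real.rpow_mul h0.le]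
        _ ≤ 4 ^ (1 : ℝ) * (n : ℝ) ^ (1 / 2 - ε / 2 - ε) := by
            gcongr
            · norm_num
            · linarith
            · exact_mod_cast hn
            · nlinarith
        _ = _ := by rw [Real.rpow_one]
    rw [Real.rpow_sub h0, mul_div_assoc', le_div_iff₀ (by positivity)] at e1
    have e2 : C * (m : ℝ) ^ (1 / 4 - ε) * 8 ≤ 8 * k := by
      calc C * (m : ℝ) ^ (1 / 4 - ε) * 8 = (m : ℝ) ^ (1 / 4 - ε) * (8 * C) := by ring
        _ ≤ (m : ℝ) ^ (1 / 4 - ε) * (n : ℝ) ^ ε := by gcongr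
        _ ≤ 4 * (n : ℝ) ^ (1 / 2 - ε / 2) := e1
        _ ≤ 8 * k := by linarith
    linarith
  have hmax : max 1 (C * (m : ℝ) ^ (1 / 4 - ε) /
      Real.logb 2 ((2 ^ (2 * k.size) : ℕ) : ℝ) ^ 2) ≤ k :=
    max_le hK' ((div_le_self (by positivity) hlog).trans hρ)
  calc _ ≤ (k : ℝ) * k := by gcongr
    _ = (k : ℝ) ^ 2 := by ring
    _ < _ := hsq'

/-- An approximation algorithm for Red-Blue Set Cover contradicts the conjecture for
`α = 1 + ε / 2`, `k = ⌊n ^ (1 / 2 - ε / 2)⌋` and uniformity `r ≥ 5 / ε`. -/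
theorem solvesDvR {A : RandPolyTimeAlg Instance.encode} {ε C ε' : ℝ} (hε : 0 < ε)
    (hε' : ε ≤ 1 / 16) (hC : 0 < C)
    (hA : ApproximatesOn A {I : Instance | 2 ≤ I.k ∧ I.k ≤ I.m}
      (fun m k => max 1 (C * (m : ℝ) ^ (1 / 4 - ε) / Real.logb 2 (k : ℝ) ^ 2)))
    {r : ℕ} (hr : 5 ≤ ε * r) (hεε : ε' ≤ ε / 4) {e : ℕ}
    {B : RandPolyTimeAlg (DvRInput.encode (r := r))} (hB : IsReduction A B e) :
    SolvesDvR B (1 + ε / 2) (1 + ε / 2 - ε') (denseSize (1 / 2 - ε / 2)) := by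
  have ha : 0 < 1 / 2 - ε / 2 := by linarith
  have hr0 : (5 : ℝ) ≤ r := by nlinarith
  intro δ hδ
  filter_upwards [eventually_random_le (half_pos hε) (by linarith) (r := r) (by linarith) hδ,
    eventually_dense_le ha (half_pos hε) (r := r) (by
      have : (0 : ℝ) < r := by linarith
      exact_mod_cast this),
    eventually_ratio_lt hε hε' hC, eventually_two_pow_le ha.le (by linarith),
    eventually_gt_atTop 0, eventually_le_denseSize (1 / δ) ha] with n h1 h2 h3 h4 hn h5
  have hK := denseSize_pos ha.le hn
  constructor
  · refine (hB.random_le h4 (by positivity) ?_).trans h1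
    exact Real.rpow_le_one_of_one_le_of_nonpos (by exact_mod_cast hn) (by linarith)
  · rintro G ⟨S, hS, hd⟩
    refine le_trans ?_ (hB.le_dense hA hK hS (zero_le_one.trans (le_max_left _ _)) (h3 _)
      (h2 _ ?_))
    · have e1 : (denseSize (1 / 2 - ε / 2) n : ℝ) ^ 2 <
          2 ^ (2 * (denseSize (1 / 2 - ε / 2) n).size) := by
        exact_mod_cast sq_lt_two_pow _
      rw [one_div_pow]
      have e2 : (1 : ℝ) ≤ denseSize (1 / 2 - ε / 2) n := by exact_mod_cast hK
      have : 1 / (2 : ℝ) ^ (2 * (denseSize (1 / 2 - ε / 2) n).size) ≤ δ := by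
        rw [div_le_iff₀ (by positivity)]
        rw [div_le_iff₀ hδ] at h5
        nlinarith
      linarith
    · rw [avgDegree, hS] at hd
      refine le_trans ?_ hd
      exact Real.rpow_le_rpow_of_exponent_le (by exact_mod_cast hK) (by linarith)

end RedBlue

theorem theorem4 (hconj : RedBlue.HypergraphDenseVsRandomConjecture)
    (ε : ℝ) (hε : 0 < ε) (C : ℝ) (hC : 0 < C) :
    ¬ ∃ A : RedBlue.RandPolyTimeAlg RedBlue.Instance.encode,
      RedBlue.ApproximatesOn A {I : RedBlue.Instance | 2 ≤ I.k ∧ I.k ≤ I.m}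
        (fun m k => max 1 (C * (m : ℝ) ^ (1 / 4 - ε) / Real.logb 2 (k : ℝ) ^ 2)) := by
  rintro ⟨A, hA⟩
  -- The assumption becomes weaker when `ε` decreases.
  obtain ⟨ε₁, hε₁, hle, hA⟩ : ∃ ε₁ : ℝ, 0 < ε₁ ∧ ε₁ ≤ 1 / 16 ∧
      RedBlue.ApproximatesOn A {I : RedBlue.Instance | 2 ≤ I.k ∧ I.k ≤ I.m}
        (fun m k => max 1 (C * (m : ℝ) ^ (1 / 4 - ε₁) / Real.logb 2 (k : ℝ) ^ 2)) := by
    refine ⟨min ε (1 / 16), by positivity, min_le_right _ _, hA.mono ?_⟩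
    rintro I ⟨h1, h2⟩
    have : (1 : ℝ) ≤ I.m := by exact_mod_cast (by omega : 1 ≤ I.m)
    gcongr
    exact min_le_left _ _
  obtain ⟨r, hr⟩ := exists_nat_ge (5 / ε₁)
  rw [div_le_iff₀' hε₁] at hr
  have hr0 : (5 : ℝ) ≤ r := by nlinarith
  obtain ⟨ε₀, hε₀, h⟩ := hconj r (1 + ε₁ / 2) (by linarith) (by linarith)
  obtain ⟨B, e, hB⟩ := RedBlue.exists_isReduction A r
  have hmin : 0 < min (ε₀ / 2) (ε₁ / 4) := by positivity
  refine h (min (ε₀ / 2) (ε₁ / 4)) hmin ((min_le_left _ _).trans_lt (by linarith))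
    (RedBlue.denseSize (1 / 2 - ε₁ / 2)) ⟨1 / 4, by norm_num, ?_⟩ ?_
    ⟨B, RedBlue.solvesDvR hε₁ hle hC hA hr (min_le_right _ _) hB⟩
  -- `k` grows polynomially because its exponent exceeds `1 / 4`.
  · filter_upwards [RedBlue.eventually_le_rpow 2 (show 0 < 1 / 4 - ε₁ / 2 by linarith),
      eventually_gt_atTop 0] with n h1 hn
    have h0 : (0 : ℝ) < n := by exact_mod_cast hn
    have h2 := RedBlue.rpow_le_denseSize (show (0 : ℝ) ≤ 1 / 2 - ε₁ / 2 by linarith) hn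
    rw [show 1 / 2 - ε₁ / 2 = 1 / 4 + (1 / 4 - ε₁ / 2) by ring, Real.rpow_add h0] at h2
    rw [show 1 / 2 - ε₁ / 2 = 1 / 4 + (1 / 4 - ε₁ / 2) by ring]
    have h3 : (0 : ℝ) < (n : ℝ) ^ (1 / 4 : ℝ) := by positivity
    nlinarith
  -- The required upper bound for `k` follows from `k ≤ n ^ (1 / 2)`.
  · intro n
    rcases n.eq_zero_or_pos with rfl | hn
    · have : RedBlue.denseSize (1 / 2 - ε₁ / 2) 0 = 0 := by
        rw [RedBlue.denseSize, Nat.cast_zero, Real.zero_rpow (by linarith), Nat.floor_zero]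
      have h1 := min_le_right (ε₀ / 2) (ε₁ / 4)
      rw [this, Nat.cast_zero, Real.zero_rpow (by linarith)]
      positivity
    · have h0 : (1 : ℝ) ≤ n := by exact_mod_cast hn
      have h1 := min_le_right (ε₀ / 2) (ε₁ / 4)
      calc _ ≤ ((n : ℝ) ^ (1 / 2 - ε₁ / 2)) ^ (1 + (1 + ε₁ / 2) - min (ε₀ / 2) (ε₁ / 4)) :=
            Real.rpow_le_rpow (by positivity) (RedBlue.denseSize_le _ n) (by linarith)
        _ = (n : ℝ) ^ ((1 / 2 - ε₁ / 2) * (1 + (1 + ε₁ / 2) - min (ε₀ / 2) (ε₁ / 4))) := by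
            rw [Real.rpow_mul (by positivity)]
        _ ≤ _ := Real.rpow_le_rpow_of_exponent_le h0 (by nlinarith)
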